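/- Let $G$ be a complex semisimple algebraic group with Lie algebra $\mathfrak g$, let $\mathfrak h\subset\mathfrak b$ be a Cartan subalgebra and a Borel subalgebra of $\mathfrak g$, let $\Delta$ be the set of roots of $(\mathfrak g,\mathfrak h)$, $\Delta_+$ the set of roots of $\mathfrak b$ (the positive roots), and $W$ the Weyl group. Choose a nonzero root vector $e_\alpha\in\mathfrak g_\alpha$ for every $\alpha\in\Delta$, and a nondegenerate invariant symmetric bilinear form $\kappa$ on $\mathfrak g$. Every $y\in\mathfrak g$ is uniquely of the form $y=h+\sum_{\alpha\in\Delta}c_\alpha e_\alpha$ with $h\in\mathfrak h$, $c_\alpha\in\mathbb C$; put $h(y)=h$, $c_\alpha(y)=c_\alpha$, $\widehat h_\alpha(y)=\alpha(h)$ and $\widehat e_\alpha(y)=c_{-\alpha}$. For a linear subspace $\mathfrak h\subset U\subset\mathfrak g$ let $U'=\{y\in U:\alpha(h(y))\ne0\ \forall\alpha\in\Delta\}$, and let $\mathbb C[U]'$ be the localization of the algebra of polynomial functions on $U$ at the products of the $\widehat h_\alpha$, regarded as an algebra of functions on $U'$. The algebra $\mathbb C[\mathfrak g]'$ carries the Kirillov--Kostant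 Poisson bracket obtained by identifying $\mathfrak g^*$ with $\mathfrak g$ by $\kappa$, so that $\{\kappa(x,\cdot),\kappa(z,\cdot)\}=\kappa([x,z],\cdot)$. For $w\in W$ let $\Delta_w=\{\alpha\in\Delta_+: w^{-1}\alpha<0\}$; let $\mathfrak n_w$ be the Lie subalgebra generated by the $e_\alpha$, $\alpha\in\Delta_w$, let $N_w\subset G$ be the corresponding subgroup, let $\mathfrak n^w_1$ be the Lie subalgebra generated by the $e_\alpha$, $\alpha\in w(\Delta_+\setminus\Delta_{w^{-1}})$, and let $\mathfrak b^w$ be the Borel subalgebra generated by $\mathfrak h$ and the $e_\alpha$, $\alpha\in w\Delta_+$. (1) For every $w\in W$ the adjoint action restricts to a map $N_w\times(\mathfrak h+\mathfrak n^w_1)\to\mathfrak b$, which is a birational equivalence. (2) Let $\beta_1,\dots,\beta_N$ be a normal ordering of $\Delta_+$ (if $\gamma=\alpha+\beta$ with $\alpha,\beta,\gamma\in\Delta_+$, then $\gamma$ stands between $\alpha$ and $\beta$) such that $w=s_{\beta_k}\cdots s_{\beta_N}$. For $y\in\mathfrak b'$ put $y^0=y$ and $y^{i}=\mathrm{Ad}\,\exp\Big(\frac{c_{\beta_{N-i+1}}(y^{i-1})}{\beta_{N-i+1}(h(y^{i-1}))}\,e_{\beta_{N-i+1}}\Big)\,y^{i-1}$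 for $1\le i\le N-k+1$. Then $y^{N-k+1}\in(\mathfrak b^w)'$, and $(Q_wf)(y)=f(y^{N-k+1})$ defines a linear operator $Q_w:\mathbb C[\mathfrak b^w]'\to\mathbb C[\mathfrak b]'$. Its image is the space $\mathbb C[\mathfrak b]'^{N_w}$ of the elements that are invariant under the adjoint action of $N_w$, and its kernel is the ideal of $\mathbb C[\mathfrak b^w]'$ generated by the $\widehat e_\alpha$, $\alpha\in\Delta_w$. (3) In the situation of (2) put $w_j=s_{\beta_j}\cdots s_{\beta_N}$ for $k\le j\le N$ and $w_{N+1}=1$. Then $Q_w=Q_{\beta_N}\circ\cdots\circ Q_{\beta_k}$ for linear operators $Q_{\beta_j}:\mathbb C[\mathfrak b^{w_j}]'\to\mathbb C[\mathfrak b^{w_{j+1}}]'$ which, for $\alpha=\beta_j$, are given by $$Q_\alpha f=\sum_{n=0}^\infty\frac{(-1)^n}{n!}\,\widehat h_\alpha^{-n}\,\big(\kappa(e_\alpha,e_{-\alpha})\,\widehat e_{-\alpha}\big)^n\,\underbrace{\{\widehat e_\alpha,\{\widehat e_\alpha,\dots,\{\widehat e_\alpha}_{n},\widetilde f\}\dots\}\}\Big|_{(\mathfrak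 b^{w_{j+1}})'},$$ where $\widetilde f\in\mathbb C[\mathfrak g]'$ is any element whose restriction to $(\mathfrak b^{w_j})'$ is $f$; after the restriction only finitely many terms of the series are nonzero. The factor $\kappa(e_\alpha,e_{-\alpha})$ is $1$ if the normalization is such that $\{\widehat e_\alpha,\widehat e_{-\alpha}\}=\widehat h_\alpha$. -/

import Mathlib

open LieAlgebra LieAlgebra.IsKilling

attribute [local instance] LieRing.ofAssociativeRing

namespace Zhelobenko

noncomputable section

/-! ### Irreducible affine varieties and birational equivalences -/

section Varieties

variable {X Y : Type*}

/-- A set `X` together with an algebra `A` of complex functions on it is an irreducible affine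
variety with coordinate ring `A`: the algebra is finitely generated, is a domain, and every
character of `A` is the evaluation at exactly one point of `X`. -/
structure IsIrreducibleAffineVariety (A : Subalgebra ℂ (X → ℂ)) : Prop where
  fg : A.FG
  isDomain : IsDomain A
  existsUnique_point : ∀ χ : A →ₐ[ℂ] ℂ, ∃! x : X, ∀ f : A, χ f = (f : X → ℂ) x

/-- A regular map `φ : X → Y` between irreducible affine varieties with coordinate rings `A` and
`C` is a birational equivalence: it restricts to an isomorphism from a nonempty principal open
subset `{p ≠ 0}` of `X` onto a nonempty principal open subset `{q ≠ 0}` of `Y`. The last clause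
says that each regular function on `X`, composed with the inverse map, has the form `g / q ^ m`
with `g` regular on `Y`. -/
structure IsBirationalEquiv (A : Subalgebra ℂ (X → ℂ)) (C : Subalgebra ℂ (Y → ℂ))
    (φ : X → Y) : Prop where
  source : IsIrreducibleAffineVariety A
  target : IsIrreducibleAffineVariety C
  regular : ∀ f ∈ C, f ∘ φ ∈ A
  birational : ∃ p ∈ A, ∃ q ∈ C, p ≠ 0 ∧ q ≠ 0 ∧
    Set.BijOn φ {x | p x ≠ 0} {y | q y ≠ 0} ∧
    ∀ f ∈ A, ∃ m : ℕ, ∃ g ∈ C, ∀ x, p x ≠ 0 → f x * q (φ x) ^ m = g (φ x)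

/-- The algebra of regular (polynomial) functions on a complex vector space. -/
def polyFun (E : Type*) [AddCommGroup E] [Module ℂ E] : Subalgebra ℂ (E → ℂ) :=
  Algebra.adjoin ℂ (Set.range fun ℓ : Module.Dual ℂ E => (ℓ : E → ℂ))

end Varieties

/-! ### Root vectors, Borel subalgebras, functions on them, and the Poisson bracket -/

section LieAlgebra

variable {L : Type*} [LieRing L] [LieAlgebra ℂ L] [FiniteDimensional ℂ L] [IsKilling ℂ L]
  {H : LieSubalgebra ℂ L} [H.IsCartanSubalgebra]

/-- A choice of a nonzero root vector `e_α` in every root space. -/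
structure RootVectors (H : LieSubalgebra ℂ L) [H.IsCartanSubalgebra] where
  vec : H.root → L
  mem : ∀ α : H.root, vec α ∈ rootSpace H (α : LieModule.Weight ℂ H L)
  ne_zero : ∀ α, vec α ≠ 0

/-- The root `-α`. -/
def negRoot (α : H.root) : H.root :=
  ⟨-(α : LieModule.Weight ℂ H L), by
    have h := α.2
    simp only [LieSubalgebra.root, Finset.mem_filter, Finset.mem_univ, true_and] at h ⊢
    exact h.neg⟩

namespace RootVectors

variable (e : RootVectors H)

/-- The linear map `(h, c) ↦ h + ∑ α, c α • e_α`. -/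
def sumMap : (H × (H.root → ℂ)) →ₗ[ℂ] L :=
  (H.subtype : H →ₗ[ℂ] L).coprod (Fintype.linearCombination ℂ e.vec)

lemma sumMap_apply (h : H) (c : H.root → ℂ) :
    e.sumMap (h, c) = (h : L) + ∑ α, c α • e.vec α := by
  simp [sumMap, Fintype.linearCombination_apply]

lemma sumMap_bijective : Function.Bijective e.sumMap := by
  classical
  have hind := LieModule.iSupIndep_genWeightSpace' ℂ H L
  have hind' : iSupIndep fun χ : LieModule.Weight ℂ H L =>
      (LieModule.genWeightSpace L χ).toSubmodule :=
    LieSubmodule.iSupIndep_toSubmodule.mpr hind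
  have hzero : ∀ x : L, x ∈ H ↔ x ∈ rootSpace H (0 : H → ℂ) := fun x => by
    rw [← LieSubalgebra.mem_toLieSubmodule, rootSpace_zero_eq]
  constructor
  · rw [← LinearMap.ker_eq_bot, LinearMap.ker_eq_bot']
    rintro ⟨h, c⟩ hc
    rw [sumMap_apply] at hc
    have hroot : ∀ α : H.root, c α • e.vec α = 0 := by
      intro α
      have hdisj := hind' (α : LieModule.Weight ℂ H L)
      refine (Submodule.disjoint_def.mp hdisj) _ (Submodule.smul_mem _ _ (e.mem α)) ?_
      have hα : c α • e.vec α = -((h : L) + ∑ β ∈ Finset.univ.erase α, c β • e.vec β) := by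
        rw [← Finset.add_sum_erase _ _ (Finset.mem_univ α)] at hc
        rw [eq_neg_iff_add_eq_zero, ← hc]
        abel
      rw [hα]
      refine Submodule.neg_mem _ (Submodule.add_mem _ ?_ (Submodule.sum_mem _ fun β hβ => ?_))
      · by_cases h0 : (h : L) = 0
        · rw [h0]
          exact Submodule.zero_mem _
        · have hne : LieModule.genWeightSpace L (0 : H → ℂ) ≠ ⊥ := by
            intro hbot
            have := (hzero h).1 h.2
            rw [rootSpace, hbot] at this
            exact h0 (by simpa using this)
          let χ : LieModule.Weight ℂ H L := ⟨0, hne⟩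
          have hχ : χ ≠ α := by
            intro heq
            have := LieSubalgebra.isNonZero_coe_root α
            rw [← heq] at this
            exact this rfl
          exact Submodule.mem_iSup_of_mem χ (Submodule.mem_iSup_of_mem hχ ((hzero h).1 h.2))
      · have hβα : (β : LieModule.Weight ℂ H L) ≠ α := fun heq =>
          (Finset.mem_erase.mp hβ).1 (Subtype.ext heq)
        exact Submodule.mem_iSup_of_mem _ (Submodule.mem_iSup_of_mem hβα
          (Submodule.smul_mem _ _ (e.mem β)))
    have hc0 : c = 0 := funext fun α => (smul_eq_zero.mp (hroot α)).resolve_right (e.ne_zero α)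
    subst hc0
    simpa using hc
  · rw [← LinearMap.range_eq_top, eq_top_iff]
    have htop : (⨆ χ : LieModule.Weight ℂ H L, (LieModule.genWeightSpace L χ).toSubmodule) = ⊤ := by
      rw [← LieSubmodule.iSup_toSubmodule, LieModule.iSup_genWeightSpace_eq_top' ℂ H L]
      rfl
    rw [← htop, iSup_le_iff]
    intro χ x hx
    by_cases hχ : χ.IsZero
    · refine ⟨(⟨x, (hzero x).2 ?_⟩, 0), by simp [sumMap_apply]⟩
      have hχ' : (χ : H → ℂ) = 0 := hχ
      rw [← hχ']
      exact hx
    · let α : H.root := ⟨χ, by simpa [LieSubalgebra.root] using hχ⟩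
      obtain ⟨c, hc⟩ := (finrank_eq_one_iff_of_nonzero'
        (⟨e.vec α, e.mem α⟩ : rootSpace H χ)
        (fun h => e.ne_zero α (congrArg Subtype.val h))).mp
          (finrank_rootSpace_eq_one χ hχ) ⟨x, hx⟩
      refine ⟨(0, Pi.single α c), ?_⟩
      rw [sumMap_apply, Finset.sum_eq_single α]
      · simpa using congrArg Subtype.val hc
      · intro β _ hβ
        simp [Pi.single_eq_of_ne hβ]
      · simp

/-- The root space decomposition: every `y` is uniquely `h + ∑ α, c α • e_α`. -/
def decomp : (H × (H.root → ℂ)) ≃ₗ[ℂ] L :=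
  LinearEquiv.ofBijective e.sumMap e.sumMap_bijective

/-- The component `h` of `y = h + ∑ α, c α • e_α`. -/
def hPart : L →ₗ[ℂ] H :=
  (LinearMap.fst ℂ H (H.root → ℂ)).comp e.decomp.symm.toLinearMap

/-- The coefficient `c α` of `y = h + ∑ α, c α • e_α`. -/
def coef (α : H.root) : L →ₗ[ℂ] ℂ :=
  (LinearMap.proj α).comp
    ((LinearMap.snd ℂ H (H.root → ℂ)).comp e.decomp.symm.toLinearMap)

/-- The value `α h` for `y = h + ∑ α, c α • e_α`. -/
def rootVal (α : H.root) (y : L) : ℂ := (α : LieModule.Weight ℂ H L) (e.hPart y)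

/-- `U'`: the elements of `U` whose component in `H` is regular. -/
def regPart (U : Set L) : Set L := {y | y ∈ U ∧ ∀ α : H.root, e.rootVal α y ≠ 0}

/-- `ℂ[U]'`: the algebra of functions on `U'` generated by the linear functions and the inverses of
the functions `y ↦ α h`. For a linear subspace `U` containing `H`, this is the localization
of the algebra of polynomial functions on `U` at the products of roots. -/
def regFun (U : Set L) : Subalgebra ℂ (e.regPart U → ℂ) :=
  Algebra.adjoin ℂ
    ((Set.range fun (ℓ : Module.Dual ℂ L) (y : e.regPart U) => ℓ (y : L)) ∪
      Set.range fun (α : H.root) (y : e.regPart U) => (e.rootVal α (y : L))⁻¹)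

/-- The function `ê_α`, whose value at `y = h + ∑ α, c α • e_α` is `c (-α)`, as an element of
`ℂ[U]'`. -/
def eHat (U : Set L) (α : H.root) : e.regFun U :=
  ⟨fun y => e.coef (negRoot α) (y : L),
    Algebra.subset_adjoin (Or.inl ⟨e.coef (negRoot α), rfl⟩)⟩

/-- `φ`, a function on `L'`, is a representative of the function `f` on `U'`. -/
def Represents {U : Set L} (φ : e.regPart (Set.univ : Set L) → ℂ) (f : e.regPart U → ℂ) : Prop :=
  ∀ y : e.regPart U, φ ⟨y, trivial, y.2.2⟩ = f y

open Classical in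
/-- The derivative of a function on `L'` in the direction of the vector `v`. -/
def dirDeriv (φ : e.regPart (Set.univ : Set L) → ℂ) (v : L) :
    e.regPart (Set.univ : Set L) → ℂ := fun y =>
  deriv (fun t : ℂ =>
    if h : (y : L) + t • v ∈ e.regPart (Set.univ : Set L) then φ ⟨_, h⟩ else 0) 0

/-- The Kirillov-Kostant Poisson bracket on functions on `L'`, where `L` is identified with its dual
by means of the form `κ`: `{φ, ψ}(y) = κ(y, [∇φ(y), ∇ψ(y)])` with gradients relative to `κ`, so
that `{κ(x, ·), κ(z, ·)} = κ([x, z], ·)`. The gradient `∇φ(y)` is expanded as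
`∑ i, ∂_{b i} φ(y) • b' i` for a basis `b` and its dual basis `b'` relative to `κ`. -/
def poisson (κ : LinearMap.BilinForm ℂ L) (hκ : κ.Nondegenerate)
    (φ ψ : e.regPart (Set.univ : Set L) → ℂ) : e.regPart (Set.univ : Set L) → ℂ := fun y =>
  let b := Module.finBasis ℂ L
  let b' := κ.dualBasis hκ b
  κ (y : L) ⁅∑ i, e.dirDeriv φ (b i) y • b' i, ∑ i, e.dirDeriv ψ (b i) y • b' i⁆

/-- The `n`-th term of the series of `Q_α`, applied to the representative `φ`:
`(-1)^n / n! * ĥ_α^(-n) * (κ(e_α, e_{-α}) ê_{-α})^n * {ê_α, {ê_α, ..., {ê_α, φ}}}`.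
The constant `κ(e_α, e_{-α})` is `1` exactly if `{ê_α, ê_{-α}} = ĥ_α`. -/
def seriesTerm (κ : LinearMap.BilinForm ℂ L) (hκ : κ.Nondegenerate) (α : H.root)
    (φ : e.regPart (Set.univ : Set L) → ℂ) (n : ℕ) (y : e.regPart (Set.univ : Set L)) : ℂ :=
  (-1) ^ n / (n.factorial : ℂ) * ((e.rootVal α (y : L))⁻¹) ^ n *
    (κ (e.vec α) (e.vec (negRoot α)) *
      (e.eHat Set.univ (negRoot α) : e.regPart (Set.univ : Set L) → ℂ) y) ^ n *
    ((e.poisson κ hκ (e.eHat Set.univ α : e.regPart (Set.univ : Set L) → ℂ))^[n] φ) y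

variable (B : (rootSystem H).Base)

/-- The Weyl group element `s_{β₁} ⋯ s_{βₘ}` of a list `[β₁, …, βₘ]` of roots. -/
def _root_.Zhelobenko.wordProd (l : List H.root) : (rootSystem H).weylGroup :=
  (l.map fun β => RootPairing.weylGroup.ofIdx (rootSystem H) β).prod

/-- The root `w α`. -/
def _root_.Zhelobenko.weylAct (w : (rootSystem H).weylGroup) (α : H.root) : H.root :=
  (rootSystem H).weylGroupToPerm w α

/-- The set `Δ_w` of the positive roots `α` such that `w⁻¹ α` is negative. -/
def _root_.Zhelobenko.inversions (w : (rootSystem H).weylGroup) : Set H.root :=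
  {α | B.IsPos α ∧ B.IsPos (negRoot (weylAct w⁻¹ α))}

/-- A normal ordering of the positive roots: a list of all of them, without repetitions, in which a
positive root that is the sum of two positive roots stands between these two. -/
structure _root_.Zhelobenko.IsNormalOrdering (l : List H.root) : Prop where
  nodup : l.Nodup
  mem_iff : ∀ α, α ∈ l ↔ B.IsPos α
  between : ∀ α ∈ l, ∀ β ∈ l, ∀ γ ∈ l,
    (rootSystem H).root γ = (rootSystem H).root α + (rootSystem H).root β →
      [α, γ, β].Sublist l ∨ [β, γ, α].Sublist l

/-- The Borel subalgebra `𝔟^w`, generated by `H` and the `e_{wα}` with `α` positive. For `w = 1`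
this is the Borel subalgebra `𝔟` that defines the positive roots. -/
def borel (w : (rootSystem H).weylGroup) : LieSubalgebra ℂ L :=
  LieSubalgebra.lieSpan ℂ L ((H : Set L) ∪ e.vec '' (weylAct w '' {α | B.IsPos α}))

/-- The subalgebra `𝔫_w`, generated by the `e_α` with `α ∈ Δ_w`. -/
def nLower (w : (rootSystem H).weylGroup) : LieSubalgebra ℂ L :=
  LieSubalgebra.lieSpan ℂ L (e.vec '' inversions B w)

/-- The subalgebra `𝔫^w_1`, generated by the `e_α` with `α ∈ w (Δ₊ \ Δ_{w⁻¹})`. -/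
def nOne (w : (rootSystem H).weylGroup) : LieSubalgebra ℂ L :=
  LieSubalgebra.lieSpan ℂ L
    (e.vec '' (weylAct w '' ({α | B.IsPos α} \ inversions B w⁻¹)))

/-- The linear space `𝔥 + 𝔫^w_1`. -/
def hPlusNOne (w : (rootSystem H).weylGroup) : Submodule ℂ L :=
  H.toSubmodule ⊔ (e.nOne B w).toSubmodule

/-- The composition `Q_{βₘ} ∘ ⋯ ∘ Q_{β₁}` along a list `[β₁, …, βₘ]`, where the operator belonging
to an entry `α` that is followed by the list `l` goes from `ℂ[𝔟^{wordProd (α :: l)}]'` to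
`ℂ[𝔟^{wordProd l}]'`. -/
def compose
    (Q : ∀ (α : H.root) (l : List H.root),
      e.regFun (e.borel B (wordProd (α :: l)) : Set L) →ₗ[ℂ]
        e.regFun (e.borel B (wordProd l) : Set L)) :
    ∀ l : List H.root, e.regFun (e.borel B (wordProd l) : Set L) →ₗ[ℂ]
      e.regFun (e.borel B 1 : Set L)
  | [] => LinearMap.id
  | α :: l => (compose Q l).comp (Q α l)

end RootVectors

end LieAlgebra

/-! ### Linear algebraic groups and the adjoint action -/

/-- A complex linear algebraic group: a Zariski closed subgroup of `GL n ℂ`, together with its Lie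
algebra, which consists of the matrices `A` such that `exp (t A)` is in the group for all `t`. -/
structure LinearAlgebraicGroup (n : ℕ) where
  grp : Subgroup (GL (Fin n) ℂ)
  isClosed : ∃ S : Set (MvPolynomial (Fin n × Fin n) ℂ), ∀ u : GL (Fin n) ℂ,
    u ∈ grp ↔ ∀ p ∈ S, MvPolynomial.eval (fun ij => (u : Matrix (Fin n) (Fin n) ℂ) ij.1 ij.2) p = 0
  lie : LieSubalgebra ℂ (Matrix (Fin n) (Fin n) ℂ)
  mem_lie : ∀ A : Matrix (Fin n) (Fin n) ℂ,
    A ∈ lie ↔ ∀ t : ℂ, ∃ u ∈ grp, (u : Matrix (Fin n) (Fin n) ℂ) = NormedSpace.exp (t • A)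

namespace LinearAlgebraicGroup

variable {n : ℕ} (G : LinearAlgebraicGroup n)

lemma exists_exp (A : G.lie) : ∃ u : G.grp,
    ((u : GL (Fin n) ℂ) : Matrix (Fin n) (Fin n) ℂ) =
      NormedSpace.exp (A : Matrix (Fin n) (Fin n) ℂ) := by
  obtain ⟨u, hu, h⟩ := (G.mem_lie A).1 A.2 1
  exact ⟨⟨u, hu⟩, by simpa using h⟩

/-- The exponential map from the Lie algebra to the group. -/
def expMap (A : G.lie) : G.grp := (G.exists_exp A).choose

lemma conj_mem (u : G.grp) (A : G.lie) :
    ((u : GL (Fin n) ℂ) : Matrix (Fin n) (Fin n) ℂ) * (A : Matrix (Fin n) (Fin n) ℂ) *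
      (((u : GL (Fin n) ℂ)⁻¹ : GL (Fin n) ℂ) : Matrix (Fin n) (Fin n) ℂ) ∈ G.lie := by
  rw [G.mem_lie]
  intro t
  obtain ⟨v, hv, hvt⟩ := (G.mem_lie A).1 A.2 t
  refine ⟨u * v * (u : GL (Fin n) ℂ)⁻¹, G.grp.mul_mem (G.grp.mul_mem u.2 hv)
    (G.grp.inv_mem u.2), ?_⟩
  have h := Matrix.exp_units_conj (u : GL (Fin n) ℂ) (t • (A : Matrix (Fin n) (Fin n) ℂ))
  rw [mul_smul_comm, smul_mul_assoc] at h
  rw [Units.val_mul, Units.val_mul, hvt]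
  exact h.symm

/-- The adjoint action `Ad u A = u A u⁻¹`. -/
def Ad (u : G.grp) (A : G.lie) : G.lie := ⟨_, G.conj_mem u A⟩

/-- The subgroup corresponding to a Lie subalgebra, generated by its exponentials. -/
def subgroupOf (m : LieSubalgebra ℂ G.lie) : Subgroup G.grp :=
  Subgroup.closure (G.expMap '' (m : Set G.lie))

/-- The algebra of regular functions on `K × V`, for a subgroup `K` of `G` and a linear subspace `V`
of the Lie algebra: it is generated by the entries of `u` and `u⁻¹` and by the linear functions
of `x`, where `(u, x) ∈ K × V`. -/
def prodFun (K : Subgroup G.grp) (V : Submodule ℂ G.lie) : Subalgebra ℂ (K × V → ℂ) :=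
  Algebra.adjoin ℂ
    ((Set.range fun (ij : Fin n × Fin n) (z : K × V) =>
        (((z.1 : G.grp) : GL (Fin n) ℂ) : Matrix (Fin n) (Fin n) ℂ) ij.1 ij.2) ∪
      (Set.range fun (ij : Fin n × Fin n) (z : K × V) =>
        ((((z.1 : G.grp) : GL (Fin n) ℂ)⁻¹ : GL (Fin n) ℂ) : Matrix (Fin n) (Fin n) ℂ)
          ij.1 ij.2) ∪
      Set.range fun (ℓ : Module.Dual ℂ V) (z : K × V) => ℓ z.2)

variable [IsKilling ℂ G.lie] {H : LieSubalgebra ℂ G.lie} [H.IsCartanSubalgebra]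

/-- The map `y ↦ Ad (exp ((c α / α h) e_α)) y` for `y = h + ∑ α, c α • e_α`. -/
def straighten (e : RootVectors H) (α : H.root) (y : G.lie) : G.lie :=
  G.Ad (G.expMap ((e.coef α y / e.rootVal α y) • e.vec α)) y

/-- The functions in `ℂ[U]'` that are invariant under the adjoint action of the subgroup `K`. -/
def invariants (e : RootVectors H) (U : Set G.lie) (K : Subgroup G.grp) :
    Submodule ℂ (e.regFun U) where
  carrier := {f | ∀ u ∈ K, ∀ y z : e.regPart U, (z : G.lie) = G.Ad u y →
    (f : e.regPart U → ℂ) z = (f : e.regPart U → ℂ) y}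
  add_mem' := by
    intro f g hf hg u hu y z h
    simp [hf u hu y z h, hg u hu y z h]
  zero_mem' := by
    intro u hu y z h
    simp
  smul_mem' := by
    intro c f hf u hu y z h
    simp [hf u hu y z h]

end LinearAlgebraicGroup

end

end Zhelobenko

/-!
All three parts rest on the straightening of the elements of `𝔟'` along a list of roots.

*One step.* Let `P` be a closed set of roots with `α ∈ P` and `-α ∉ P`. For `y` in
`𝔥 ⊕ ⨁_P 𝔤_γ` the element `exp (t ad e_α) y` lies in the same space and has the same component in
`𝔥`, while its coefficient at `e_α` is `c_α(y) - t α(h(y))` (`RootVectors.coef_adExp_vec`). So the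
step `straighten α`, which takes `t = c_α / α(h)`, kills this coefficient
(`LinearAlgebraicGroup.straighten_mem`).

*A whole list.* If the positive roots outside each suffix of a list `l` form a closed set
(`IsStraighteningList`), then the straightening along `l` kills all coefficients along `l`. The set
`Δ_w` is enumerated by such a list for every `w` (`exists_isStraighteningList`, by induction on the
cardinality of `Δ_w`), and each final segment of a normal ordering is one, with `Δ_w` for the
corresponding `w` as its set of entries (`IsNormalOrdering.mem_posSystem_wordProd`).

*Uniqueness.* Let `h₀` in `𝔥` be the element on which each root is its height. The elements of
`𝔫` are matrices of positive weight for the commutator with `h₀`. Hence they are nilpotent, and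
`u - 1` has positive weight for `u ∈ N_w`, so the stabilizer of `h₀` in `N_w` is trivial
(`eq_one_of_Ad_heightElt`). The straightening of `Ad u h₀ ∈ h₀ + 𝔫_w` is `h₀`, so `u ↦ Ad u h₀ - h₀`
is a bijection from `N_w` onto `𝔫_w`, each element of `N_w` is an ordered product of exponentials
along `l`, and by the one-step formula a regular `y ∈ 𝔟` is mapped into `𝔥 + 𝔫^w_1` by exactly one
element of `N_w`, namely by the one that straightens it (`eq_straightenElt`).

*Part (1).* The bijection above identifies `N_w × (𝔥 + 𝔫^w_1)` with an affine space
(`isIrreducibleAffineVariety_prodFun`), and the straightening, whose matrix entries are regular away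
from the zeros of the roots, inverts the adjoint action there (`isBirationalEquiv_adjointMap`).

*Part (2).* `Q_w` is the composition with a retraction of `𝔟'` onto the regular part of `𝔥 + 𝔫^w_1`
whose fibres are the orbits of `N_w`. Its range consists of the invariants, and its kernel of the
functions vanishing on `𝔥 + 𝔫^w_1`; that they are generated by the coordinates `ê_α` is seen by
comparing a function with its composition with the linear projection onto `𝔥 + 𝔫^w_1`
(`sub_pullbackReg_proj_mem`).

*Part (3).* `{ê_α, ·}` is, up to the factor `-1 / κ(e_α, e_{-α})`, the derivative along the vector
field `y ↦ [e_α, y]` (`poisson_eHat`). So the series is the Taylor expansion of `φ` along the curve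
`t ↦ exp (t ad e_α) y` at `t = c_α / α(h)`. It terminates since `φ` is a polynomial in `t` along
this curve, the values of the roots being constant on it (`exists_sum_seriesTerm_eq`).
-/

set_option linter.unusedSectionVars false

namespace Zhelobenko

noncomputable section

section RootSubspaces

variable {L : Type*} [LieRing L] [LieAlgebra ℂ L] [FiniteDimensional ℂ L] [IsKilling ℂ L]
  {H : LieSubalgebra ℂ L} [H.IsCartanSubalgebra]

/-- A set of roots is closed if it contains each root that is a sum of two of its elements. -/
def IsClosedSet (P : Set H.root) : Prop :=
  ∀ α ∈ P, ∀ β ∈ P, ∀ γ, (rootSystem H).root γ = (rootSystem H).root α + (rootSystem H).root β →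
    γ ∈ P

lemma root_eq_iff {α β : H.root} :
    ((α : LieModule.Weight ℂ H L) : H → ℂ) = (β : LieModule.Weight ℂ H L) ↔ α = β := by
  rw [DFunLike.coe_fn_eq, Subtype.ext_iff]

lemma root_eq_add_iff {α β γ : H.root} :
    (rootSystem H).root γ = (rootSystem H).root α + (rootSystem H).root β ↔
      ∀ h : H, (γ : LieModule.Weight ℂ H L) h =
        (α : LieModule.Weight ℂ H L) h + (β : LieModule.Weight ℂ H L) h := by
  rw [LinearMap.ext_iff]
  rfl

@[simp] lemma negRoot_apply (α : H.root) (h : H) :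
    (negRoot α : LieModule.Weight ℂ H L) h = -(α : LieModule.Weight ℂ H L) h := rfl

@[simp] lemma negRoot_negRoot (α : H.root) : negRoot (negRoot α) = α :=
  Subtype.ext (neg_neg _)

@[simp] lemma root_negRoot (α : H.root) :
    (rootSystem H).root (negRoot α) = -(rootSystem H).root α := by
  ext h
  simp

lemma exists_apply_ne_zero (α : H.root) : ∃ h : H, (α : LieModule.Weight ℂ H L) h ≠ 0 := by
  by_contra! hc
  exact LieSubalgebra.isNonZero_coe_root α (funext hc)

namespace RootVectors

variable (e : RootVectors H)

lemma eq_hPart_add_sum (y : L) : y = (e.hPart y : L) + ∑ α, e.coef α y • e.vec α := by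
  conv_lhs => rw [← e.decomp.apply_symm_apply y]
  exact e.sumMap_apply _ _

lemma hPart_sumMap (h : H) (c : H.root → ℂ) : e.hPart ((h : L) + ∑ α, c α • e.vec α) = h := by
  rw [← sumMap_apply]
  change (e.decomp.symm (e.decomp (h, c))).1 = h
  rw [LinearEquiv.symm_apply_apply]

lemma coef_sumMap (h : H) (c : H.root → ℂ) (β : H.root) :
    e.coef β ((h : L) + ∑ α, c α • e.vec α) = c β := by
  rw [← sumMap_apply]
  change (e.decomp.symm (e.decomp (h, c))).2 β = c β
  rw [LinearEquiv.symm_apply_apply]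

lemma ext_parts {y z : L} (h : e.hPart y = e.hPart z) (hc : ∀ α, e.coef α y = e.coef α z) :
    y = z := by
  rw [e.eq_hPart_add_sum y, e.eq_hPart_add_sum z, h]
  simp [hc]

@[simp] lemma hPart_coe (h : H) : e.hPart (h : L) = h := by
  simpa using e.hPart_sumMap h 0

@[simp] lemma coef_coe (α : H.root) (h : H) : e.coef α (h : L) = 0 := by
  simpa using e.coef_sumMap h 0 α

@[simp] lemma hPart_vec (α : H.root) : e.hPart (e.vec α) = 0 := by
  classical
  simpa [Pi.single_apply] using e.hPart_sumMap 0 (Pi.single α 1)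

lemma coef_vec [DecidableEq H.root] (α β : H.root) :
    e.coef α (e.vec β) = if α = β then 1 else 0 := by
  simpa [Pi.single_apply] using e.coef_sumMap 0 (Pi.single β 1) α

@[simp] lemma coef_vec_self (α : H.root) : e.coef α (e.vec α) = 1 := by
  classical
  simp [coef_vec]

lemma coef_vec_of_ne {α β : H.root} (h : α ≠ β) : e.coef α (e.vec β) = 0 := by
  classical
  simp [coef_vec, h]

lemma lie_coe_vec (h : H) (α : H.root) :
    ⁅(h : L), e.vec α⁆ = (α : LieModule.Weight ℂ H L) h • e.vec α :=
  lie_eq_smul_of_mem_rootSpace (e.mem α) h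

lemma lie_coe (h : H) (y : L) :
    ⁅(h : L), y⁆ =
      ((0 : H) : L) + ∑ α : H.root, ((α : LieModule.Weight ℂ H L) h * e.coef α y) • e.vec α := by
  have h0 : ⁅(h : L), (e.hPart y : L)⁆ = 0 := by
    have := trivial_lie_zero H H h (e.hPart y)
    simpa using congrArg (Subtype.val : H → L) this
  conv_lhs => rw [e.eq_hPart_add_sum y]
  rw [lie_add, h0, lie_sum]
  simp only [lie_smul, lie_coe_vec, smul_smul, ZeroMemClass.coe_zero, mul_comm]

@[simp] lemma hPart_lie_coe (h : H) (y : L) : e.hPart ⁅(h : L), y⁆ = 0 := by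
  rw [lie_coe, hPart_sumMap]

@[simp] lemma coef_lie_coe (h : H) (y : L) (α : H.root) :
    e.coef α ⁅(h : L), y⁆ = (α : LieModule.Weight ℂ H L) h * e.coef α y := by
  rw [lie_coe, coef_sumMap]

lemma hPart_of_mem_rootSpace {χ : H → ℂ} {x : L} (hx : x ∈ rootSpace H χ) (hχ : χ ≠ 0) :
    e.hPart x = 0 := by
  obtain ⟨h, hh⟩ := Function.ne_iff.mp hχ
  have := e.hPart_lie_coe h x
  rw [show ⁅(h : L), x⁆ = χ h • x from lie_eq_smul_of_mem_rootSpace hx h, map_smul] at this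
  exact (smul_eq_zero.mp this).resolve_left hh

lemma coef_of_mem_rootSpace {χ : H → ℂ} {x : L} (hx : x ∈ rootSpace H χ) {γ : H.root}
    (hχ : χ ≠ (γ : LieModule.Weight ℂ H L)) : e.coef γ x = 0 := by
  obtain ⟨h, hh⟩ := Function.ne_iff.mp hχ
  have := e.coef_lie_coe h x γ
  rw [show ⁅(h : L), x⁆ = χ h • x from lie_eq_smul_of_mem_rootSpace hx h, map_smul,
    smul_eq_mul] at this
  have h2 : (χ h - (γ : LieModule.Weight ℂ H L) h) * e.coef γ x = 0 := by
    rw [sub_mul, this, sub_self]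
  exact (mul_eq_zero.mp h2).resolve_left (sub_ne_zero.mpr hh)

lemma lie_vec_vec_mem (α β : H.root) :
    ⁅e.vec α, e.vec β⁆ ∈ rootSpace H (((α : LieModule.Weight ℂ H L) : H → ℂ) +
      (β : LieModule.Weight ℂ H L)) :=
  lie_mem_genWeightSpace_of_mem_genWeightSpace (e.mem α) (e.mem β)

/-- The space `𝔥 ⊕ ⨁_{α ∈ P} 𝔤_α`. -/
def hSum (P : Set H.root) : Submodule ℂ L where
  carrier := {y | ∀ α ∉ P, e.coef α y = 0}
  add_mem' := fun hx hy α hα => by simp [hx α hα, hy α hα]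
  zero_mem' := fun α _ => map_zero _
  smul_mem' := fun c x hx α hα => by simp [hx α hα]

/-- The space `⨁_{α ∈ P} 𝔤_α`. -/
def nSum (P : Set H.root) : Submodule ℂ L where
  carrier := {y | e.hPart y = 0 ∧ ∀ α ∉ P, e.coef α y = 0}
  add_mem' := fun hx hy => ⟨by simp [hx.1, hy.1], fun α hα => by simp [hx.2 α hα, hy.2 α hα]⟩
  zero_mem' := ⟨map_zero _, fun α _ => map_zero _⟩
  smul_mem' := fun c x hx => ⟨by simp [hx.1], fun α hα => by simp [hx.2 α hα]⟩

variable {P Q : Set H.root}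

lemma hSum_mono (h : P ⊆ Q) : e.hSum P ≤ e.hSum Q := fun _ hy α hα => hy α fun hP => hα (h hP)

lemma nSum_mono (h : P ⊆ Q) : e.nSum P ≤ e.nSum Q := fun _ hy =>
  ⟨hy.1, fun α hα => hy.2 α fun hP => hα (h hP)⟩

lemma nSum_le_hSum : e.nSum P ≤ e.hSum P := fun _ hy => hy.2

lemma coe_mem_hSum (h : H) : (h : L) ∈ e.hSum P := fun α _ => e.coef_coe α h

lemma vec_mem_nSum {α : H.root} (hα : α ∈ P) : e.vec α ∈ e.nSum P :=
  ⟨e.hPart_vec α, fun _ hβ => e.coef_vec_of_ne fun h => hβ (h ▸ hα)⟩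

lemma sub_hPart_mem_nSum {y : L} (hy : y ∈ e.hSum P) : y - e.hPart y ∈ e.nSum P :=
  ⟨by simp, fun α hα => by simp [hy α hα]⟩

lemma nSum_eq_span : e.nSum P = Submodule.span ℂ (e.vec '' P) := by
  apply le_antisymm
  · intro y hy
    rw [e.eq_hPart_add_sum y, hy.1, ZeroMemClass.coe_zero, zero_add]
    refine Submodule.sum_mem _ fun α _ => ?_
    by_cases hα : α ∈ P
    · exact Submodule.smul_mem _ _ (Submodule.subset_span ⟨α, hα, rfl⟩)
    · simp [hy.2 α hα]
  · rw [Submodule.span_le]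
    rintro _ ⟨α, hα, rfl⟩
    exact e.vec_mem_nSum hα

lemma hSum_eq_sup : e.hSum P = H.toSubmodule ⊔ e.nSum P := by
  apply le_antisymm
  · intro y hy
    rw [← add_sub_cancel (e.hPart y : L) y]
    exact Submodule.add_mem_sup (e.hPart y).2 (e.sub_hPart_mem_nSum hy)
  · refine sup_le (fun y hy => ?_) e.nSum_le_hSum
    exact e.coe_mem_hSum ⟨y, hy⟩

/-- The brackets of two root vectors whose roots are not opposite. -/
lemma lie_vec_vec_mem_nSum {α β : H.root} (hne : β ≠ negRoot α)
    (hP : ∀ γ, (rootSystem H).root γ = (rootSystem H).root α + (rootSystem H).root β → γ ∈ P) :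
    ⁅e.vec α, e.vec β⁆ ∈ e.nSum P := by
  refine ⟨e.hPart_of_mem_rootSpace (e.lie_vec_vec_mem α β) fun h0 => hne ?_, fun γ hγ =>
    e.coef_of_mem_rootSpace (e.lie_vec_vec_mem α β) fun h => hγ (hP γ ?_)⟩
  · rw [← root_eq_iff]
    funext h
    have := congrFun h0 h
    simp only [Pi.add_apply, Pi.zero_apply] at this
    rw [negRoot_apply]
    linear_combination this
  · rw [root_eq_add_iff]
    exact fun x => (congrFun h x).symm

/-- If `P` is closed, `A ⊆ P` and no element of `A` is opposite to one of `P`, then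
`[⨁_A 𝔤_α, 𝔥 ⊕ ⨁_P 𝔤_α] ⊆ ⨁_P 𝔤_α`. -/
lemma lie_mem_nSum {A : Set H.root} (hP : IsClosedSet P) (hA : A ⊆ P)
    (hneg : ∀ α ∈ A, negRoot α ∉ P) {x y : L} (hx : x ∈ e.nSum A) (hy : y ∈ e.hSum P) :
    ⁅x, y⁆ ∈ e.nSum P := by
  rw [nSum_eq_span] at hx
  induction hx using Submodule.span_induction with
  | zero => simp
  | add u v _ _ hu hv => rw [add_lie]; exact Submodule.add_mem _ hu hv
  | smul c u _ hu => rw [smul_lie]; exact Submodule.smul_mem _ _ hu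
  | mem u hu =>
    obtain ⟨α, hα, rfl⟩ := hu
    rw [← add_sub_cancel (e.hPart y : L) y, lie_add, ← lie_skew, lie_coe_vec]
    refine Submodule.add_mem _ (Submodule.neg_mem _ (Submodule.smul_mem _ _
      (e.vec_mem_nSum (hA hα)))) ?_
    have hz := e.sub_hPart_mem_nSum hy
    generalize y - (e.hPart y : L) = z at hz
    rw [nSum_eq_span] at hz
    induction hz using Submodule.span_induction with
    | zero => simp
    | add u v _ _ hu hv => rw [lie_add]; exact Submodule.add_mem _ hu hv
    | smul c u _ hu => rw [lie_smul]; exact Submodule.smul_mem _ _ hu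
    | mem u hu =>
      obtain ⟨β, hβ, rfl⟩ := hu
      exact e.lie_vec_vec_mem_nSum (fun h => hneg α hα (h ▸ hβ)) fun γ hγ =>
        hP α (hA hα) β hβ γ hγ

/-- `⨁_P 𝔤_α` is a subalgebra if `P` is closed and disjoint from `-P`. -/
def nSumAlg (hP : IsClosedSet P) (hneg : ∀ α ∈ P, negRoot α ∉ P) : LieSubalgebra ℂ L :=
  { e.nSum P with
    lie_mem' := fun hx hy => e.lie_mem_nSum hP subset_rfl hneg hx (e.nSum_le_hSum hy) }

/-- `𝔥 ⊕ ⨁_P 𝔤_α` is a subalgebra if `P` is closed and disjoint from `-P`. -/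
def hSumAlg (hP : IsClosedSet P) (hneg : ∀ α ∈ P, negRoot α ∉ P) : LieSubalgebra ℂ L :=
  { e.hSum P with
    lie_mem' := by
      intro x y hx hy
      change x ∈ e.hSum P at hx
      change y ∈ e.hSum P at hy
      change ⁅x, y⁆ ∈ e.hSum P
      rw [← add_sub_cancel (e.hPart x : L) x, add_lie]
      refine Submodule.add_mem _ (fun α hα => ?_) (e.nSum_le_hSum
        (e.lie_mem_nSum hP subset_rfl hneg (e.sub_hPart_mem_nSum hx) hy))
      rw [coef_lie_coe, hy α hα, mul_zero] }

lemma lieSpan_vec (hP : IsClosedSet P) (hneg : ∀ α ∈ P, negRoot α ∉ P) :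
    (LieSubalgebra.lieSpan ℂ L (e.vec '' P)).toSubmodule = e.nSum P := by
  apply le_antisymm
  · change LieSubalgebra.lieSpan ℂ L (e.vec '' P) ≤ e.nSumAlg hP hneg
    rw [LieSubalgebra.lieSpan_le]
    rintro _ ⟨α, hα, rfl⟩
    exact e.vec_mem_nSum hα
  · rw [nSum_eq_span, Submodule.span_le]
    exact LieSubalgebra.subset_lieSpan

lemma lieSpan_cartan_vec (hP : IsClosedSet P) (hneg : ∀ α ∈ P, negRoot α ∉ P) :
    (LieSubalgebra.lieSpan ℂ L ((H : Set L) ∪ e.vec '' P)).toSubmodule = e.hSum P := by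
  apply le_antisymm
  · change LieSubalgebra.lieSpan ℂ L ((H : Set L) ∪ e.vec '' P) ≤ e.hSumAlg hP hneg
    rw [LieSubalgebra.lieSpan_le]
    rintro y (hy | ⟨α, hα, rfl⟩)
    · exact e.coe_mem_hSum ⟨y, hy⟩
    · exact e.nSum_le_hSum (e.vec_mem_nSum hα)
  · rw [hSum_eq_sup, nSum_eq_span, sup_le_iff, Submodule.span_le]
    exact ⟨fun y hy => LieSubalgebra.subset_lieSpan (Or.inl hy),
      fun y hy => LieSubalgebra.subset_lieSpan (Or.inr hy)⟩

end RootVectors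

end RootSubspaces

/-! ### The exponential of a nilpotent inner derivation -/

section AdExp

variable {L : Type*} [LieRing L] [LieAlgebra ℂ L] [FiniteDimensional ℂ L]

/-- `exp (t ad x)` for an element `x` such that `ad x` is nilpotent. The exponential series is cut
off at the dimension of `L`, beyond which the powers of `ad x` vanish. -/
def adExp (x : L) (t : ℂ) : L →ₗ[ℂ] L :=
  ∑ k ∈ Finset.range (Module.finrank ℂ L), (t ^ k / (k.factorial : ℂ)) • (ad ℂ L x) ^ k

lemma adExp_apply (x : L) (t : ℂ) (y : L) :
    adExp x t y = ∑ k ∈ Finset.range (Module.finrank ℂ L),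
      (t ^ k / (k.factorial : ℂ)) • ((ad ℂ L x) ^ k) y := by
  simp [adExp]

lemma ad_pow_finrank {x : L} (hx : IsNilpotent (ad ℂ L x)) :
    (ad ℂ L x) ^ (Module.finrank ℂ L) = 0 := by
  have h := LinearMap.aeval_self_charpoly (ad ℂ L x)
  rw [LinearMap.charpoly_eq_X_pow_iff _ |>.mpr ?_] at h
  · simpa using h
  · obtain ⟨k, hk⟩ := hx
    exact fun m => ⟨k, by rw [hk]; rfl⟩

lemma adExp_eq_sum {x : L} (hx : IsNilpotent (ad ℂ L x)) (t : ℂ) (y : L) {K : ℕ}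
    (hK : (ad ℂ L x) ^ K = 0) :
    adExp x t y = ∑ k ∈ Finset.range K, (t ^ k / (k.factorial : ℂ)) • ((ad ℂ L x) ^ k) y := by
  have key : ∀ M, (ad ℂ L x) ^ M = 0 → ∀ N, M ≤ N →
      ∑ k ∈ Finset.range N, (t ^ k / (k.factorial : ℂ)) • ((ad ℂ L x) ^ k) y =
        ∑ k ∈ Finset.range M, (t ^ k / (k.factorial : ℂ)) • ((ad ℂ L x) ^ k) y := by
    intro M hM N hN
    symm
    refine Finset.sum_subset (Finset.range_mono hN) fun k _ hk => ?_
    rw [pow_eq_zero_of_le (by simpa using hk) hM]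
    simp
  rw [adExp_apply, ← key _ (ad_pow_finrank hx) _ (le_max_left _ K), key _ hK _ (le_max_right _ K)]

/-- The curve `t ↦ exp (t ad x) y` is an integral curve of `z ↦ [x, z]`. -/
lemma hasDerivAt_adExp {x : L} (hx : IsNilpotent (ad ℂ L x)) (y : L) (ℓ : Module.Dual ℂ L)
    (t : ℂ) : HasDerivAt (fun s => ℓ (adExp x s y)) (ℓ ⁅x, adExp x t y⁆) t := by
  have hK := ad_pow_finrank hx
  set K := Module.finrank ℂ L
  have hK1 : (ad ℂ L x) ^ (K + 1) = 0 := by rw [pow_succ, hK, zero_mul]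
  have h1 : ⁅x, adExp x t y⁆ = ∑ k ∈ Finset.range (K + 1),
      ((k : ℂ) * t ^ (k - 1) / (k.factorial : ℂ)) • ((ad ℂ L x) ^ k) y := by
    rw [Finset.sum_range_succ', adExp_eq_sum hx t y hK, lie_sum]
    simp only [Nat.cast_zero, zero_mul, zero_div, zero_smul, add_zero, Nat.add_sub_cancel]
    refine Finset.sum_congr rfl fun k _ => ?_
    rw [lie_smul, pow_succ' (ad ℂ L x), Module.End.mul_apply, ad_apply, Nat.factorial_succ]
    congr 1
    have : (k.factorial : ℂ) ≠ 0 := by exact_mod_cast k.factorial_ne_zero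
    have : ((k : ℂ) + 1) ≠ 0 := by exact_mod_cast k.succ_ne_zero
    push_cast
    field_simp
  have h2 : (fun s => ℓ (adExp x s y)) = fun s => ∑ k ∈ Finset.range (K + 1),
      (s ^ k / (k.factorial : ℂ)) * ℓ (((ad ℂ L x) ^ k) y) := by
    funext s
    rw [adExp_eq_sum hx s y hK1]
    simp
  rw [h1, h2]
  simp only [map_sum, map_smul, smul_eq_mul]
  refine HasDerivAt.fun_sum fun k _ => ?_
  exact ((hasDerivAt_pow k t).div_const _).mul_const _

end AdExp

section Step

variable {L : Type*} [LieRing L] [LieAlgebra ℂ L] [FiniteDimensional ℂ L] [IsKilling ℂ L]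
  {H : LieSubalgebra ℂ L} [H.IsCartanSubalgebra]

namespace RootVectors

variable (e : RootVectors H)

lemma isNilpotent_ad_vec (α : H.root) : IsNilpotent (ad ℂ L (e.vec α)) :=
  LieModule.isNilpotent_toEnd_of_mem_rootSpace (M := L) H (LieSubalgebra.isNonZero_coe_root α)
    (e.mem α)

/-- If `[x, y]` lies in an `ad x`-stable subspace, then `exp (t ad x) y - y` lies in it. -/
lemma _root_.Zhelobenko.adExp_sub_mem {x y : L} {V : Submodule ℂ L} (h1 : ⁅x, y⁆ ∈ V)
    (h2 : ∀ v ∈ V, ⁅x, v⁆ ∈ V) (hx : IsNilpotent (ad ℂ L x)) (t : ℂ) :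
    adExp x t y - y ∈ V := by
  have hK : (ad ℂ L x) ^ (Module.finrank ℂ L + 1) = 0 := by
    rw [pow_succ, ad_pow_finrank hx, zero_mul]
  rw [adExp_eq_sum hx t y hK, Finset.sum_range_succ']
  simp only [pow_zero, Nat.factorial_zero, Nat.cast_one, div_one, one_smul, Module.End.one_apply,
    add_sub_cancel_right]
  refine Submodule.sum_mem _ fun k hk => Submodule.smul_mem _ _ ?_
  clear hk
  induction k with
  | zero => simpa using h1
  | succ k ih => rw [pow_succ', Module.End.mul_apply]; exact h2 _ ih

/-- The effect of `exp (t ad e_α)` on `𝔥 ⊕ ⨁_P 𝔤_γ`, up to the root spaces other than `𝔤_α`. -/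
lemma adExp_vec_sub_mem {P : Set H.root} (hP : IsClosedSet P) {α : H.root} (hα : α ∈ P)
    (hneg : negRoot α ∉ P) {y : L} (hy : y ∈ e.hSum P) (t : ℂ) :
    adExp (e.vec α) t y - (y - (t * e.rootVal α y) • e.vec α) ∈ e.nSum (P \ {α}) := by
  have hdiff : ∀ β ∈ P, ⁅e.vec α, e.vec β⁆ ∈ e.nSum (P \ {α}) := fun β hβ => by
    refine e.lie_vec_vec_mem_nSum (fun h => hneg (h ▸ hβ)) fun γ hγ => ⟨hP α hα β hβ γ hγ, ?_⟩
    rintro rfl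
    rw [left_eq_add] at hγ
    exact (rootSystem H).ne_zero β hγ
  have hn : ∀ v ∈ e.nSum P, ⁅e.vec α, v⁆ ∈ e.nSum (P \ {α}) := fun v hv => by
    rw [nSum_eq_span] at hv
    induction hv using Submodule.span_induction with
    | zero => simp
    | add u v _ _ hu hv => rw [lie_add]; exact Submodule.add_mem _ hu hv
    | smul c u _ hu => rw [lie_smul]; exact Submodule.smul_mem _ _ hu
    | mem u hu => obtain ⟨β, hβ, rfl⟩ := hu; exact hdiff β hβ
  have hV : ∀ v ∈ e.nSum (P \ {α}), ⁅e.vec α, v⁆ ∈ e.nSum (P \ {α}) := fun v hv =>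
    hn v (e.nSum_mono Set.sdiff_subset hv)
  -- `y` is corrected by a multiple of `e_α` to reduce to a bracket without `e_α`-component
  have hnil := e.isNilpotent_ad_vec α
  have h1 : adExp (e.vec α) t (e.hPart y : L) =
      e.hPart y - (t * e.rootVal α y) • e.vec α := by
    have hpow : ∀ k, ((ad ℂ L (e.vec α)) ^ (k + 2)) (e.hPart y : L) = 0 := by
      intro k
      rw [pow_add, Module.End.mul_apply, pow_two, Module.End.mul_apply, ad_apply, ad_apply,
        ← lie_skew (e.vec α) (e.hPart y : L), lie_coe_vec]
      simp
    have hK : (ad ℂ L (e.vec α)) ^ (Module.finrank ℂ L + 2) = 0 := by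
      rw [pow_add, ad_pow_finrank hnil, zero_mul]
    rw [adExp_eq_sum hnil t _ hK, Finset.sum_range_succ', Finset.sum_range_succ']
    simp only [hpow, smul_zero, Finset.sum_const_zero, zero_add, pow_one, pow_zero,
      Nat.factorial_one, Nat.factorial_zero, Nat.cast_one, div_one, one_smul,
      Module.End.one_apply, ad_apply]
    rw [← lie_skew, lie_coe_vec, smul_neg, smul_smul, neg_add_eq_sub]
    rfl
  have h2 : adExp (e.vec α) t (y - e.hPart y) - (y - e.hPart y) ∈ e.nSum (P \ {α}) :=
    adExp_sub_mem (hn _ (e.sub_hPart_mem_nSum hy)) hV hnil t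
  have h3 : adExp (e.vec α) t y =
      adExp (e.vec α) t (e.hPart y : L) + adExp (e.vec α) t (y - e.hPart y) := by
    rw [← map_add, add_sub_cancel]
  rw [h3, h1]
  convert h2 using 1
  abel

section Consequences

variable {P : Set H.root} (hP : IsClosedSet P) {α : H.root} (hα : α ∈ P)
  (hneg : negRoot α ∉ P) {y : L} (hy : y ∈ e.hSum P) (t : ℂ)

include hP hα hneg hy

lemma adExp_vec_mem : adExp (e.vec α) t y ∈ e.hSum P := by
  have h := e.hSum_mono Set.sdiff_subset (e.nSum_le_hSum (e.adExp_vec_sub_mem hP hα hneg hy t))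
  have h2 : y - (t * e.rootVal α y) • e.vec α ∈ e.hSum P :=
    Submodule.sub_mem _ hy (Submodule.smul_mem _ _ (e.nSum_le_hSum (e.vec_mem_nSum hα)))
  simpa using Submodule.add_mem _ h h2

lemma hPart_adExp_vec : e.hPart (adExp (e.vec α) t y) = e.hPart y := by
  have h := (e.adExp_vec_sub_mem hP hα hneg hy t).1
  simpa [sub_eq_zero] using h

lemma coef_adExp_vec :
    e.coef α (adExp (e.vec α) t y) = e.coef α y - t * e.rootVal α y := by
  have h := (e.adExp_vec_sub_mem hP hα hneg hy t).2 α (by simp)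
  simpa [sub_eq_zero] using h

end Consequences

end RootVectors

end Step

/-! ### Positive systems, inversions and normal orderings -/

section Roots

variable {L : Type*} [LieRing L] [LieAlgebra ℂ L] [FiniteDimensional ℂ L] [IsKilling ℂ L]
  {H : LieSubalgebra ℂ L} [H.IsCartanSubalgebra]

@[simp] lemma weylAct_one (α : H.root) : weylAct 1 α = α := by simp [weylAct]

lemma weylAct_mul (w v : (rootSystem H).weylGroup) (α : H.root) :
    weylAct (w * v) α = weylAct w (weylAct v α) := by simp [weylAct]

@[simp] lemma weylAct_inv_weylAct (w : (rootSystem H).weylGroup) (α : H.root) :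
    weylAct w⁻¹ (weylAct w α) = α := by rw [← weylAct_mul, inv_mul_cancel, weylAct_one]

@[simp] lemma weylAct_weylAct_inv (w : (rootSystem H).weylGroup) (α : H.root) :
    weylAct w (weylAct w⁻¹ α) = α := by rw [← weylAct_mul, mul_inv_cancel, weylAct_one]

lemma weylAct_injective (w : (rootSystem H).weylGroup) :
    Function.Injective (weylAct w : H.root → H.root) :=
  Function.LeftInverse.injective (weylAct_inv_weylAct w)

lemma root_weylAct (w : (rootSystem H).weylGroup) (α : H.root) :
    (rootSystem H).root (weylAct w α) = w • (rootSystem H).root α :=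
  ((rootSystem H).weylGroup_apply_root w α).symm

lemma weylAct_add (w : (rootSystem H).weylGroup) {α β γ : H.root}
    (h : (rootSystem H).root γ = (rootSystem H).root α + (rootSystem H).root β) :
    (rootSystem H).root (weylAct w γ) =
      (rootSystem H).root (weylAct w α) + (rootSystem H).root (weylAct w β) := by
  rw [root_weylAct, root_weylAct, root_weylAct, h, smul_add]

@[simp] lemma weylAct_negRoot (w : (rootSystem H).weylGroup) (α : H.root) :
    weylAct w (negRoot α) = negRoot (weylAct w α) := by
  apply (rootSystem H).root.injective
  rw [root_weylAct, root_negRoot, root_negRoot, root_weylAct, smul_neg]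

lemma weylAct_ofIdx (α β : H.root) :
    weylAct (RootPairing.weylGroup.ofIdx (rootSystem H) α) β =
      (rootSystem H).reflectionPerm α β := by
  simp [weylAct, RootPairing.weylGroup.ofIdx]

lemma reflectionPerm_self_eq_negRoot (α : H.root) :
    (rootSystem H).reflectionPerm α α = negRoot α := by
  apply (rootSystem H).root.injective
  rw [root_negRoot, RootPairing.root_reflectionPerm, RootPairing.reflection_apply_self]

lemma pairing_weylAct (w : (rootSystem H).weylGroup) (α β : H.root) :
    (rootSystem H).pairing (weylAct w α) (weylAct w β) = (rootSystem H).pairing α β := by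
  obtain ⟨w, hw⟩ := w
  induction hw using RootPairing.weylGroup.induction generalizing α β with
  | mem i =>
    change (rootSystem H).pairing (weylAct (RootPairing.weylGroup.ofIdx (rootSystem H) i) α)
      (weylAct (RootPairing.weylGroup.ofIdx (rootSystem H) i) β) = _
    rw [weylAct_ofIdx, weylAct_ofIdx, RootPairing.pairing_reflectionPerm]
    simp
  | one =>
    change (rootSystem H).pairing (weylAct 1 α) (weylAct 1 β) = _
    simp
  | mul x y hx hy ihx ihy =>
    change (rootSystem H).pairing (weylAct (⟨x, hx⟩ * ⟨y, hy⟩) α)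
      (weylAct (⟨x, hx⟩ * ⟨y, hy⟩) β) = _
    rw [weylAct_mul, weylAct_mul, ihx, ihy]

lemma weylAct_reflectionPerm (w : (rootSystem H).weylGroup) (α β : H.root) :
    weylAct w ((rootSystem H).reflectionPerm α β) =
      (rootSystem H).reflectionPerm (weylAct w α) (weylAct w β) := by
  apply (rootSystem H).root.injective
  rw [root_weylAct, RootPairing.root_reflectionPerm, RootPairing.root_reflectionPerm,
    RootPairing.reflection_apply_root, RootPairing.reflection_apply_root, pairing_weylAct,
    root_weylAct, root_weylAct, smul_sub]
  congr 1
  exact smul_comm _ _ _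

variable (B : (rootSystem H).Base)

lemma isPos_negRoot {α : H.root} : B.IsPos (negRoot α) ↔ ¬ B.IsPos α := by
  rw [← reflectionPerm_self_eq_negRoot]
  exact RootPairing.Base.IsPos.neg_iff_not B α

/-- The positive system `w Δ₊`. -/
def posSystem (w : (rootSystem H).weylGroup) : Set H.root := weylAct w '' {α | B.IsPos α}

variable {B}

lemma mem_posSystem {w : (rootSystem H).weylGroup} {α : H.root} :
    α ∈ posSystem B w ↔ B.IsPos (weylAct w⁻¹ α) := by
  constructor
  · rintro ⟨β, hβ, rfl⟩
    simpa using hβ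
  · exact fun h => ⟨_, h, by simp⟩

lemma posSystem_one : posSystem B 1 = {α | B.IsPos α} := by
  ext α
  simp [mem_posSystem]

lemma isClosedSet_posSystem (w : (rootSystem H).weylGroup) : IsClosedSet (posSystem B w) := by
  intro α hα β hβ γ h
  rw [mem_posSystem] at *
  exact hα.add hβ (weylAct_add w⁻¹ h)

lemma negRoot_notMem_posSystem (w : (rootSystem H).weylGroup) {α : H.root}
    (h : α ∈ posSystem B w) : negRoot α ∉ posSystem B w := by
  rw [mem_posSystem] at *
  rwa [weylAct_negRoot, isPos_negRoot, not_not]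

lemma IsClosedSet.inter {P Q : Set H.root} (hP : IsClosedSet P) (hQ : IsClosedSet Q) :
    IsClosedSet (P ∩ Q) := fun α hα β hβ γ h =>
  ⟨hP α hα.1 β hβ.1 γ h, hQ α hα.2 β hβ.2 γ h⟩

lemma isClosedSet_pos : IsClosedSet {α : H.root | B.IsPos α} :=
  fun _ hα _ hβ _ h => RootPairing.Base.IsPos.add hα hβ h

lemma mem_inversions {w : (rootSystem H).weylGroup} {α : H.root} :
    α ∈ inversions B w ↔ B.IsPos α ∧ ¬ B.IsPos (weylAct w⁻¹ α) := by
  rw [inversions, Set.mem_ofPred_eq, isPos_negRoot]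

lemma isClosedSet_inversions (w : (rootSystem H).weylGroup) :
    IsClosedSet (inversions B w) := by
  intro α hα β hβ γ h
  refine ⟨hα.1.add hβ.1 h, hα.2.add hβ.2 ?_⟩
  rw [root_negRoot, root_negRoot, root_negRoot, weylAct_add w⁻¹ h, neg_add]

lemma negRoot_notMem_inversions {w : (rootSystem H).weylGroup} {α : H.root}
    (h : α ∈ inversions B w) : negRoot α ∉ inversions B w := fun h' =>
  (isPos_negRoot B).mp h'.1 h.1

lemma isClosedSet_pos_diff_inversions (w : (rootSystem H).weylGroup) :
    IsClosedSet ({α | B.IsPos α} \ inversions B w) := by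
  have : {α | B.IsPos α} \ inversions B w = {α | B.IsPos α} ∩ posSystem B w := by
    ext α
    simp only [Set.mem_sdiff, Set.mem_ofPred_eq, mem_inversions, Set.mem_inter_iff, mem_posSystem]
    tauto
  rw [this]
  exact isClosedSet_pos.inter (isClosedSet_posSystem w)

lemma weylAct_image_diff_inversions (w : (rootSystem H).weylGroup) :
    weylAct w '' ({α | B.IsPos α} \ inversions B w⁻¹) = {α | B.IsPos α} \ inversions B w := by
  ext α
  simp only [Set.mem_image, Set.mem_sdiff, Set.mem_ofPred_eq, mem_inversions, inv_inv]
  constructor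
  · rintro ⟨β, ⟨h1, h2⟩, rfl⟩
    simp only [weylAct_inv_weylAct]
    tauto
  · rintro ⟨h1, h2⟩
    exact ⟨weylAct w⁻¹ α, by simp only [weylAct_weylAct_inv]; tauto, by simp⟩

/-- The positive roots, other than the simple root `α`, are permuted by `s_α`. -/
lemma isPos_reflectionPerm_iff {α β : H.root} (hα : α ∈ B.support) (h1 : β ≠ α)
    (h2 : β ≠ negRoot α) : B.IsPos ((rootSystem H).reflectionPerm α β) ↔ B.IsPos β := by
  have key : ∀ γ : H.root, γ ≠ α → B.IsPos γ → B.IsPos ((rootSystem H).reflectionPerm α γ) :=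
    fun γ h hγ => hγ.reflectionPerm hα h
  refine ⟨fun h => ?_, key β h1⟩
  have h3 := key _ (fun h4 => h2 ?_) h
  · simpa using h3
  · rw [← reflectionPerm_self_eq_negRoot]
    exact ((rootSystem H).reflectionPerm_self α β).symm.trans (congrArg _ h4)

/-- If `α'` is a simple root and `α = w α'`, then `s_α w Δ₊` differs from `w Δ₊` by the sign of
`α`. -/
lemma mem_posSystem_ofIdx_mul {w : (rootSystem H).weylGroup} {α δ : H.root}
    (hα : weylAct w⁻¹ α ∈ B.support) :
    δ ∈ posSystem B (RootPairing.weylGroup.ofIdx (rootSystem H) α * w) ↔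
      (δ ∈ posSystem B w ∧ δ ≠ α) ∨ δ = negRoot α := by
  have hinv : weylAct (RootPairing.weylGroup.ofIdx (rootSystem H) α * w)⁻¹ δ =
      (rootSystem H).reflectionPerm (weylAct w⁻¹ α) (weylAct w⁻¹ δ) := by
    rw [← weylAct_reflectionPerm, mul_inv_rev, weylAct_mul]
    rfl
  rw [mem_posSystem, hinv, mem_posSystem]
  have hpos : B.IsPos (weylAct w⁻¹ α) := RootPairing.Base.isPos_of_mem_support hα
  by_cases h1 : δ = α
  · subst h1
    rw [reflectionPerm_self_eq_negRoot, isPos_negRoot]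
    constructor
    · exact fun h => absurd hpos h
    · rintro (⟨-, h⟩ | h)
      · exact absurd rfl h
      · rw [h, weylAct_negRoot, isPos_negRoot] at hpos
        rw [h, weylAct_negRoot, isPos_negRoot, not_not]
        rw [h] at hpos
        simpa [isPos_negRoot] using hpos
  · by_cases h2 : δ = negRoot α
    · subst h2
      simp only [or_true, iff_true]
      rw [weylAct_negRoot, ← reflectionPerm_self_eq_negRoot]
      simpa using hpos
    · rw [isPos_reflectionPerm_iff hα]
      · simp [h1, h2]
      · exact fun h => h1 (weylAct_injective _ h)
      · rw [← weylAct_negRoot]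
        exact fun h => h2 (weylAct_injective _ h)

lemma exists_mem_support_not_isPos {w : (rootSystem H).weylGroup}
    (h : (inversions B w).Nonempty) : ∃ α ∈ B.support, ¬ B.IsPos (weylAct w α) := by
  by_contra! hc
  obtain ⟨γ, h1, h2⟩ := h
  have : B.IsPos (weylAct w (negRoot (weylAct w⁻¹ γ))) := by
    refine RootPairing.Base.IsPos.induction_on_add (p := fun α => B.IsPos (weylAct w α)) h2 hc ?_
    intro i j k hk hi hj
    exact hi.add (hc j hj) (weylAct_add w hk)
  rw [weylAct_negRoot, weylAct_weylAct_inv, isPos_negRoot] at this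
  exact this h1

/-- The complement in `Δ₊` of each tail of the list `l` is closed. Such lists are the sequences of
roots along which elements of `𝔟` can be straightened. -/
def IsStraighteningList (B : (rootSystem H).Base) (l : List H.root) : Prop :=
  l.Nodup ∧ (∀ α ∈ l, B.IsPos α) ∧ ∀ l', l' <:+ l → IsClosedSet {α | B.IsPos α ∧ α ∉ l'}

lemma IsStraighteningList.tail {α : H.root} {l : List H.root}
    (h : IsStraighteningList B (α :: l)) : IsStraighteningList B l :=
  ⟨(List.nodup_cons.mp h.1).2, fun β hβ => h.2.1 β (List.mem_cons_of_mem _ hβ),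
    fun l' hl' => h.2.2 l' (hl'.trans (List.suffix_cons α l))⟩

variable (B) in
/-- The inversions of each `w` can be arranged in a straightening list. -/
lemma exists_isStraighteningList (w : (rootSystem H).weylGroup) :
    ∃ l : List H.root, IsStraighteningList B l ∧ ∀ α, α ∈ l ↔ α ∈ inversions B w := by
  generalize hN : (inversions B w).ncard = N
  induction N generalizing w with
  | zero =>
    have h0 : inversions B w = ∅ := (Set.ncard_eq_zero (Set.toFinite _)).mp hN
    refine ⟨[], ⟨List.nodup_nil, by simp, fun l' hl' => ?_⟩, by simp [h0]⟩
    rw [List.suffix_nil.mp hl']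
    simpa using isClosedSet_pos
  | succ N ih =>
    have hne : (inversions B w).Nonempty := by
      rw [← Set.ncard_pos, hN]
      omega
    obtain ⟨α, hα, hwα⟩ := exists_mem_support_not_isPos hne
    -- `w` and `w s_α` differ by the inversion `-w α`
    set β := negRoot (weylAct w α) with hβ
    have hβpos : B.IsPos β := (isPos_negRoot B).mpr hwα
    set w' := w * RootPairing.weylGroup.ofIdx (rootSystem H) α with hw'
    have hs : ∀ γ, weylAct w'⁻¹ γ = (rootSystem H).reflectionPerm α (weylAct w⁻¹ γ) := by
      intro γ
      have : γ = weylAct w' ((rootSystem H).reflectionPerm α (weylAct w⁻¹ γ)) := by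
        rw [hw', weylAct_mul, weylAct_ofIdx]
        simp
      conv_lhs => rw [this]
      rw [weylAct_inv_weylAct]
    have hwβ : weylAct w⁻¹ β = negRoot α := by rw [hβ, weylAct_negRoot, weylAct_inv_weylAct]
    have hαpos : B.IsPos α := RootPairing.Base.isPos_of_mem_support hα
    have hβw : β ∈ inversions B w := by
      exact ⟨hβpos, by rwa [hwβ, negRoot_negRoot]⟩
    have hinv : inversions B w' = inversions B w \ {β} := by
      ext γ
      rw [Set.mem_sdiff, mem_inversions, mem_inversions, Set.mem_singleton_iff, hs]
      by_cases hγ : γ = β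
      · subst hγ
        rw [hwβ, ← reflectionPerm_self_eq_negRoot]
        simp [hαpos]
      · by_cases hpos : B.IsPos γ
        · rw [isPos_reflectionPerm_iff hα]
          · simp [hγ]
          · intro h
            have h2 : γ = weylAct w α := by rw [← h, weylAct_weylAct_inv]
            exact hwα (h2 ▸ hpos)
          · intro h
            apply hγ
            rw [hβ, ← weylAct_negRoot, ← h, weylAct_weylAct_inv]
        · simp [hpos]
    obtain ⟨l, hl, hmem⟩ := ih w' (by
      rw [hinv, Set.ncard_sdiff_singleton_of_mem hβw, hN]
      rfl)
    have hmem' : ∀ γ, γ ∈ β :: l ↔ γ ∈ inversions B w := by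
      intro γ
      rw [List.mem_cons, hmem, hinv]
      by_cases h : γ = β
      · simp [h, hβw]
      · simp [h]
    have hβl : β ∉ l := by rw [hmem, hinv]; simp
    refine ⟨β :: l, ⟨List.nodup_cons.mpr ⟨hβl, hl.1⟩, fun γ hγ => ((hmem' γ).mp hγ).1,
      fun l' hl' => ?_⟩, hmem'⟩
    rcases List.suffix_cons_iff.mp hl' with rfl | h
    · have := isClosedSet_pos_diff_inversions (B := B) w
      convert! this using 1
      ext γ
      rw [Set.mem_sdiff, ← hmem']
      rfl
    · exact hl.2.2 l' h

lemma mem_of_sublist_append_cons {X : Type*} {l₁ l : List X} {a b : X}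
    (hnd : (l₁ ++ a :: l).Nodup) (h : [a, b].Sublist (l₁ ++ a :: l)) : b ∈ l := by
  have ha : a ∉ l₁ := fun hm => List.disjoint_of_nodup_append hnd hm (by simp)
  obtain ⟨x, y, hxy, hx, hy⟩ := List.sublist_append_iff.mp h
  cases x with
  | nil =>
    rw [List.nil_append] at hxy
    subst hxy
    exact List.singleton_sublist.mp (List.cons_sublist_cons.mp hy)
  | cons c x =>
    obtain ⟨rfl, -⟩ := List.cons.inj hxy
    exact absurd (hx.subset (by simp)) ha

/-- For a tail `l` of a normal ordering, `wordProd l` maps the positive roots to the positive roots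
outside `l` and the negatives of the roots in `l`. -/
lemma IsNormalOrdering.mem_posSystem_wordProd {l₁ l₂ : List H.root}
    (h : IsNormalOrdering B (l₁ ++ l₂)) (δ : H.root) :
    δ ∈ posSystem B (wordProd l₂) ↔ (B.IsPos δ ∧ δ ∉ l₂) ∨ negRoot δ ∈ l₂ := by
  induction l₂ generalizing l₁ δ with
  | nil => simp [wordProd, posSystem_one]
  | cons α l ih =>
    have ih' := ih (l₁ := l₁ ++ [α]) (by simpa using h)
    have hpos : ∀ β ∈ l₁ ++ α :: l, B.IsPos β := fun β hβ => (h.mem_iff β).mp hβ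
    have hα : B.IsPos α := hpos α (by simp)
    have hnd := h.nodup
    have hαl : α ∉ l := by
      have := (List.nodup_append.mp hnd).2.1
      exact (List.nodup_cons.mp this).1
    have hαmem : α ∈ posSystem B (wordProd l) := (ih' α).mpr (Or.inl ⟨hα, hαl⟩)
    have hnegα : negRoot α ∉ l := fun hm =>
      (isPos_negRoot B).mp (hpos _ (by simp [hm])) hα
    -- `α` is not a sum of two roots of the positive system of `l`
    have hsum : ∀ γ δ, γ ∈ posSystem B (wordProd l) → δ ∈ posSystem B (wordProd l) →
        (rootSystem H).root α ≠ (rootSystem H).root γ + (rootSystem H).root δ := by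
      have hin : ∀ γ, B.IsPos γ → γ ∈ l₁ ++ α :: l := fun γ hγ => (h.mem_iff γ).mpr hγ
      have mixed : ∀ γ δ, B.IsPos γ → γ ∉ l → negRoot δ ∈ l →
          (rootSystem H).root α ≠ (rootSystem H).root γ + (rootSystem H).root δ := by
        intro γ δ h1 h2 h3 heq
        have heq' : (rootSystem H).root γ =
            (rootSystem H).root α + (rootSystem H).root (negRoot δ) := by
          rw [root_negRoot, heq]
          abel
        rcases h.between α (by simp) (negRoot δ) (by simp [h3]) γ (hin γ h1) heq' with hs | hs
        · exact h2 (mem_of_sublist_append_cons hnd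
            (((List.Sublist.refl [γ]).trans (by simp)).cons_cons α |>.trans hs))
        · obtain ⟨s, t, rfl⟩ := List.append_of_mem h3
          have hs' : [negRoot δ, α].Sublist ((l₁ ++ α :: s) ++ negRoot δ :: t) := by
            refine List.Sublist.trans ?_ (by simpa using hs)
            exact List.Sublist.cons_cons _ (List.sublist_cons_self _ _)
          have hmem := mem_of_sublist_append_cons (by simpa using hnd) hs'
          exact hαl (by simp [hmem])
      intro γ δ hγ hδ heq
      rcases (ih' γ).mp hγ with ⟨h1, h2⟩ | h1 <;> rcases (ih' δ).mp hδ with ⟨h3, h4⟩ | h3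
      · rcases h.between γ (hin γ h1) δ (hin δ h3) α (by simp) heq with hs | hs
        · exact h4 (mem_of_sublist_append_cons hnd ((List.sublist_cons_self _ _).trans hs))
        · exact h2 (mem_of_sublist_append_cons hnd ((List.sublist_cons_self _ _).trans hs))
      · exact mixed γ δ h1 h2 h3 heq
      · exact mixed δ γ h3 h4 h1 (by rw [heq, add_comm])
      · refine (isPos_negRoot B).mp ((hpos (negRoot γ) (by simp [h1])).add
          (hpos (negRoot δ) (by simp [h3])) ?_) hα
        rw [root_negRoot, root_negRoot, root_negRoot, heq, neg_add]
    -- `α` is indecomposable in `wordProd l • Δ₊`, so it is the image of a simple root.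
    have hsimple : weylAct (wordProd l)⁻¹ α ∈ B.support := by
      rw [mem_posSystem] at hαmem
      obtain ⟨j, hj, hj'⟩ := hαmem.exists_mem_support_pos_pairingIn
      rw [(rootSystem H).zero_lt_pairingIn_iff'] at hj'
      by_contra hns
      have hne : weylAct (wordProd l)⁻¹ α ≠ j := fun h => hns (h ▸ hj)
      obtain ⟨k, hk⟩ := (rootSystem H).root_sub_root_mem_of_pairingIn_pos hj' hne
      have hkpos : B.IsPos k := hαmem.sub hj hk
      refine hsum (weylAct (wordProd l) k) (weylAct (wordProd l) j)
        (mem_posSystem.mpr (by simpa using hkpos))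
        (mem_posSystem.mpr (by simpa using RootPairing.Base.isPos_of_mem_support hj)) ?_
      rw [← weylAct_add (γ := weylAct (wordProd l)⁻¹ α), weylAct_weylAct_inv]
      rw [hk]
      abel
    have hword : wordProd (α :: l) =
        RootPairing.weylGroup.ofIdx (rootSystem H) α * wordProd l := by simp [wordProd]
    rw [hword, mem_posSystem_ofIdx_mul hsimple, ih']
    have hnn : δ = negRoot α ↔ negRoot δ = α := by
      constructor
      · rintro rfl
        simp
      · rintro rfl
        simp
    rw [hnn, List.mem_cons, List.mem_cons]
    by_cases h1 : δ = α
    · subst h1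
      simp [hnegα]
    · simp only [h1, false_or, ne_eq, not_false_eq_true, and_true]
      tauto

end Roots

/-! ### Calculus in the localized algebras of functions -/

section Calculus

variable {L : Type*} [LieRing L] [LieAlgebra ℂ L] [FiniteDimensional ℂ L] [IsKilling ℂ L]
  {H : LieSubalgebra ℂ L} [H.IsCartanSubalgebra]

namespace RootVectors

variable (e : RootVectors H)

/-- The linear function `y ↦ α h` for `y = h + ∑ c_α e_α`. -/
def rootLin (α : H.root) : Module.Dual ℂ L :=
  (LieModule.Weight.toLinear ℂ H L (α : LieModule.Weight ℂ H L)).comp e.hPart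

lemma rootLin_apply (α : H.root) (y : L) : e.rootLin α y = e.rootVal α y := rfl

lemma rootVal_eq_of_hPart_eq {y z : L} (h : e.hPart z = e.hPart y) (α : H.root) :
    e.rootVal α z = e.rootVal α y := by
  rw [rootVal, rootVal, h]

variable {U V : Set L}

lemma linear_mem_regFun (ℓ : Module.Dual ℂ L) :
    (fun y : e.regPart U => ℓ (y : L)) ∈ e.regFun U :=
  Algebra.subset_adjoin (Or.inl ⟨ℓ, rfl⟩)

lemma inv_rootVal_mem_regFun (α : H.root) :
    (fun y : e.regPart U => (e.rootVal α (y : L))⁻¹) ∈ e.regFun U :=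
  Algebra.subset_adjoin (Or.inr ⟨α, rfl⟩)

/-- A map into `U'` pulls `ℂ[U]'` back into an algebra of functions if it does so for the
generators. -/
lemma comp_mem_of_mem_regFun {X : Type*} (A : Subalgebra ℂ (X → ℂ)) (σ : X → e.regPart U)
    (h1 : ∀ ℓ : Module.Dual ℂ L, (fun x => ℓ (σ x : L)) ∈ A)
    (h2 : ∀ α, (fun x => (e.rootVal α (σ x : L))⁻¹) ∈ A) {f : e.regPart U → ℂ}
    (hf : f ∈ e.regFun U) : f ∘ σ ∈ A := by
  induction hf using Algebra.adjoin_induction with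
  | mem f hf =>
    rcases hf with ⟨ℓ, rfl⟩ | ⟨α, rfl⟩
    · exact h1 ℓ
    · exact h2 α
  | algebraMap r => exact A.algebraMap_mem r
  | add f g _ _ hf hg => exact A.add_mem hf hg
  | mul f g _ _ hf hg => exact A.mul_mem hf hg

lemma linear_adExp_mem {X : Type*} (A : Subalgebra ℂ (X → ℂ)) (σ : X → L)
    (hσ : ∀ ℓ : Module.Dual ℂ L, (fun x => ℓ (σ x)) ∈ A) {s : X → ℂ} (hs : s ∈ A) (v : L)
    (ℓ : Module.Dual ℂ L) : (fun x => ℓ (adExp v (s x) (σ x))) ∈ A := by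
  have : (fun x => ℓ (adExp v (s x) (σ x))) =
      ∑ k ∈ Finset.range (Module.finrank ℂ L), ((k.factorial : ℂ)⁻¹) •
        (s ^ k * fun x => (ℓ.comp ((ad ℂ L v) ^ k)) (σ x)) := by
    funext x
    simp only [adExp_apply, map_sum, map_smul, smul_eq_mul, Finset.sum_apply, Pi.smul_apply,
      Pi.mul_apply, Pi.pow_apply, LinearMap.comp_apply]
    exact Finset.sum_congr rfl fun k _ => by ring
  rw [this]
  exact A.sum_mem fun k _ => A.smul_mem (A.mul_mem (A.pow_mem hs k) (hσ _)) _

open Classical in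
/-- The extension by zero of a function on `L'`. -/
def extendZero (φ : e.regPart (Set.univ : Set L) → ℂ) (y : L) : ℂ :=
  if h : y ∈ e.regPart (Set.univ : Set L) then φ ⟨y, h⟩ else 0

lemma extendZero_of_mem (φ : e.regPart (Set.univ : Set L) → ℂ) {y : L}
    (h : y ∈ e.regPart (Set.univ : Set L)) : e.extendZero φ y = φ ⟨y, h⟩ := dif_pos h

/-- `D` is a differential of `φ`: it computes the derivatives of `φ` along all differentiable
curves in `L'`. -/
def HasDifferential (φ : e.regPart (Set.univ : Set L) → ℂ)
    (D : L →ₗ[ℂ] (e.regPart (Set.univ : Set L) → ℂ)) : Prop :=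
  ∀ (c : ℂ → L) (v : L) (t : ℂ) (ht : c t ∈ e.regPart (Set.univ : Set L)),
    (∀ ℓ : Module.Dual ℂ L, HasDerivAt (fun s => ℓ (c s)) (ℓ v) t) →
      HasDerivAt (fun s => e.extendZero φ (c s)) (D v ⟨c t, ht⟩) t

lemma eventually_mem_regPart {c : ℂ → L} {v : L} {t : ℂ}
    (ht : c t ∈ e.regPart (Set.univ : Set L))
    (hc : ∀ ℓ : Module.Dual ℂ L, HasDerivAt (fun s => ℓ (c s)) (ℓ v) t) :
    ∀ᶠ s in nhds t, c s ∈ e.regPart (Set.univ : Set L) := by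
  have : ∀ α : H.root, ∀ᶠ s in nhds t, e.rootVal α (c s) ≠ 0 := fun α =>
    (hc (e.rootLin α)).continuousAt.eventually_ne (ht.2 α)
  filter_upwards [Filter.eventually_all.mpr this] with s hs
  exact ⟨trivial, hs⟩

lemma exists_differential {φ : e.regPart (Set.univ : Set L) → ℂ}
    (hφ : φ ∈ e.regFun (Set.univ : Set L)) :
    ∃ D : L →ₗ[ℂ] (e.regPart (Set.univ : Set L) → ℂ),
      (∀ v, D v ∈ e.regFun (Set.univ : Set L)) ∧ e.HasDifferential φ D := by
  induction hφ using Algebra.adjoin_induction with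
  | mem f hf =>
    rcases hf with ⟨ℓ, rfl⟩ | ⟨α, rfl⟩
    · refine ⟨LinearMap.pi fun _ => ℓ, fun v => (e.regFun _).algebraMap_mem (ℓ v), ?_⟩
      intro c v t ht hc
      refine (hc ℓ).congr_of_eventuallyEq ?_
      filter_upwards [e.eventually_mem_regPart ht hc] with s hs
      rw [extendZero_of_mem _ _ hs]
    · refine ⟨LinearMap.pi fun y => (-((e.rootVal α (y : L))⁻¹) ^ 2) • e.rootLin α, fun v => ?_, ?_⟩
      · have := (e.regFun (Set.univ : Set L)).smul_mem
          ((e.regFun (Set.univ : Set L)).pow_mem (e.inv_rootVal_mem_regFun (U := Set.univ) α) 2)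
          (-e.rootLin α v)
        convert! this using 1
        funext y
        simp only [LinearMap.pi_apply, LinearMap.smul_apply, smul_eq_mul, Pi.smul_apply,
          Pi.pow_apply]
        ring
      · intro c v t ht hc
        have h := (hc (e.rootLin α)).inv (ht.2 α)
        have h2 : (LinearMap.pi (fun y : e.regPart (Set.univ : Set L) =>
            (-((e.rootVal α (y : L))⁻¹) ^ 2) • e.rootLin α) v) ⟨c t, ht⟩ =
            -e.rootLin α v / e.rootLin α (c t) ^ 2 := by
          simp only [LinearMap.pi_apply, LinearMap.smul_apply, smul_eq_mul, rootLin_apply]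
          field_simp
        rw [h2]
        refine h.congr_of_eventuallyEq ?_
        filter_upwards [e.eventually_mem_regPart ht hc] with s hs
        rw [extendZero_of_mem _ _ hs]
        rfl
  | algebraMap r =>
    refine ⟨0, fun v => (e.regFun _).zero_mem, ?_⟩
    intro c v t ht hc
    refine (hasDerivAt_const t r).congr_of_eventuallyEq ?_
    filter_upwards [e.eventually_mem_regPart ht hc] with s hs
    rw [extendZero_of_mem _ _ hs]
    rfl
  | add f g _ _ hf hg =>
    obtain ⟨D, hD, hfD⟩ := hf
    obtain ⟨E, hE, hgE⟩ := hg
    refine ⟨D + E, fun v => (e.regFun _).add_mem (hD v) (hE v), ?_⟩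
    intro c v t ht hc
    refine ((hfD c v t ht hc).add (hgE c v t ht hc)).congr_of_eventuallyEq ?_
    filter_upwards [e.eventually_mem_regPart ht hc] with s hs
    simp only [Pi.add_apply, extendZero_of_mem _ _ hs]
  | mul f g hf' hg' hf hg =>
    obtain ⟨D, hD, hfD⟩ := hf
    obtain ⟨E, hE, hgE⟩ := hg
    refine ⟨LinearMap.pi fun y => g y • (LinearMap.proj y).comp D +
      f y • (LinearMap.proj y).comp E, fun v => ?_, ?_⟩
    · exact (e.regFun _).add_mem ((e.regFun _).mul_mem hg' (hD v))
        ((e.regFun _).mul_mem hf' (hE v))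
    · intro c v t ht hc
      have h := (hfD c v t ht hc).mul (hgE c v t ht hc)
      refine (h.congr_of_eventuallyEq ?_).congr_deriv ?_
      · filter_upwards [e.eventually_mem_regPart ht hc] with s hs
        simp only [Pi.mul_apply, extendZero_of_mem _ _ hs]
      · simp only [extendZero_of_mem _ _ ht, LinearMap.pi_apply, LinearMap.add_apply,
          LinearMap.smul_apply, LinearMap.comp_apply, LinearMap.proj_apply, smul_eq_mul]
        ring

variable {e} in
lemma HasDifferential.dirDeriv_eq {φ : e.regPart (Set.univ : Set L) → ℂ}
    {D : L →ₗ[ℂ] (e.regPart (Set.univ : Set L) → ℂ)} (h : e.HasDifferential φ D) (v : L)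
    (y : e.regPart (Set.univ : Set L)) : e.dirDeriv φ v y = D v y := by
  have hy : (y : L) + (0 : ℂ) • v ∈ e.regPart (Set.univ : Set L) := by
    simpa only [zero_smul, add_zero] using y.2
  have h1 := h (fun s => (y : L) + s • v) v 0 hy (fun ℓ => by
    simpa using ((hasDerivAt_id (0 : ℂ)).mul_const (ℓ v)).const_add (ℓ y))
  have h2 : (⟨(y : L) + (0 : ℂ) • v, hy⟩ : e.regPart (Set.univ : Set L)) = y :=
    Subtype.ext (by simp)
  rw [h2] at h1
  exact h1.deriv

end RootVectors

end Calculus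

/-! ### The Poisson bracket with a root function -/

section Poisson

variable {L : Type*} [LieRing L] [LieAlgebra ℂ L] [FiniteDimensional ℂ L] [IsKilling ℂ L]
  {H : LieSubalgebra ℂ L} [H.IsCartanSubalgebra]

namespace RootVectors

variable (e : RootVectors H) {κ : LinearMap.BilinForm ℂ L}

section Form

variable (hκ_inv : κ.lieInvariant L)

include hκ_inv

lemma form_vec_coe (α : H.root) (h : H) : κ (e.vec α) h = 0 := by
  obtain ⟨h', hh'⟩ := exists_apply_ne_zero α
  have h0 : ⁅(h' : L), (h : L)⁆ = 0 := by
    have := trivial_lie_zero H H h' h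
    simpa using congrArg (Subtype.val : H → L) this
  have h1 := hκ_inv (h' : L) (e.vec α) (h : L)
  rw [lie_coe_vec, h0, map_zero, neg_zero, map_smul, LinearMap.smul_apply, smul_eq_mul] at h1
  exact (mul_eq_zero.mp h1).resolve_left hh'

lemma form_vec_vec {α β : H.root} (hβ : β ≠ negRoot α) : κ (e.vec α) (e.vec β) = 0 := by
  have : ∃ h : H, (α : LieModule.Weight ℂ H L) h + (β : LieModule.Weight ℂ H L) h ≠ 0 := by
    by_contra! hc
    apply hβ
    rw [← root_eq_iff]
    funext h
    rw [negRoot_apply]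
    linear_combination hc h
  obtain ⟨h, hh⟩ := this
  have h1 := hκ_inv (h : L) (e.vec α) (e.vec β)
  rw [lie_coe_vec, lie_coe_vec, map_smul, map_smul, LinearMap.smul_apply, smul_eq_mul,
    smul_eq_mul] at h1
  have h2 : ((α : LieModule.Weight ℂ H L) h + (β : LieModule.Weight ℂ H L) h) *
      κ (e.vec α) (e.vec β) = 0 := by linear_combination h1
  exact (mul_eq_zero.mp h2).resolve_left hh

lemma form_vec (α : H.root) (v : L) :
    κ (e.vec α) v = e.coef (negRoot α) v * κ (e.vec α) (e.vec (negRoot α)) := by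
  conv_lhs => rw [e.eq_hPart_add_sum v]
  rw [map_add, e.form_vec_coe hκ_inv, zero_add, map_sum, Finset.sum_eq_single (negRoot α)]
  · simp
  · intro β _ hβ
    rw [map_smul, e.form_vec_vec hκ_inv hβ, smul_zero]
  · simp

lemma form_vec_negRoot_ne_zero (hκ : κ.Nondegenerate) (α : H.root) :
    κ (e.vec α) (e.vec (negRoot α)) ≠ 0 := by
  intro h
  refine e.ne_zero α (hκ.1 _ fun v => ?_)
  rw [e.form_vec hκ_inv, h, mul_zero]

end Form

variable (hκ : κ.Nondegenerate)

omit [IsKilling ℂ L] in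
lemma _root_.Zhelobenko.form_gradient (ℓ : Module.Dual ℂ L) (v : L) :
    κ (∑ i, ℓ (Module.finBasis ℂ L i) • κ.dualBasis hκ (Module.finBasis ℂ L) i) v = ℓ v := by
  conv_rhs => rw [← (Module.finBasis ℂ L).sum_repr v]
  conv_lhs => rw [← (Module.finBasis ℂ L).sum_repr v]
  simp only [map_sum, map_smul, LinearMap.sum_apply, LinearMap.smul_apply, smul_eq_mul,
    LinearMap.BilinForm.apply_dualBasis_left, mul_ite, mul_one, mul_zero]
  simp

/-- The Poisson bracket with `ê_α` is, up to a constant, the derivative along the vector field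
`y ↦ [e_α, y]`. -/
lemma poisson_eHat (hκ_symm : κ.IsSymm) (hκ_inv : κ.lieInvariant L) (α : H.root)
    {φ : e.regPart (Set.univ : Set L) → ℂ} {D : L →ₗ[ℂ] (e.regPart (Set.univ : Set L) → ℂ)}
    (hD : e.HasDifferential φ D) (y : e.regPart (Set.univ : Set L)) :
    e.poisson κ hκ (e.eHat Set.univ α : e.regPart (Set.univ : Set L) → ℂ) φ y =
      -(κ (e.vec α) (e.vec (negRoot α)))⁻¹ * D ⁅e.vec α, (y : L)⁆ y := by
  have hE : e.HasDifferential (e.eHat Set.univ α : e.regPart (Set.univ : Set L) → ℂ)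
      (LinearMap.pi fun _ => e.coef (negRoot α)) := by
    intro c v t ht hc
    refine (hc (e.coef (negRoot α))).congr_of_eventuallyEq ?_
    filter_upwards [e.eventually_mem_regPart ht hc] with s hs
    rw [extendZero_of_mem _ _ hs]
    rfl
  set k := κ (e.vec α) (e.vec (negRoot α)) with hk
  have hk0 : k ≠ 0 := e.form_vec_negRoot_ne_zero hκ_inv hκ α
  have hgrad : ∑ i, e.coef (negRoot α) (Module.finBasis ℂ L i) •
      κ.dualBasis hκ (Module.finBasis ℂ L) i = k⁻¹ • e.vec α := by
    rw [← sub_eq_zero]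
    refine hκ.1 _ fun v => ?_
    rw [map_sub, LinearMap.sub_apply, form_gradient, map_smul, LinearMap.smul_apply,
      e.form_vec hκ_inv, ← hk, smul_eq_mul]
    field_simp
    ring
  have hpo : e.poisson κ hκ (e.eHat Set.univ α : e.regPart (Set.univ : Set L) → ℂ) φ y =
      κ (y : L) ⁅∑ i, e.coef (negRoot α) (Module.finBasis ℂ L i) •
        κ.dualBasis hκ (Module.finBasis ℂ L) i,
        ∑ i, ((LinearMap.proj y).comp D) (Module.finBasis ℂ L i) •
        κ.dualBasis hκ (Module.finBasis ℂ L) i⁆ := by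
    simp only [poisson, hE.dirDeriv_eq, hD.dirDeriv_eq]
    rfl
  have hs : ∀ x z, κ x z = κ z x := fun x z => hκ_symm.eq x z
  rw [hpo, hgrad, smul_lie, map_smul, ← neg_neg (κ (y : L) _), ← hκ_inv, hs, form_gradient]
  simp

lemma poisson_eHat_mem (hκ_symm : κ.IsSymm) (hκ_inv : κ.lieInvariant L) (α : H.root)
    {φ : e.regPart (Set.univ : Set L) → ℂ} (hφ : φ ∈ e.regFun (Set.univ : Set L)) :
    e.poisson κ hκ (e.eHat Set.univ α : e.regPart (Set.univ : Set L) → ℂ) φ ∈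
      e.regFun (Set.univ : Set L) := by
  obtain ⟨D, hDm, hD⟩ := e.exists_differential hφ
  let b := Module.finBasis ℂ L
  have : e.poisson κ hκ (e.eHat Set.univ α : e.regPart (Set.univ : Set L) → ℂ) φ =
      ∑ i, (-(κ (e.vec α) (e.vec (negRoot α)))⁻¹) •
        ((fun y : e.regPart (Set.univ : Set L) => ((b.coord i).comp (ad ℂ L (e.vec α))) (y : L)) *
          D (b i)) := by
    funext y
    have hsum : D ⁅e.vec α, (y : L)⁆ y = ∑ i, b.repr ⁅e.vec α, (y : L)⁆ i * D (b i) y := by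
      conv_lhs => rw [← b.sum_repr ⁅e.vec α, (y : L)⁆]
      simp only [map_sum, map_smul, Finset.sum_apply, Pi.smul_apply, smul_eq_mul]
    rw [e.poisson_eHat hκ hκ_symm hκ_inv α hD, hsum, Finset.mul_sum]
    simp
  rw [this]
  exact (e.regFun _).sum_mem fun i _ => (e.regFun _).smul_mem
    ((e.regFun _).mul_mem (e.linear_mem_regFun _) (hDm _)) _

section Series

variable {P : Set H.root} (hP : IsClosedSet P) {α : H.root} (hα : α ∈ P)
  (hneg : negRoot α ∉ P)

include hP hα hneg

lemma adExp_mem_regPart_univ {y : L} (hy : y ∈ e.hSum P)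
    (hreg : ∀ β : H.root, e.rootVal β y ≠ 0) (t : ℂ) :
    adExp (e.vec α) t y ∈ e.regPart (Set.univ : Set L) :=
  ⟨trivial, fun β => by
    rw [e.rootVal_eq_of_hPart_eq (e.hPart_adExp_vec hP hα hneg hy t)]
    exact hreg β⟩

/-- Along the curves `t ↦ exp (t ad e_α) y` in `𝔥 ⊕ ⨁_P 𝔤_γ` a function in `ℂ[𝔤]'` is a polynomial
in `t` whose degree is bounded independently of `y`. -/
lemma exists_polynomial_adExp {φ : e.regPart (Set.univ : Set L) → ℂ}
    (hφ : φ ∈ e.regFun (Set.univ : Set L)) :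
    ∃ d : ℕ, ∀ y ∈ e.hSum P, ∀ _ : ∀ β : H.root, e.rootVal β y ≠ 0,
      ∃ p : Polynomial ℂ, p.natDegree ≤ d ∧
        ∀ t, ∀ h : adExp (e.vec α) t y ∈ e.regPart (Set.univ : Set L),
          φ ⟨adExp (e.vec α) t y, h⟩ = p.eval t := by
  induction hφ using Algebra.adjoin_induction with
  | mem f hf =>
    rcases hf with ⟨ℓ, rfl⟩ | ⟨β, rfl⟩
    · refine ⟨Module.finrank ℂ L, fun y _ _ => ⟨∑ k ∈ Finset.range (Module.finrank ℂ L),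
        Polynomial.C (ℓ (((ad ℂ L (e.vec α)) ^ k) y) / (k.factorial : ℂ)) * Polynomial.X ^ k,
        ?_, fun t _ => ?_⟩⟩
      · refine Polynomial.natDegree_sum_le_of_forall_le _ _ fun k hk => ?_
        exact (Polynomial.natDegree_C_mul_X_pow_le _ _).trans (Finset.mem_range.mp hk).le
      · simp only [adExp_apply, map_sum, map_smul, smul_eq_mul, Polynomial.eval_finsetSum,
          Polynomial.eval_mul, Polynomial.eval_C, Polynomial.eval_pow, Polynomial.eval_X]
        exact Finset.sum_congr rfl fun k _ => by ring
    · refine ⟨0, fun y hy _ => ⟨Polynomial.C (e.rootVal β y)⁻¹, by simp, fun t _ => ?_⟩⟩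
      rw [Polynomial.eval_C]
      exact congrArg _ (e.rootVal_eq_of_hPart_eq (e.hPart_adExp_vec hP hα hneg hy t) β)
  | algebraMap r => exact ⟨0, fun y _ _ => ⟨Polynomial.C r, by simp, fun t _ => by simp⟩⟩
  | add f g _ _ hf hg =>
    obtain ⟨d, hd⟩ := hf
    obtain ⟨d', hd'⟩ := hg
    refine ⟨max d d', fun y hy hr => ?_⟩
    obtain ⟨p, hp, hp'⟩ := hd y hy hr
    obtain ⟨q, hq, hq'⟩ := hd' y hy hr
    exact ⟨p + q, (Polynomial.natDegree_add_le _ _).trans (max_le_max hp hq), fun t h => by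
      simp [hp' t h, hq' t h]⟩
  | mul f g _ _ hf hg =>
    obtain ⟨d, hd⟩ := hf
    obtain ⟨d', hd'⟩ := hg
    refine ⟨d + d', fun y hy hr => ?_⟩
    obtain ⟨p, hp, hp'⟩ := hd y hy hr
    obtain ⟨q, hq, hq'⟩ := hd' y hy hr
    exact ⟨p * q, Polynomial.natDegree_mul_le.trans (add_le_add hp hq), fun t h => by
      simp [hp' t h, hq' t h]⟩

/-- Iterated brackets with `ê_α` are, up to constants, the derivatives along the curves
`t ↦ exp (t ad e_α) y`. -/
lemma poisson_iterate_adExp (hκ_symm : κ.IsSymm) (hκ_inv : κ.lieInvariant L) {y : L}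
    (hy : y ∈ e.hSum P) (hreg : ∀ β : H.root, e.rootVal β y ≠ 0) (i : ℕ)
    {φ : e.regPart (Set.univ : Set L) → ℂ} (hφ : φ ∈ e.regFun (Set.univ : Set L))
    {p : Polynomial ℂ} (hp : ∀ t, φ ⟨adExp (e.vec α) t y,
      e.adExp_mem_regPart_univ hP hα hneg hy hreg t⟩ = p.eval t) (t : ℂ) :
    ((e.poisson κ hκ (e.eHat Set.univ α : e.regPart (Set.univ : Set L) → ℂ))^[i] φ)
        ⟨adExp (e.vec α) t y, e.adExp_mem_regPart_univ hP hα hneg hy hreg t⟩ =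
      (-(κ (e.vec α) (e.vec (negRoot α)))⁻¹) ^ i * (Polynomial.derivative^[i] p).eval t := by
  induction i generalizing φ p with
  | zero => simpa using hp t
  | succ i ih =>
    set k := κ (e.vec α) (e.vec (negRoot α))
    have hder : ∀ s, e.poisson κ hκ (e.eHat Set.univ α : e.regPart (Set.univ : Set L) → ℂ) φ
        ⟨adExp (e.vec α) s y, e.adExp_mem_regPart_univ hP hα hneg hy hreg s⟩ =
          (Polynomial.C (-k⁻¹) * Polynomial.derivative p).eval s := by
      intro s
      obtain ⟨D, -, hD⟩ := e.exists_differential hφ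
      rw [e.poisson_eHat hκ hκ_symm hκ_inv α hD]
      have h1 := hD (fun s => adExp (e.vec α) s y) ⁅e.vec α, adExp (e.vec α) s y⁆ s
        (e.adExp_mem_regPart_univ hP hα hneg hy hreg s)
        (fun ℓ => hasDerivAt_adExp (e.isNilpotent_ad_vec α) y ℓ s)
      have h2 : (fun s => e.extendZero φ (adExp (e.vec α) s y)) = fun s => p.eval s := by
        funext s
        rw [extendZero_of_mem _ _ (e.adExp_mem_regPart_univ hP hα hneg hy hreg s), hp]
      rw [h2] at h1
      rw [h1.unique (p.hasDerivAt s)]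
      simp [k]
    rw [Function.iterate_succ_apply,
      ih (e.poisson_eHat_mem hκ hκ_symm hκ_inv α hφ) hder, Function.iterate_succ_apply,
      Polynomial.iterate_derivative_C_mul]
    simp only [Polynomial.eval_mul, Polynomial.eval_C]
    ring

/-- The series of `Q_α` is the Taylor expansion of `φ` along `t ↦ exp (t ad e_α) y`, evaluated at
`t = c_α / α h`. It is a finite sum, with a bound that does not depend on `y`. -/
theorem exists_sum_seriesTerm_eq (hκ_symm : κ.IsSymm) (hκ_inv : κ.lieInvariant L)
    {φ : e.regPart (Set.univ : Set L) → ℂ} (hφ : φ ∈ e.regFun (Set.univ : Set L)) :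
    ∃ M : ℕ, ∀ m ≥ M, ∀ y, ∀ hy : y ∈ e.hSum P, ∀ hreg : ∀ β : H.root, e.rootVal β y ≠ 0,
      ∑ i ∈ Finset.range m, e.seriesTerm κ hκ α φ i ⟨y, trivial, hreg⟩ =
        φ ⟨adExp (e.vec α) (e.coef α y / e.rootVal α y) y,
          e.adExp_mem_regPart_univ hP hα hneg hy hreg _⟩ := by
  obtain ⟨d, hd⟩ := e.exists_polynomial_adExp hP hα hneg hφ
  refine ⟨d + 1, fun m hm y hy hreg => ?_⟩
  obtain ⟨p, hpd, hp⟩ := hd y hy hreg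
  rw [hp, Polynomial.eval_eq_sum_range' (lt_of_le_of_lt hpd (by omega : d < m))]
  refine Finset.sum_congr rfl fun i _ => ?_
  have h0 : (⟨y, trivial, hreg⟩ : e.regPart (Set.univ : Set L)) =
      ⟨adExp (e.vec α) 0 y, e.adExp_mem_regPart_univ hP hα hneg hy hreg 0⟩ := by
    refine Subtype.ext ?_
    change y = adExp (e.vec α) 0 y
    have hK : (ad ℂ L (e.vec α)) ^ (Module.finrank ℂ L + 1) = 0 := by
      rw [pow_succ, ad_pow_finrank (e.isNilpotent_ad_vec α), zero_mul]
    rw [adExp_eq_sum (e.isNilpotent_ad_vec α) 0 y hK, Finset.sum_range_succ']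
    simp
  have hit := e.poisson_iterate_adExp hκ hP hα hneg hκ_symm hκ_inv hy hreg i hφ
    (fun t => hp t _) 0
  rw [← h0] at hit
  have hk0 := e.form_vec_negRoot_ne_zero hκ_inv hκ α
  rw [seriesTerm, hit, ← Polynomial.coeff_zero_eq_eval_zero, Polynomial.coeff_iterate_derivative]
  have hc : (e.eHat Set.univ (negRoot α) : e.regPart (Set.univ : Set L) → ℂ) ⟨y, trivial, hreg⟩ =
      e.coef α y := by
    change e.coef (negRoot (negRoot α)) y = _
    rw [negRoot_negRoot]
  rw [hc]
  have hf : (i.factorial : ℂ) ≠ 0 := by exact_mod_cast i.factorial_ne_zero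
  have hr := hreg α
  rw [zero_add, Nat.descFactorial_self, nsmul_eq_mul]
  generalize κ (e.vec α) (e.vec (negRoot α)) = k at *
  have hk2 : (-1 : ℂ) ^ i * (-k⁻¹) ^ i * k ^ i = 1 := by
    rw [← mul_pow, ← mul_pow]
    field_simp
    simp
  rw [div_pow, mul_pow, inv_pow]
  field_simp
  field_simp at hk2
  linear_combination (e.coef α y ^ i * p.coeff i) * hk2

end Series

end RootVectors

end Poisson

/-! ### Affine spaces as affine varieties -/

section Varieties

variable {X Y : Type*}

lemma linear_mem_polyFun {E : Type*} [AddCommGroup E] [Module ℂ E] (ℓ : Module.Dual ℂ E) :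
    (ℓ : E → ℂ) ∈ polyFun E := Algebra.subset_adjoin ⟨ℓ, rfl⟩

lemma polyFun_eq_range {E : Type*} [AddCommGroup E] [Module ℂ E] {ι : Type*} [Fintype ι]
    (b : Module.Basis ι ℂ E) :
    polyFun E = (MvPolynomial.aeval (R := ℂ) fun i => (b.coord i : E → ℂ)).range := by
  rw [← Algebra.adjoin_range_eq_range_aeval]
  apply le_antisymm
  · refine Algebra.adjoin_le ?_
    rintro _ ⟨ℓ, rfl⟩
    have : (ℓ : E → ℂ) = ∑ i, ℓ (b i) • (b.coord i : E → ℂ) := by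
      funext x
      conv_lhs => rw [← b.sum_repr x]
      simp only [map_sum, map_smul, smul_eq_mul, Finset.sum_apply, Pi.smul_apply,
        Module.Basis.coord_apply]
      exact Finset.sum_congr rfl fun i _ => mul_comm _ _
    change (ℓ : E → ℂ) ∈ _
    rw [this]
    exact Subalgebra.sum_mem _ fun i _ => Subalgebra.smul_mem _
      (Algebra.subset_adjoin (Set.mem_range_self i)) _
  · refine Algebra.adjoin_le ?_
    rintro _ ⟨i, rfl⟩
    exact linear_mem_polyFun _

theorem isIrreducibleAffineVariety_polyFun (E : Type*) [AddCommGroup E] [Module ℂ E]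
    [FiniteDimensional ℂ E] : IsIrreducibleAffineVariety (polyFun E) where
  fg := by
    rw [polyFun_eq_range (Module.finBasis ℂ E), ← Algebra.adjoin_range_eq_range_aeval]
    exact Subalgebra.fg_def.mpr ⟨_, Set.finite_range _, rfl⟩
  isDomain := by
    have hinj : Function.Injective
        (MvPolynomial.aeval (R := ℂ) fun i => ((Module.finBasis ℂ E).coord i : E → ℂ)) := by
      intro p q hpq
      refine MvPolynomial.funext fun x => ?_
      have h := congrFun hpq ((Module.finBasis ℂ E).equivFun.symm x)
      have key : ∀ p : MvPolynomial (Fin (Module.finrank ℂ E)) ℂ,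
          (MvPolynomial.aeval (R := ℂ) fun i => ((Module.finBasis ℂ E).coord i : E → ℂ)) p
            ((Module.finBasis ℂ E).equivFun.symm x) = MvPolynomial.eval x p := by
        intro p
        induction p using MvPolynomial.induction_on with
        | C a => simp
        | add p q hp hq => rw [map_add, Pi.add_apply, hp, hq, map_add]
        | mul_X p i hp =>
          rw [map_mul, Pi.mul_apply, hp, map_mul, MvPolynomial.aeval_X, MvPolynomial.eval_X,
            Module.Basis.coord_apply, ← Module.Basis.equivFun_apply,
            LinearEquiv.apply_symm_apply]
      rwa [key, key] at h
    rw [polyFun_eq_range (Module.finBasis ℂ E)]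
    exact (AlgEquiv.ofInjective _ hinj).toMulEquiv.symm.isDomain _
  existsUnique_point χ := by
    let ev : Module.Dual ℂ (Module.Dual ℂ E) :=
      { toFun := fun ℓ => χ ⟨ℓ, linear_mem_polyFun ℓ⟩
        map_add' := fun ℓ m => by rw [← map_add]; rfl
        map_smul' := fun c ℓ => by rw [← map_smul]; rfl }
    let x := (Module.evalEquiv ℂ E).symm ev
    have hx : ∀ ℓ : Module.Dual ℂ E, χ ⟨ℓ, linear_mem_polyFun ℓ⟩ = ℓ x := by
      intro ℓ
      have : (Module.evalEquiv ℂ E) x ℓ = ev ℓ := by rw [LinearEquiv.apply_symm_apply]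
      exact this.symm
    refine ⟨x, ?_, ?_⟩
    · rintro ⟨f, hf⟩
      induction hf using Algebra.adjoin_induction with
      | mem f hf =>
        obtain ⟨ℓ, rfl⟩ := hf
        exact hx ℓ
      | algebraMap r => exact χ.commutes r
      | add f g hf' hg' hf hg =>
        exact (map_add χ ⟨f, hf'⟩ ⟨g, hg'⟩).trans (congrArg₂ (· + ·) hf hg)
      | mul f g hf' hg' hf hg =>
        exact (map_mul χ ⟨f, hf'⟩ ⟨g, hg'⟩).trans (congrArg₂ (· * ·) hf hg)
    · intro z hz
      have hxz : ∀ ℓ : Module.Dual ℂ E, ℓ z = ℓ x := fun ℓ =>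
        (hz ⟨ℓ, linear_mem_polyFun ℓ⟩).symm.trans (hx ℓ)
      rw [← sub_eq_zero, ← Module.forall_dual_apply_eq_zero_iff ℂ]
      intro ℓ
      rw [map_sub, hxz, sub_self]

/-- The pull-back of functions along a map. -/
def pullback (ψ : X → Y) : (Y → ℂ) →ₐ[ℂ] (X → ℂ) :=
  AlgHom.pi fun x => Pi.evalAlgHom ℂ _ (ψ x)

/-- Affine varieties can be transported along bijections of the underlying sets. -/
lemma IsIrreducibleAffineVariety.map_pullback {C : Subalgebra ℂ (Y → ℂ)}
    (hC : IsIrreducibleAffineVariety C) {ψ : X → Y} (hψ : Function.Bijective ψ) :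
    IsIrreducibleAffineVariety (C.map (pullback ψ)) := by
  have hinj : Function.Injective (pullback ψ) := fun f g h => by
    funext y
    obtain ⟨x, rfl⟩ := hψ.2 y
    exact congrFun h x
  let E := C.equivMapOfInjective (pullback ψ) hinj
  have hE : ∀ f : C, (E f : X → ℂ) = (f : Y → ℂ) ∘ ψ := fun f => rfl
  have := hC.isDomain
  refine ⟨hC.fg.map _, E.toMulEquiv.symm.isDomain _, fun χ => ?_⟩
  obtain ⟨y, hy, huniq⟩ := hC.existsUnique_point (χ.comp E.toAlgHom)
  obtain ⟨x, rfl⟩ := hψ.2 y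
  refine ⟨x, fun f => ?_, fun z hz => hψ.1 (huniq _ fun f => ?_)⟩
  · obtain ⟨f, rfl⟩ := E.surjective f
    exact hy f
  · exact hz (E f)

end Varieties

section Localization

variable {L : Type*} [LieRing L] [LieAlgebra ℂ L] [FiniteDimensional ℂ L] [IsKilling ℂ L]
  {H : LieSubalgebra ℂ L} [H.IsCartanSubalgebra]

namespace RootVectors

variable (e : RootVectors H)

/-- The product of the functions `y ↦ α h` over all roots. -/
def rootProd (y : L) : ℂ := ∏ α : H.root, e.rootVal α y

lemma rootProd_ne_zero_iff {y : L} : e.rootProd y ≠ 0 ↔ ∀ α : H.root, e.rootVal α y ≠ 0 := by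
  simp [rootProd, Finset.prod_ne_zero_iff]

variable {E : Type*} [AddCommGroup E] [Module ℂ E] (j : E →ₗ[ℂ] L)

lemma linear_comp_mem_polyFun (ℓ : Module.Dual ℂ L) : (fun x => ℓ (j x)) ∈ polyFun E :=
  linear_mem_polyFun (ℓ.comp j)

lemma rootProd_mem_polyFun : (fun x => e.rootProd (j x)) ∈ polyFun E := by
  have : (fun x => e.rootProd (j x)) = ∏ α : H.root, fun x => e.rootLin α (j x) := by
    funext x
    rw [Finset.prod_apply]
    rfl
  rw [this]
  exact Subalgebra.prod_mem _ fun α _ => linear_comp_mem_polyFun j _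

/-- Elements of `ℂ[U]'` become polynomial after multiplication by a power of the product of the
roots. -/
lemma exists_mul_rootProd_pow {U : Set L} {f : e.regPart U → ℂ} (hf : f ∈ e.regFun U) :
    ∃ m : ℕ, ∃ g ∈ polyFun E, ∀ x, ∀ hx : j x ∈ e.regPart U,
      f ⟨j x, hx⟩ * e.rootProd (j x) ^ m = g x := by
  classical
  induction hf using Algebra.adjoin_induction with
  | mem f hf =>
    rcases hf with ⟨ℓ, rfl⟩ | ⟨α, rfl⟩
    · exact ⟨0, _, linear_comp_mem_polyFun j ℓ, fun x hx => by simp⟩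
    · refine ⟨1, ∏ β ∈ Finset.univ.erase α, fun x => e.rootLin β (j x),
        Subalgebra.prod_mem _ fun β _ => linear_comp_mem_polyFun j _, fun x hx => ?_⟩
      rw [pow_one, rootProd, ← Finset.mul_prod_erase _ _ (Finset.mem_univ α), ← mul_assoc,
        inv_mul_cancel₀ (hx.2 α), one_mul, Finset.prod_apply]
      rfl
  | algebraMap r => exact ⟨0, _, (polyFun E).algebraMap_mem r, fun x hx => by simp⟩
  | add f g _ _ hf hg =>
    obtain ⟨m, f', hf', h1⟩ := hf
    obtain ⟨k, g', hg', h2⟩ := hg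
    have hq := e.rootProd_mem_polyFun j
    refine ⟨m + k, f' * (fun x => e.rootProd (j x)) ^ k + g' * (fun x => e.rootProd (j x)) ^ m,
      Subalgebra.add_mem _ (Subalgebra.mul_mem _ hf' (Subalgebra.pow_mem _ hq _))
        (Subalgebra.mul_mem _ hg' (Subalgebra.pow_mem _ hq _)), fun x hx => ?_⟩
    simp only [Pi.add_apply, Pi.mul_apply, Pi.pow_apply, ← h1 x hx, ← h2 x hx]
    ring
  | mul f g _ _ hf hg =>
    obtain ⟨m, f', hf', h1⟩ := hf
    obtain ⟨k, g', hg', h2⟩ := hg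
    refine ⟨m + k, f' * g', Subalgebra.mul_mem _ hf' hg', fun x hx => ?_⟩
    simp only [Pi.mul_apply, ← h1 x hx, ← h2 x hx]
    ring

end RootVectors

end Localization

/-! ### Elements of positive weight in an associative algebra -/

section PositiveWeight

variable {A : Type*} [Ring A] [Algebra ℂ A]

/-- The span of the elements of `A` on which the commutator with `d` acts by an integer `k ≥ m`. -/
def weightGE (d : A) (m : ℕ) : Submodule ℂ A :=
  Submodule.span ℂ {a | ∃ k : ℕ, m ≤ k ∧ d * a - a * d = (k : ℂ) • a}

lemma one_mem_weightGE (d : A) : (1 : A) ∈ weightGE d 0 :=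
  Submodule.subset_span ⟨0, le_rfl, by simp⟩

lemma mul_mem_weightGE {d : A} {m k : ℕ} {a b : A} (ha : a ∈ weightGE d m)
    (hb : b ∈ weightGE d k) : a * b ∈ weightGE d (m + k) := by
  have h : a * b ∈ weightGE d m * weightGE d k := Submodule.mul_mem_mul ha hb
  rw [weightGE, weightGE, Submodule.span_mul_span] at h
  refine Submodule.span_mono ?_ h
  rintro _ ⟨x, ⟨i, hi, hx⟩, y, ⟨j, hj, hy⟩, rfl⟩
  refine ⟨i + j, add_le_add hi hj, ?_⟩
  have : d * (x * y) - x * y * d = (d * x - x * d) * y + x * (d * y - y * d) := by noncomm_ring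
  change d * (x * y) - x * y * d = _ • (x * y)
  rw [this, hx, hy, smul_mul_assoc, mul_smul_comm, ← add_smul]
  push_cast
  rfl

lemma weightGE_anti (d : A) {m k : ℕ} (h : m ≤ k) : weightGE d k ≤ weightGE d m :=
  Submodule.span_mono fun _ ⟨i, hi, ha⟩ => ⟨i, h.trans hi, ha⟩

lemma pow_mem_weightGE {d a : A} (ha : a ∈ weightGE d 1) (m : ℕ) : a ^ m ∈ weightGE d m := by
  induction m with
  | zero => simpa using one_mem_weightGE d
  | succ m ih => rw [pow_succ]; exact mul_mem_weightGE ih ha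

variable [FiniteDimensional ℂ A]

lemma exists_weightGE_eq_bot (d : A) : ∃ m, weightGE d m = ⊥ := by
  have hfin : Set.Finite {k : ℕ | Module.End.HasEigenvalue
      (LinearMap.mulLeft ℂ d - LinearMap.mulRight ℂ d) (k : ℂ)} :=
    Set.Finite.preimage (f := ((↑) : ℕ → ℂ)) Nat.cast_injective.injOn
      (Module.End.finite_hasEigenvalue (LinearMap.mulLeft ℂ d - LinearMap.mulRight ℂ d))
  obtain ⟨M, hM⟩ := hfin.bddAbove
  refine ⟨M + 1, ?_⟩
  rw [weightGE, Submodule.span_eq_bot]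
  rintro a ⟨k, hk, ha⟩
  by_contra h0
  have := hM (Module.End.hasEigenvalue_of_hasEigenvector
    (f := LinearMap.mulLeft ℂ d - LinearMap.mulRight ℂ d) (μ := (k : ℂ)) (x := a)
    ⟨Module.End.mem_eigenspace_iff.mpr (by simpa using ha), h0⟩)
  omega

lemma isNilpotent_of_mem_weightGE {d a : A} (ha : a ∈ weightGE d 1) : IsNilpotent a := by
  obtain ⟨m, hm⟩ := exists_weightGE_eq_bot d
  refine ⟨m, ?_⟩
  have := pow_mem_weightGE ha m
  rwa [hm, Submodule.mem_bot] at this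

omit [FiniteDimensional ℂ A] in
/-- An element of positive weight that commutes with `d` vanishes. -/
lemma eq_zero_of_mem_weightGE_of_commute {d a : A} (ha : a ∈ weightGE d 1)
    (h : d * a = a * d) : a = 0 := by
  have hind := Module.End.eigenspaces_iSupIndep (LinearMap.mulLeft ℂ d - LinearMap.mulRight ℂ d)
  refine Submodule.disjoint_def.mp (hind 0) a ?_ ?_
  · rw [Module.End.mem_eigenspace_iff]
    simp [h]
  · refine (Submodule.span_le.mpr ?_ : weightGE d 1 ≤ _) ha
    rintro b ⟨k, hk, hb⟩
    refine Submodule.mem_iSup_of_mem (k : ℂ) (Submodule.mem_iSup_of_mem ?_ ?_)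
    · exact_mod_cast (by omega : k ≠ 0)
    · rw [Module.End.mem_eigenspace_iff]
      simpa using hb

end PositiveWeight

/-! ### Exponentials of nilpotent matrices and the adjoint action -/

section MatrixExp

variable {n : ℕ}

lemma exp_eq_isNilpotent_exp {x : Matrix (Fin n) (Fin n) ℂ} (hx : IsNilpotent x) :
    NormedSpace.exp x = IsNilpotent.exp x := by
  obtain ⟨k, hk⟩ := hx
  rw [IsNilpotent.exp_eq_sum hk, NormedSpace.exp_eq_tsum_rat]
  refine tsum_eq_sum fun i hi => ?_
  rw [pow_eq_zero_of_le (by simpa using hi) hk, smul_zero]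

lemma exp_eq_sum_of_pow_eq_zero {x : Matrix (Fin n) (Fin n) ℂ} {k : ℕ} (hk : x ^ k = 0) :
    NormedSpace.exp x = ∑ i ∈ Finset.range k, (i.factorial : ℂ)⁻¹ • x ^ i := by
  rw [exp_eq_isNilpotent_exp ⟨k, hk⟩, IsNilpotent.exp_eq_sum hk]
  refine Finset.sum_congr rfl fun i _ => ?_
  rw [← Rat.cast_smul_eq_qsmul ℂ]
  push_cast
  rfl

lemma exp_mul_exp_neg (x : Matrix (Fin n) (Fin n) ℂ) :
    NormedSpace.exp x * NormedSpace.exp (-x) = 1 := by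
  rw [← Matrix.exp_add_of_commute _ _ (Commute.neg_right (Commute.refl x)), add_neg_cancel,
    NormedSpace.exp_zero]

/-- Conjugation by `exp x` is `exp (ad x)`. -/
lemma exp_mul_mul_exp_neg {x : Matrix (Fin n) (Fin n) ℂ} (hx : IsNilpotent x)
    (y : Matrix (Fin n) (Fin n) ℂ) {K : ℕ}
    (hK : (ad ℂ (Matrix (Fin n) (Fin n) ℂ) x) ^ K = 0) :
    NormedSpace.exp x * y * NormedSpace.exp (-x) = ∑ k ∈ Finset.range K,
      (k.factorial : ℂ)⁻¹ • ((ad ℂ (Matrix (Fin n) (Fin n) ℂ) x) ^ k) y := by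
  have had : ad ℂ (Matrix (Fin n) (Fin n) ℂ) x =
      LinearMap.mulLeft ℂ x + LinearMap.mulRight ℂ (-x) := by
    ext1 z
    simp [Ring.lie_def, sub_eq_add_neg]
  have hl : IsNilpotent (LinearMap.mulLeft ℂ x) := (LinearMap.isNilpotent_mulLeft_iff ℂ x).mpr hx
  have hr : IsNilpotent (LinearMap.mulRight ℂ (-x)) :=
    (LinearMap.isNilpotent_mulRight_iff ℂ (-x)).mpr hx.neg
  have h1 : IsNilpotent.exp (LinearMap.mulLeft ℂ x) =
      LinearMap.mulLeft ℂ (IsNilpotent.exp x) := by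
    exact (IsNilpotent.map_exp hx (Algebra.lmul ℂ (Matrix (Fin n) (Fin n) ℂ))).symm
  have h2 : IsNilpotent.exp (LinearMap.mulRight ℂ (-x)) =
      LinearMap.mulRight ℂ (IsNilpotent.exp (-x)) := by
    obtain ⟨k, hk⟩ := hx.neg
    have hk' : (LinearMap.mulRight ℂ (-x)) ^ k = 0 := by
      rw [LinearMap.pow_mulRight, hk, LinearMap.mulRight_zero_eq_zero]
    rw [IsNilpotent.exp_eq_sum hk, IsNilpotent.exp_eq_sum hk']
    ext1 z
    simp [LinearMap.pow_mulRight, Finset.mul_sum]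
  have h3 : IsNilpotent.exp (ad ℂ (Matrix (Fin n) (Fin n) ℂ) x) y =
      NormedSpace.exp x * y * NormedSpace.exp (-x) := by
    rw [had, IsNilpotent.exp_add_of_commute (LinearMap.commute_mulLeft_right x (-x)) hl hr, h1,
      h2, exp_eq_isNilpotent_exp hx, exp_eq_isNilpotent_exp hx.neg, Module.End.mul_apply,
      LinearMap.mulLeft_apply, LinearMap.mulRight_apply, mul_assoc]
  rw [← h3, IsNilpotent.exp_eq_sum hK, LinearMap.sum_apply]
  refine Finset.sum_congr rfl fun i _ => ?_
  rw [LinearMap.smul_apply, ← Rat.cast_smul_eq_qsmul ℂ]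
  push_cast
  rfl

end MatrixExp

namespace LinearAlgebraicGroup

section Adjoint

variable {n : ℕ} (G : LinearAlgebraicGroup n)

/-- The matrix of an element of the group. -/
def toMat (u : G.grp) : Matrix (Fin n) (Fin n) ℂ :=
  ((u : GL (Fin n) ℂ) : Matrix (Fin n) (Fin n) ℂ)

lemma toMat_injective : Function.Injective G.toMat :=
  Units.val_injective.comp Subtype.val_injective

@[simp] lemma toMat_one : G.toMat 1 = 1 := rfl

lemma toMat_mul (u v : G.grp) : G.toMat (u * v) = G.toMat u * G.toMat v := rfl

lemma toMat_inv_mul (u : G.grp) : G.toMat u⁻¹ * G.toMat u = 1 := by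
  rw [← toMat_mul, inv_mul_cancel, toMat_one]

lemma toMat_expMap (x : G.lie) :
    G.toMat (G.expMap x) = NormedSpace.exp (x : Matrix (Fin n) (Fin n) ℂ) :=
  (G.exists_exp x).choose_spec

lemma expMap_neg (x : G.lie) : G.expMap (-x) = (G.expMap x)⁻¹ := by
  rw [eq_inv_iff_mul_eq_one]
  apply G.toMat_injective
  rw [toMat_mul, toMat_expMap, toMat_expMap]
  have := exp_mul_exp_neg (-(x : Matrix (Fin n) (Fin n) ℂ))
  rwa [neg_neg] at this

lemma coe_Ad (u : G.grp) (x : G.lie) :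
    (G.Ad u x : Matrix (Fin n) (Fin n) ℂ) =
      G.toMat u * (x : Matrix (Fin n) (Fin n) ℂ) * G.toMat u⁻¹ := rfl

@[simp] lemma Ad_one (x : G.lie) : G.Ad 1 x = x := by
  apply Subtype.ext
  rw [coe_Ad]
  simp

lemma Ad_mul (u v : G.grp) (x : G.lie) : G.Ad (u * v) x = G.Ad u (G.Ad v x) := by
  apply Subtype.ext
  rw [coe_Ad, coe_Ad, coe_Ad, mul_inv_rev, toMat_mul, toMat_mul]
  noncomm_ring

@[simp] lemma Ad_inv_Ad (u : G.grp) (x : G.lie) : G.Ad u⁻¹ (G.Ad u x) = x := by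
  rw [← Ad_mul, inv_mul_cancel, Ad_one]

lemma coe_sum_lie {ι : Type*} (s : Finset ι) (f : ι → G.lie) :
    ((∑ i ∈ s, f i : G.lie) : Matrix (Fin n) (Fin n) ℂ) =
      ∑ i ∈ s, (f i : Matrix (Fin n) (Fin n) ℂ) :=
  map_sum G.lie.toSubmodule.subtype f s

lemma isNilpotent_ad_of_isNilpotent {x : G.lie}
    (hx : IsNilpotent (x : Matrix (Fin n) (Fin n) ℂ)) : IsNilpotent (ad ℂ G.lie x) :=
  G.lie.isNilpotent_ad_of_isNilpotent_ad (LieAlgebra.ad_nilpotent_of_nilpotent (R := ℂ) hx)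

/-- `Ad (exp (t x)) = exp (t ad x)` for nilpotent `x`. -/
lemma Ad_expMap_smul {x : G.lie} (hx : IsNilpotent (x : Matrix (Fin n) (Fin n) ℂ)) (t : ℂ)
    (y : G.lie) : G.Ad (G.expMap (t • x)) y = adExp x t y := by
  obtain ⟨K, hK⟩ := LieAlgebra.ad_nilpotent_of_nilpotent (R := ℂ) hx
  have hadt : ad ℂ (Matrix (Fin n) (Fin n) ℂ) (t • (x : Matrix (Fin n) (Fin n) ℂ)) =
      t • ad ℂ (Matrix (Fin n) (Fin n) ℂ) (x : Matrix (Fin n) (Fin n) ℂ) := map_smul _ _ _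
  have hKt : (ad ℂ (Matrix (Fin n) (Fin n) ℂ) (t • (x : Matrix (Fin n) (Fin n) ℂ))) ^ K = 0 := by
    rw [hadt, smul_pow, hK, smul_zero]
  have hKG : (ad ℂ G.lie x) ^ K = 0 := by
    ext1 z
    apply Subtype.ext
    rw [LieSubalgebra.coe_ad_pow, hK]
    rfl
  apply Subtype.ext
  rw [coe_Ad, ← expMap_neg, toMat_expMap, toMat_expMap,
    adExp_eq_sum (G.isNilpotent_ad_of_isNilpotent hx) t y hKG, coe_sum_lie]
  change NormedSpace.exp (t • (x : Matrix (Fin n) (Fin n) ℂ)) * _ *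
    NormedSpace.exp (-(t • (x : Matrix (Fin n) (Fin n) ℂ))) = _
  rw [exp_mul_mul_exp_neg (hx.smul t) _ hKt]
  refine Finset.sum_congr rfl fun k _ => ?_
  change _ = (t ^ k / (k.factorial : ℂ)) • (((ad ℂ G.lie x ^ k) y : G.lie) : Matrix (Fin n) (Fin n) ℂ)
  rw [LieSubalgebra.coe_ad_pow, hadt, smul_pow, LinearMap.smul_apply, smul_smul]
  congr 1
  ring

lemma expMap_mem_subgroupOf {m : LieSubalgebra ℂ G.lie} {x : G.lie} (hx : x ∈ m) :
    G.expMap x ∈ G.subgroupOf m := Subgroup.subset_closure ⟨x, hx, rfl⟩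

/-- Induction over the elements of `subgroupOf m`, in which only the exponentials and their products
have to be considered. -/
lemma subgroupOf_induction {m : LieSubalgebra ℂ G.lie} {p : G.grp → Prop} (one : p 1)
    (exp : ∀ x ∈ m, p (G.expMap x)) (mul : ∀ u v, p u → p v → p (u * v)) {u : G.grp}
    (hu : u ∈ G.subgroupOf m) : p u := by
  induction hu using Subgroup.closure_induction'' with
  | one => exact one
  | mem u hu => obtain ⟨x, hx, rfl⟩ := hu; exact exp x hx
  | inv_mem u hu =>
    obtain ⟨x, hx, rfl⟩ := hu
    rw [← expMap_neg]
    exact exp _ (m.neg_mem hx)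
  | mul u v _ _ hu hv => exact mul u v hu hv

end Adjoint

end LinearAlgebraicGroup

/-! ### The straightening of elements of the Borel subalgebra -/

section Height

variable {L : Type*} [LieRing L] [LieAlgebra ℂ L] [FiniteDimensional ℂ L] [IsKilling ℂ L]
  {H : LieSubalgebra ℂ L} [H.IsCartanSubalgebra] (B : (rootSystem H).Base)

lemma exists_apply_eq_height :
    ∃ h : H, ∀ α : H.root, (α : LieModule.Weight ℂ H L) h = (B.height α : ℂ) := by
  let f : Module.Dual ℂ (Module.Dual ℂ H) := B.toWeightBasis.constr ℂ fun _ => (1 : ℂ)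
  have hf : ∀ j ∈ B.support, f ((rootSystem H).root j) = 1 := fun j hj => by
    have := B.toWeightBasis.constr_basis ℂ (fun _ => (1 : ℂ)) ⟨j, hj⟩
    rwa [RootPairing.Base.toWeightBasis_apply] at this
  refine ⟨(Module.evalEquiv ℂ H).symm f, fun α => ?_⟩
  have h1 : (α : LieModule.Weight ℂ H L) ((Module.evalEquiv ℂ H).symm f) =
      f ((rootSystem H).root α) := by
    have : (Module.evalEquiv ℂ H) ((Module.evalEquiv ℂ H).symm f) ((rootSystem H).root α) =
      f ((rootSystem H).root α) := by rw [LinearEquiv.apply_symm_apply]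
    exact this
  obtain ⟨c, -, -, hc⟩ := B.exists_root_eq_sum_int α
  rw [h1, RootPairing.Base.height_eq_sum hc, hc, map_sum, Int.cast_sum]
  exact Finset.sum_congr rfl fun j hj => by rw [map_zsmul, hf j hj]; simp

/-- The element of the Cartan subalgebra on which each root takes its height as value. -/
def heightElt : H := (exists_apply_eq_height B).choose

lemma apply_heightElt (α : H.root) :
    (α : LieModule.Weight ℂ H L) (heightElt B) = (B.height α : ℂ) :=
  (exists_apply_eq_height B).choose_spec α

lemma apply_heightElt_ne_zero (α : H.root) :
    (α : LieModule.Weight ℂ H L) (heightElt B) ≠ 0 := by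
  rw [apply_heightElt]
  exact_mod_cast B.height_ne_zero α

lemma negRoot_notMem_pos {α : H.root} (h : α ∈ {α : H.root | B.IsPos α}) :
    negRoot α ∉ {α : H.root | B.IsPos α} := fun h' => (isPos_negRoot B).mp h' h

namespace RootVectors

variable (e : RootVectors H)

lemma borel_toSubmodule (w : (rootSystem H).weylGroup) :
    (e.borel B w).toSubmodule = e.hSum (posSystem B w) :=
  e.lieSpan_cartan_vec (isClosedSet_posSystem w) fun _ => negRoot_notMem_posSystem w

lemma mem_borel {w : (rootSystem H).weylGroup} {y : L} :
    y ∈ e.borel B w ↔ y ∈ e.hSum (posSystem B w) := by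
  rw [← borel_toSubmodule]
  rfl

lemma mem_borel_one {y : L} : y ∈ e.borel B 1 ↔ y ∈ e.hSum {α | B.IsPos α} := by
  rw [mem_borel, posSystem_one]

lemma mem_nLower {w : (rootSystem H).weylGroup} {y : L} :
    y ∈ e.nLower B w ↔ y ∈ e.nSum (inversions B w) := by
  rw [← e.lieSpan_vec (isClosedSet_inversions w) fun _ => negRoot_notMem_inversions]
  rfl

lemma hPlusNOne_eq (w : (rootSystem H).weylGroup) :
    e.hPlusNOne B w = e.hSum ({α | B.IsPos α} \ inversions B w) := by
  rw [hPlusNOne, nOne, weylAct_image_diff_inversions, e.lieSpan_vec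
    (isClosedSet_pos_diff_inversions w) fun α hα h => negRoot_notMem_pos B hα.1 h.1, hSum_eq_sup]

end RootVectors

end Height

section PosOutside

variable {L : Type*} [LieRing L] [LieAlgebra ℂ L] [FiniteDimensional ℂ L] [IsKilling ℂ L]
  {H : LieSubalgebra ℂ L} [H.IsCartanSubalgebra] {B : (rootSystem H).Base} {α : H.root}

/-- The positive roots outside a list. -/
def posOutside (B : (rootSystem H).Base) (l : List H.root) : Set H.root :=
  {α | B.IsPos α ∧ α ∉ l}

lemma posOutside_nil : posOutside B [] = {α | B.IsPos α} := by simp [posOutside]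

lemma posOutside_cons (l : List H.root) : posOutside B (α :: l) = posOutside B l \ {α} := by
  ext β
  simp only [posOutside, List.mem_cons, not_or, Set.mem_ofPred_eq, Set.mem_sdiff,
    Set.mem_singleton_iff]
  tauto

lemma posOutside_subset (l : List H.root) : posOutside B l ⊆ {α | B.IsPos α} := fun _ h => h.1

section Cons

variable {l : List H.root} (hl : IsStraighteningList B (α :: l))

include hl

lemma IsStraighteningList.isPos_head : B.IsPos α := hl.2.1 α (by simp)

lemma IsStraighteningList.head_mem : α ∈ posOutside B l :=
  ⟨hl.isPos_head, (List.nodup_cons.mp hl.1).1⟩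

lemma IsStraighteningList.isClosedSet_tail : IsClosedSet (posOutside B l) :=
  hl.2.2 l (List.suffix_cons α l)

lemma IsStraighteningList.negRoot_head_notMem :
    negRoot α ∉ posOutside B l := fun h => (isPos_negRoot B).mp h.1 hl.isPos_head

end Cons

lemma posOutside_eq {l : List H.root} {w : (rootSystem H).weylGroup}
    (hmem : ∀ α, α ∈ l ↔ α ∈ inversions B w) :
    posOutside B l = {α | B.IsPos α} \ inversions B w := by
  ext α
  rw [Set.mem_sdiff, ← hmem]
  rfl

end PosOutside

namespace LinearAlgebraicGroup

variable {n : ℕ} (G : LinearAlgebraicGroup n) [IsKilling ℂ G.lie] {H : LieSubalgebra ℂ G.lie}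
  [H.IsCartanSubalgebra] {B : (rootSystem H).Base} (e : RootVectors H)

section Nilpotency

/-- The elements of `𝔫` are matrices of positive weight with respect to the height element. -/
lemma coe_mem_weightGE {x : G.lie} (hx : x ∈ e.nSum {α | B.IsPos α}) :
    (x : Matrix (Fin n) (Fin n) ℂ) ∈
      weightGE (((heightElt B : H) : G.lie) : Matrix (Fin n) (Fin n) ℂ) 1 := by
  rw [RootVectors.nSum_eq_span] at hx
  induction hx using Submodule.span_induction with
  | zero => exact Submodule.zero_mem _
  | add u v _ _ hu hv => exact Submodule.add_mem _ hu hv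
  | smul c u _ hu => exact Submodule.smul_mem _ c hu
  | mem u hu =>
    obtain ⟨α, hα, rfl⟩ := hu
    have hα' : 0 < B.height α := hα
    refine Submodule.subset_span ⟨(B.height α).toNat, by omega, ?_⟩
    have h := congrArg (Subtype.val : G.lie → Matrix (Fin n) (Fin n) ℂ)
      (e.lie_coe_vec (heightElt B) α)
    rw [apply_heightElt] at h
    have h2 : ((B.height α).toNat : ℂ) = (B.height α : ℂ) := by
      exact_mod_cast Int.toNat_of_nonneg hα'.le
    rw [h2]
    exact h

lemma isNilpotent_coe {x : G.lie} (hx : x ∈ e.nSum {α | B.IsPos α}) :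
    IsNilpotent (x : Matrix (Fin n) (Fin n) ℂ) :=
  isNilpotent_of_mem_weightGE (G.coe_mem_weightGE e hx)

lemma isNilpotent_vec {α : H.root} (hα : B.IsPos α) :
    IsNilpotent (e.vec α : Matrix (Fin n) (Fin n) ℂ) :=
  G.isNilpotent_coe e (e.vec_mem_nSum (P := {α | B.IsPos α}) hα)

variable {w : (rootSystem H).weylGroup}

lemma nLower_le {x : G.lie} (hx : x ∈ e.nLower B w) : x ∈ e.nSum {α | B.IsPos α} :=
  e.nSum_mono (fun _ h => h.1) ((e.mem_nLower B).mp hx)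

lemma Ad_sub_mem {P : Set H.root} (hP : IsClosedSet P) (hneg : ∀ α ∈ P, negRoot α ∉ P)
    (hw : inversions B w ⊆ P) {u : G.grp} (hu : u ∈ G.subgroupOf (e.nLower B w)) {y : G.lie}
    (hy : y ∈ e.hSum P) : G.Ad u y - y ∈ e.nSum P := by
  refine G.subgroupOf_induction (p := fun u => ∀ y ∈ e.hSum P, G.Ad u y - y ∈ e.nSum P)
    (fun y _ => by simp) (fun x hx y hy => ?_) (fun u v hu hv y hy => ?_) hu y hy
  · have hnil := G.isNilpotent_coe e (G.nLower_le e hx)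
    have hlie : ∀ z ∈ e.hSum P, ⁅x, z⁆ ∈ e.nSum P := fun z hz =>
      e.lie_mem_nSum hP hw (fun α hα => hneg α (hw hα)) ((e.mem_nLower B).mp hx) hz
    rw [← one_smul ℂ x, G.Ad_expMap_smul hnil]
    exact adExp_sub_mem (hlie y hy) (fun z hz => hlie z (e.nSum_le_hSum hz))
      (G.isNilpotent_ad_of_isNilpotent hnil) 1
  · have h1 := hv y hy
    have h2 : G.Ad v y ∈ e.hSum P := by
      simpa using Submodule.add_mem _ (e.nSum_le_hSum h1) hy
    have h3 := Submodule.add_mem _ (hu _ h2) h1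
    rw [Ad_mul]
    simpa using h3

lemma toMat_sub_one_mem {u : G.grp} (hu : u ∈ G.subgroupOf (e.nLower B w)) :
    G.toMat u - 1 ∈ weightGE (((heightElt B : H) : G.lie) : Matrix (Fin n) (Fin n) ℂ) 1 := by
  refine G.subgroupOf_induction (p := fun u => G.toMat u - 1 ∈
    weightGE (((heightElt B : H) : G.lie) : Matrix (Fin n) (Fin n) ℂ) 1)
    (by simp) (fun x hx => ?_) (fun u v hu hv => ?_) hu
  · have hW := G.coe_mem_weightGE e (G.nLower_le e hx)
    obtain ⟨K, hK⟩ := isNilpotent_of_mem_weightGE hW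
    have hK1 : (x : Matrix (Fin n) (Fin n) ℂ) ^ (K + 1) = 0 := by rw [pow_succ, hK, zero_mul]
    rw [toMat_expMap, exp_eq_sum_of_pow_eq_zero hK1, Finset.sum_range_succ']
    simp only [Nat.factorial_zero, Nat.cast_one, inv_one, pow_zero, one_smul, add_sub_cancel_right]
    exact Submodule.sum_mem _ fun k _ => Submodule.smul_mem _ _
      (weightGE_anti _ (by omega) (pow_mem_weightGE hW (k + 1)))
  · have h : G.toMat (u * v) - 1 =
        (G.toMat u - 1) * (G.toMat v - 1) + (G.toMat u - 1) + (G.toMat v - 1) := by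
      rw [toMat_mul]
      noncomm_ring
    rw [h]
    exact Submodule.add_mem _ (Submodule.add_mem _
      (weightGE_anti _ (Nat.le_add_left 1 1) (mul_mem_weightGE hu hv)) hu) hv

/-- The stabilizer in `N_w` of the height element is trivial. -/
lemma eq_one_of_Ad_heightElt {u : G.grp} (hu : u ∈ G.subgroupOf (e.nLower B w))
    (h : G.Ad u ((heightElt B : H) : G.lie) = ((heightElt B : H) : G.lie)) : u = 1 := by
  have h1 := congrArg (Subtype.val : G.lie → Matrix (Fin n) (Fin n) ℂ) h
  rw [coe_Ad] at h1
  have h2 : (((heightElt B : H) : G.lie) : Matrix (Fin n) (Fin n) ℂ) * G.toMat u =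
      G.toMat u * (((heightElt B : H) : G.lie) : Matrix (Fin n) (Fin n) ℂ) := by
    conv_lhs => rw [← h1]
    rw [mul_assoc, toMat_inv_mul, mul_one]
  have h3 := eq_zero_of_mem_weightGE_of_commute (G.toMat_sub_one_mem e hu) (by
    rw [mul_sub, sub_mul, h2, mul_one, one_mul])
  exact G.toMat_injective (sub_eq_zero.mp h3)

end Nilpotency

section Straighten

variable {P : Set H.root} {α : H.root}

lemma straighten_eq_adExp (hα : B.IsPos α) (y : G.lie) :
    G.straighten e α y = adExp (e.vec α) (e.coef α y / e.rootVal α y) y :=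
  G.Ad_expMap_smul (G.isNilpotent_vec e hα) _ _

/-- The straightening along `α` makes the component in `𝔤_α` vanish. -/
lemma straighten_mem (hα : B.IsPos α) (hP : IsClosedSet P) (hαP : α ∈ P) (hneg : negRoot α ∉ P)
    {y : G.lie} (hy : y ∈ e.hSum P) (hreg : e.rootVal α y ≠ 0) :
    G.straighten e α y ∈ e.hSum (P \ {α}) := by
  rw [G.straighten_eq_adExp e hα]
  intro β hβ
  by_cases h : β = α
  · subst h
    rw [e.coef_adExp_vec hP hαP hneg hy, div_mul_cancel₀ _ hreg, sub_self]
  · exact e.adExp_vec_mem hP hαP hneg hy _ β fun hβP => hβ ⟨hβP, h⟩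

lemma hPart_straighten (hα : B.IsPos α) (hP : IsClosedSet P) (hαP : α ∈ P) (hneg : negRoot α ∉ P)
    {y : G.lie} (hy : y ∈ e.hSum P) : e.hPart (G.straighten e α y) = e.hPart y := by
  rw [G.straighten_eq_adExp e hα, e.hPart_adExp_vec hP hαP hneg hy]

/-- Straightening along all roots of the list `l` makes their components vanish. -/
lemma foldr_straighten {l : List H.root} (hl : IsStraighteningList B l) {y : G.lie}
    (hy : y ∈ e.hSum {α | B.IsPos α}) (hreg : ∀ β : H.root, e.rootVal β y ≠ 0) :
    l.foldr (G.straighten e) y ∈ e.hSum (posOutside B l) ∧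
      e.hPart (l.foldr (G.straighten e) y) = e.hPart y := by
  induction l with
  | nil => simpa [posOutside_nil] using hy
  | cons α l ih =>
    obtain ⟨h1, h2⟩ := ih hl.tail
    rw [List.foldr_cons, posOutside_cons]
    refine ⟨G.straighten_mem e hl.isPos_head hl.isClosedSet_tail hl.head_mem
      hl.negRoot_head_notMem h1 ?_, ?_⟩
    · rw [e.rootVal_eq_of_hPart_eq h2]
      exact hreg α
    · rw [G.hPart_straighten e hl.isPos_head hl.isClosedSet_tail hl.head_mem
        hl.negRoot_head_notMem h1, h2]

/-- The group element that straightens `y` along the list `l`. -/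
def straightenElt (e : RootVectors H) : List H.root → G.lie → G.grp
  | [], _ => 1
  | α :: l, y =>
    G.expMap ((e.coef α (l.foldr (G.straighten e) y) /
      e.rootVal α (l.foldr (G.straighten e) y)) • e.vec α) * straightenElt e l y

lemma Ad_straightenElt (l : List H.root) (y : G.lie) :
    G.Ad (G.straightenElt e l y) y = l.foldr (G.straighten e) y := by
  induction l with
  | nil => simp [straightenElt]
  | cons α l ih => rw [straightenElt, Ad_mul, ih]; rfl

lemma straightenElt_mem {w : (rootSystem H).weylGroup} {l : List H.root}
    (hl : ∀ α ∈ l, α ∈ inversions B w) (y : G.lie) :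
    G.straightenElt e l y ∈ G.subgroupOf (e.nLower B w) := by
  induction l with
  | nil => exact Subgroup.one_mem _
  | cons α l ih =>
    refine Subgroup.mul_mem _ (G.expMap_mem_subgroupOf ?_)
      (ih fun β hβ => hl β (List.mem_cons_of_mem _ hβ))
    exact (e.nLower B w).smul_mem _ ((e.mem_nLower B).mpr (e.vec_mem_nSum (hl α (by simp))))

/-- The products `exp (t_m e_{α_m}) ⋯ exp (t_1 e_{α_1})` for a list `[α_m, …, α_1]` of roots. -/
def expProducts (e : RootVectors H) : List H.root → Set G.grp
  | [] => {1}
  | α :: l => {u | ∃ t : ℂ, ∃ v ∈ expProducts e l, u = G.expMap (t • e.vec α) * v}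

lemma straightenElt_mem_expProducts (l : List H.root) (y : G.lie) :
    G.straightenElt e l y ∈ G.expProducts e l := by
  induction l with
  | nil => rfl
  | cons α l ih => exact ⟨_, _, ih, rfl⟩

/-- Among the products of exponentials, only one straightens a given regular element. -/
lemma eq_straightenElt_of_mem_expProducts {l : List H.root} (hl : IsStraighteningList B l)
    {y : G.lie} (hy : y ∈ e.hSum {α | B.IsPos α}) (hreg : ∀ β : H.root, e.rootVal β y ≠ 0)
    {v : G.grp} (hv : v ∈ G.expProducts e l) (hvy : G.Ad v y ∈ e.hSum (posOutside B l)) :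
    v = G.straightenElt e l y := by
  induction l generalizing v with
  | nil => exact hv
  | cons α l ih =>
    obtain ⟨t, v, hv, rfl⟩ := hv
    rw [Ad_mul] at hvy
    set x := G.Ad (G.expMap (t • e.vec α)) (G.Ad v y) with hx
    have hxl : x ∈ e.hSum (posOutside B l) := by
      rw [posOutside_cons] at hvy
      exact e.hSum_mono Set.sdiff_subset hvy
    have hv' : G.Ad v y ∈ e.hSum (posOutside B l) := by
      have h1 : G.Ad v y = adExp (e.vec α) (-t) x := by
        rw [← G.Ad_expMap_smul (G.isNilpotent_vec e hl.isPos_head), neg_smul, expMap_neg, hx,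
          Ad_inv_Ad]
      rw [h1]
      exact e.adExp_vec_mem hl.isClosedSet_tail hl.head_mem hl.negRoot_head_notMem hxl _
    have hvl := ih hl.tail hv hv'
    have hz : G.Ad v y = l.foldr (G.straighten e) y := by rw [hvl, Ad_straightenElt]
    have hr : e.rootVal α (l.foldr (G.straighten e) y) ≠ 0 := by
      rw [e.rootVal_eq_of_hPart_eq (G.foldr_straighten e hl.tail hy hreg).2]
      exact hreg α
    have hc : e.coef α x = 0 := hvy α (by simp [posOutside_cons])
    rw [hx, G.Ad_expMap_smul (G.isNilpotent_vec e hl.isPos_head), e.coef_adExp_vec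
      hl.isClosedSet_tail hl.head_mem hl.negRoot_head_notMem hv', hz, sub_eq_zero] at hc
    rw [straightenElt, ← hvl, hc, mul_div_cancel_right₀ _ hr]

section Inversions

variable {w : (rootSystem H).weylGroup} {l : List H.root} (hl : IsStraighteningList B l)
  (hmem : ∀ α, α ∈ l ↔ α ∈ inversions B w)

include hl hmem

/-- The elements of `h₀ + 𝔫_w`, for the height element `h₀`, are straightened to `h₀`. -/
lemma foldr_straighten_heightElt_add {x : G.lie} (hx : x ∈ e.nLower B w) :
    l.foldr (G.straighten e) (((heightElt B : H) : G.lie) + x) = ((heightElt B : H) : G.lie) := by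
  have hx' := (e.mem_nLower B).mp hx
  set y := ((heightElt B : H) : G.lie) + x with hy
  have hyw : y ∈ e.hSum (inversions B w) :=
    Submodule.add_mem _ (e.coe_mem_hSum _) (e.nSum_le_hSum hx')
  have hyp : e.hPart y = heightElt B := by simp [hy, hx'.1]
  obtain ⟨h1, h2⟩ := G.foldr_straighten e hl (e.hSum_mono (fun _ h => h.1) hyw) fun β => by
    rw [RootVectors.rootVal, hyp]
    exact apply_heightElt_ne_zero B β
  have h3 := G.Ad_sub_mem e (isClosedSet_inversions w)
    (fun α => negRoot_notMem_inversions) subset_rfl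
    (G.straightenElt_mem e (fun α hα => (hmem α).mp hα) y) hyw
  rw [Ad_straightenElt] at h3
  refine e.ext_parts (by rw [h2, hyp, e.hPart_coe]) fun α => ?_
  rw [e.coef_coe]
  by_cases hα : α ∈ inversions B w
  · exact h1 α fun h => h.2 ((hmem α).mpr hα)
  · have := h3.2 α hα
    rw [map_sub, sub_eq_zero] at this
    rw [this, hyw α hα]

lemma straightenElt_heightElt_add {v : G.grp} (hv : v ∈ G.subgroupOf (e.nLower B w)) :
    G.Ad v⁻¹ ((heightElt B : H) : G.lie) - ((heightElt B : H) : G.lie) ∈ e.nLower B w ∧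
      G.straightenElt e l (G.Ad v⁻¹ ((heightElt B : H) : G.lie)) = v := by
  have hx := G.Ad_sub_mem e (isClosedSet_inversions w) (fun α => negRoot_notMem_inversions)
    subset_rfl (Subgroup.inv_mem _ hv) (e.coe_mem_hSum (heightElt B))
  rw [← e.mem_nLower B] at hx
  refine ⟨hx, ?_⟩
  have h1 := G.foldr_straighten_heightElt_add e hl hmem hx
  rw [add_sub_cancel, ← Ad_straightenElt, ← Ad_mul] at h1
  exact mul_inv_eq_one.mp (G.eq_one_of_Ad_heightElt e (Subgroup.mul_mem _
    (G.straightenElt_mem e (fun α hα => (hmem α).mp hα) _) (Subgroup.inv_mem _ hv)) h1)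

/-- The straightening element is the only element of `N_w` that maps a given regular element of `𝔟`
into `𝔥 + 𝔫^w_1`. -/
theorem eq_straightenElt {y : G.lie} (hy : y ∈ e.hSum {α | B.IsPos α})
    (hreg : ∀ β : H.root, e.rootVal β y ≠ 0) {v : G.grp}
    (hv : v ∈ G.subgroupOf (e.nLower B w)) (hvy : G.Ad v y ∈ e.hSum (posOutside B l)) :
    v = G.straightenElt e l y := by
  refine G.eq_straightenElt_of_mem_expProducts e hl hy hreg ?_ hvy
  rw [← (G.straightenElt_heightElt_add e hl hmem hv).2]
  exact G.straightenElt_mem_expProducts e l _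

end Inversions

end Straighten

/-! ### Regularity of the straightening -/

section Regular

variable {X : Type*} (A : Subalgebra ℂ (X → ℂ)) {σ : X → G.lie}

lemma toMat_expMap_smul_mem {x : G.lie} (hx : IsNilpotent (x : Matrix (Fin n) (Fin n) ℂ))
    {s : X → ℂ} (hs : s ∈ A) (i j : Fin n) :
    (fun z => G.toMat (G.expMap (s z • x)) i j) ∈ A := by
  obtain ⟨K, hK⟩ := hx
  have : (fun z => G.toMat (G.expMap (s z • x)) i j) = ∑ k ∈ Finset.range K,
      ((k.factorial : ℂ)⁻¹ * ((x : Matrix (Fin n) (Fin n) ℂ) ^ k) i j) • s ^ k := by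
    funext z
    have hz : (s z • (x : Matrix (Fin n) (Fin n) ℂ)) ^ K = 0 := by
      rw [smul_pow, hK, smul_zero]
    rw [toMat_expMap]
    change NormedSpace.exp (s z • (x : Matrix (Fin n) (Fin n) ℂ)) i j = _
    rw [exp_eq_sum_of_pow_eq_zero hz, Matrix.sum_apply, Finset.sum_apply]
    refine Finset.sum_congr rfl fun k _ => ?_
    rw [Matrix.smul_apply, smul_pow, Matrix.smul_apply, Pi.smul_apply, Pi.pow_apply]
    simp only [smul_eq_mul]
    ring
  rw [this]
  exact A.sum_mem fun k _ => A.smul_mem (A.pow_mem hs k) _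

variable (hσ : ∀ ℓ : Module.Dual ℂ G.lie, (fun x => ℓ (σ x)) ∈ A)
  (hinv : ∀ α, (fun x => (e.rootVal α (σ x))⁻¹) ∈ A)
  (hpos : ∀ x, σ x ∈ e.hSum {α | B.IsPos α}) (hreg : ∀ x, ∀ β : H.root, e.rootVal β (σ x) ≠ 0)
  {l : List H.root} (hl : IsStraighteningList B l)

include hσ hinv

lemma straighten_param_mem (α : H.root) :
    (fun x => e.coef α (σ x) / e.rootVal α (σ x)) ∈ A := by
  simp only [div_eq_mul_inv]
  exact A.mul_mem (hσ (e.coef α)) (hinv α)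

include hpos hreg hl

lemma linear_foldr_straighten_mem (ℓ : Module.Dual ℂ G.lie) :
    (fun x => ℓ (l.foldr (G.straighten e) (σ x))) ∈ A := by
  induction l generalizing ℓ with
  | nil => exact hσ ℓ
  | cons α l ih =>
    simp only [List.foldr_cons, G.straighten_eq_adExp e hl.isPos_head]
    refine RootVectors.linear_adExp_mem A _ (ih hl.tail) (G.straighten_param_mem e A (ih hl.tail) ?_ α) _ _
    intro β
    convert! hinv β using 1
    funext x
    rw [e.rootVal_eq_of_hPart_eq (G.foldr_straighten e hl.tail (hpos x) (hreg x)).2]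

lemma toMat_straightenElt_mem (i j : Fin n) :
    (fun x => G.toMat (G.straightenElt e l (σ x)) i j) ∈ A ∧
      (fun x => G.toMat (G.straightenElt e l (σ x))⁻¹ i j) ∈ A := by
  induction l generalizing i j with
  | nil =>
    have h := A.algebraMap_mem ((1 : Matrix (Fin n) (Fin n) ℂ) i j)
    exact ⟨h, by simp only [straightenElt, inv_one, toMat_one]; exact h⟩
  | cons α l ih =>
    have hs : (fun x => e.coef α (l.foldr (G.straighten e) (σ x)) /
        e.rootVal α (l.foldr (G.straighten e) (σ x))) ∈ A := by
      refine G.straighten_param_mem e A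
        (G.linear_foldr_straighten_mem e A hσ hinv hpos hreg hl.tail) (fun β => ?_) α
      convert! hinv β using 1
      funext x
      rw [e.rootVal_eq_of_hPart_eq (G.foldr_straighten e hl.tail (hpos x) (hreg x)).2]
    have hnil := G.isNilpotent_vec e hl.isPos_head
    constructor
    · simp only [straightenElt, toMat_mul, Matrix.mul_apply]
      have := A.sum_mem (t := Finset.univ) fun k _ =>
        A.mul_mem (G.toMat_expMap_smul_mem A hnil hs i k) (ih hl.tail k j).1
      convert! this using 1
      funext x
      simp
    · simp only [straightenElt, mul_inv_rev, toMat_mul, Matrix.mul_apply, ← expMap_neg,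
        ← neg_smul]
      have := A.sum_mem (t := Finset.univ) fun k _ =>
        A.mul_mem (ih hl.tail i k).2 (G.toMat_expMap_smul_mem A hnil (A.neg_mem hs) k j)
      convert! this using 1
      funext x
      simp

end Regular

end LinearAlgebraicGroup

/-! ### The birational equivalence -/

section Extension

lemma mem_of_forall_eq {X : Type*} {A : Subalgebra ℂ (X → ℂ)} {f g : X → ℂ} (hg : g ∈ A)
    (h : ∀ x, f x = g x) : f ∈ A := by
  rwa [funext h]

lemma exists_extend_dual {E : Type*} [AddCommGroup E] [Module ℂ E] (p : Submodule ℂ E)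
    (ℓ : Module.Dual ℂ p) : ∃ m : Module.Dual ℂ E, ∀ x : p, ℓ x = m x := by
  obtain ⟨m, hm⟩ := LinearMap.exists_extend ℓ
  exact ⟨m, fun x => (LinearMap.congr_fun hm x).symm⟩

lemma exists_extend_dual_lie {L : Type*} [LieRing L] [LieAlgebra ℂ L] (M : LieSubalgebra ℂ L)
    (ℓ : Module.Dual ℂ M) : ∃ m : Module.Dual ℂ L, ∀ x : M, ℓ x = m x :=
  exists_extend_dual M.toSubmodule ℓ

end Extension

section LieSubalgebraFunctions

variable {L : Type*} [LieRing L] [LieAlgebra ℂ L] [FiniteDimensional ℂ L] [IsKilling ℂ L]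
  {H : LieSubalgebra ℂ L} [H.IsCartanSubalgebra] (e : RootVectors H) (M : LieSubalgebra ℂ L)

lemma RootVectors.rootProd_coe_mem_polyFun : (fun y : M => e.rootProd (y : L)) ∈ polyFun M :=
  e.rootProd_mem_polyFun (M.subtype : M →ₗ[ℂ] L)

lemma RootVectors.exists_mul_rootProd_pow_coe {f : e.regPart (M : Set L) → ℂ}
    (hf : f ∈ e.regFun (M : Set L)) :
    ∃ m : ℕ, ∃ g ∈ polyFun M, ∀ y : M, ∀ hy : (y : L) ∈ e.regPart (M : Set L),
      f ⟨y, hy⟩ * e.rootProd (y : L) ^ m = g y :=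
  e.exists_mul_rootProd_pow (M.subtype : M →ₗ[ℂ] L) hf

end LieSubalgebraFunctions

namespace LinearAlgebraicGroup

variable {n : ℕ} (G : LinearAlgebraicGroup n)

section ProductFunctions

lemma dual_matrix_apply (m : Module.Dual ℂ (Matrix (Fin n) (Fin n) ℂ))
    (M : Matrix (Fin n) (Fin n) ℂ) : m M = ∑ i, ∑ j, m (Matrix.single i j 1) * M i j := by
  conv_lhs => rw [Matrix.matrix_eq_sum_single M]
  simp only [map_sum]
  refine Finset.sum_congr rfl fun i _ => Finset.sum_congr rfl fun j _ => ?_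
  rw [← mul_one (M i j), ← smul_eq_mul (M i j), ← Matrix.smul_single, map_smul, smul_eq_mul,
    smul_eq_mul, mul_one, mul_comm]

lemma linear_Ad_mem {X : Type*} (A : Subalgebra ℂ (X → ℂ)) {u : X → G.grp} {σ : X → G.lie}
    (hu : ∀ i j, (fun x => G.toMat (u x) i j) ∈ A)
    (hu' : ∀ i j, (fun x => G.toMat (u x)⁻¹ i j) ∈ A)
    (hσ : ∀ ℓ : Module.Dual ℂ G.lie, (fun x => ℓ (σ x)) ∈ A) (ℓ : Module.Dual ℂ G.lie) :
    (fun x => ℓ (G.Ad (u x) (σ x))) ∈ A := by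
  obtain ⟨m, hm⟩ := exists_extend_dual_lie G.lie ℓ
  have hentry : ∀ i j, (fun x => (σ x : Matrix (Fin n) (Fin n) ℂ) i j) ∈ A := fun i j =>
    hσ ((Matrix.entryLinearMap ℂ ℂ i j).comp (G.lie.subtype : G.lie →ₗ[ℂ] _))
  have h : (fun x => ℓ (G.Ad (u x) (σ x))) = ∑ i, ∑ j, m (Matrix.single i j 1) •
      ∑ k, (∑ p, (fun x => G.toMat (u x) i p) *
        fun x => (σ x : Matrix (Fin n) (Fin n) ℂ) p k) * fun x => G.toMat (u x)⁻¹ k j := by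
    funext x
    rw [hm, coe_Ad]
    rw [dual_matrix_apply]
    simp only [Matrix.mul_apply, Finset.sum_apply, Pi.smul_apply, Pi.mul_apply, smul_eq_mul]
  rw [h]
  exact A.sum_mem fun i _ => A.sum_mem fun j _ => A.smul_mem (A.sum_mem fun k _ =>
    A.mul_mem (A.sum_mem fun p _ => A.mul_mem (hu i p) (hentry p k)) (hu' k j)) _

variable (K : Subgroup G.grp) (V : Submodule ℂ G.lie)

lemma toMat_mem_prodFun (i j : Fin n) :
    (fun z : K × V => G.toMat (z.1 : G.grp) i j) ∈ G.prodFun K V :=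
  Algebra.subset_adjoin (Or.inl (Or.inl ⟨(i, j), rfl⟩))

lemma toMat_inv_mem_prodFun (i j : Fin n) :
    (fun z : K × V => G.toMat (z.1 : G.grp)⁻¹ i j) ∈ G.prodFun K V :=
  Algebra.subset_adjoin (Or.inl (Or.inr ⟨(i, j), rfl⟩))

lemma dual_mem_prodFun (ℓ : Module.Dual ℂ V) :
    (fun z : K × V => ℓ z.2) ∈ G.prodFun K V :=
  Algebra.subset_adjoin (Or.inr ⟨ℓ, rfl⟩)

variable {K V}

/-- A map into `K × V` pulls the regular functions back into an algebra of functions if it does so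
for the generators. -/
lemma comp_mem_of_mem_prodFun {X : Type*} (A : Subalgebra ℂ (X → ℂ)) (τ : X → K × V)
    (h1 : ∀ i j, (fun x => G.toMat ((τ x).1 : G.grp) i j) ∈ A)
    (h2 : ∀ i j, (fun x => G.toMat ((τ x).1 : G.grp)⁻¹ i j) ∈ A)
    (h3 : ∀ ℓ : Module.Dual ℂ V, (fun x => ℓ (τ x).2) ∈ A) {f : K × V → ℂ}
    (hf : f ∈ G.prodFun K V) : f ∘ τ ∈ A := by
  induction hf using Algebra.adjoin_induction with
  | mem f hf =>
    rcases hf with (⟨ij, rfl⟩ | ⟨ij, rfl⟩) | ⟨ℓ, rfl⟩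
    · exact h1 ij.1 ij.2
    · exact h2 ij.1 ij.2
    · exact h3 ℓ
  | algebraMap r => exact A.algebraMap_mem r
  | add f g _ _ hf hg => exact A.add_mem hf hg
  | mul f g _ _ hf hg => exact A.mul_mem hf hg

end ProductFunctions

variable [IsKilling ℂ G.lie] {H : LieSubalgebra ℂ G.lie} [H.IsCartanSubalgebra]
  {B : (rootSystem H).Base} (e : RootVectors H)

lemma Ad_heightElt_sub_mem {w : (rootSystem H).weylGroup} {v : G.grp}
    (hv : v ∈ G.subgroupOf (e.nLower B w)) :
    G.Ad v ((heightElt B : H) : G.lie) - ((heightElt B : H) : G.lie) ∈ e.nLower B w := by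
  rw [e.mem_nLower B]
  exact G.Ad_sub_mem e (isClosedSet_inversions w) (fun α => negRoot_notMem_inversions)
    subset_rfl hv (e.coe_mem_hSum (heightElt B))

section ProductVariety

variable (w : (rootSystem H).weylGroup) (V : Submodule ℂ G.lie)

/-- The map `(u, x) ↦ (Ad u h₀ - h₀, x)` from `N_w × V` to the linear space `𝔫_w × V`, where `h₀` is
the height element. -/
def orbitMap (z : G.subgroupOf (e.nLower B w) × V) : e.nLower B w × V :=
  (⟨G.Ad z.1 ((heightElt B : H) : G.lie) - ((heightElt B : H) : G.lie),
    G.Ad_heightElt_sub_mem e z.1.2⟩, z.2)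

lemma orbitMap_bijective :
    Function.Bijective (G.orbitMap (B := B) e w V) := by
  constructor
  · rintro ⟨⟨u, hu⟩, x⟩ ⟨⟨v, hv⟩, y⟩ h
    have h1 := congrArg Subtype.val (congrArg Prod.fst h)
    have h2 : x = y := congrArg Prod.snd h
    change G.Ad u ((heightElt B : H) : G.lie) - ((heightElt B : H) : G.lie) =
      G.Ad v ((heightElt B : H) : G.lie) - ((heightElt B : H) : G.lie) at h1
    have h3 : G.Ad (v⁻¹ * u) ((heightElt B : H) : G.lie) = ((heightElt B : H) : G.lie) := by
      rw [Ad_mul, sub_left_injective h1, Ad_inv_Ad]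
    have h4 := G.eq_one_of_Ad_heightElt e (Subgroup.mul_mem _ (Subgroup.inv_mem _ hv) hu) h3
    have h5 : u = v := (inv_mul_eq_one.mp h4).symm
    subst h5 h2
    rfl
  · rintro ⟨⟨η, hη⟩, x⟩
    obtain ⟨l, hl, hmem⟩ := exists_isStraighteningList B w
    set y := ((heightElt B : H) : G.lie) + η with hy
    have h1 := G.foldr_straighten_heightElt_add e hl hmem hη
    rw [← Ad_straightenElt] at h1
    refine ⟨(⟨(G.straightenElt e l y)⁻¹, Subgroup.inv_mem _
      (G.straightenElt_mem e (fun α hα => (hmem α).mp hα) y)⟩, x), Prod.ext (Subtype.ext ?_) rfl⟩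
    change G.Ad (G.straightenElt e l y)⁻¹ ((heightElt B : H) : G.lie) -
      ((heightElt B : H) : G.lie) = η
    rw [← h1, Ad_inv_Ad, h1, add_sub_cancel_left]

lemma prodFun_eq_map_orbitMap : G.prodFun (G.subgroupOf (e.nLower B w)) V =
    (polyFun (e.nLower B w × V)).map (pullback (G.orbitMap e w V)) := by
  apply le_antisymm
  · obtain ⟨l, hl, hmem⟩ := exists_isStraighteningList B w
    let σ : e.nLower B w × V → G.lie := fun z => ((heightElt B : H) : G.lie) + z.1
    have hp : ∀ z, e.hPart (σ z) = heightElt B := fun z => by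
      have h := ((e.mem_nLower B).mp z.1.2).1
      simp only [σ, map_add, h, RootVectors.hPart_coe, add_zero]
    have hmat := G.toMat_straightenElt_mem e (polyFun (e.nLower B w × V)) (σ := σ)
      (fun ℓ => by
        have h1 := (polyFun (e.nLower B w × V)).algebraMap_mem (ℓ ((heightElt B : H) : G.lie))
        have h2 := linear_mem_polyFun ((ℓ.comp ((e.nLower B w).subtype : _ →ₗ[ℂ] G.lie)).comp
          (LinearMap.fst ℂ (e.nLower B w) V))
        convert! Subalgebra.add_mem _ h1 h2 using 1
        funext z
        exact map_add ℓ _ _)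
      (fun α => by
        have h1 := (polyFun (e.nLower B w × V)).algebraMap_mem
          ((α : LieModule.Weight ℂ H G.lie) (heightElt B))⁻¹
        convert! h1 using 1
        funext z
        rw [RootVectors.rootVal, hp]
        rfl)
      (fun z => Submodule.add_mem _ (e.coe_mem_hSum _) (e.nSum_le_hSum (G.nLower_le e z.1.2)))
      (fun z β => by
        rw [RootVectors.rootVal, hp]
        exact apply_heightElt_ne_zero B β) hl
    have hinv : ∀ z : G.subgroupOf (e.nLower B w) × V,
        G.straightenElt e l (σ (G.orbitMap e w V z)) = (z.1 : G.grp)⁻¹ := fun z => by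
      have h := (G.straightenElt_heightElt_add e hl hmem (Subgroup.inv_mem _ z.1.2)).2
      rw [inv_inv] at h
      change G.straightenElt e l (((heightElt B : H) : G.lie) +
        (G.Ad z.1 ((heightElt B : H) : G.lie) - ((heightElt B : H) : G.lie))) = _
      rw [add_sub_cancel, h]
    refine Algebra.adjoin_le ?_
    rintro _ ((⟨ij, rfl⟩ | ⟨ij, rfl⟩) | ⟨ℓ, rfl⟩)
    · refine ⟨_, (hmat ij.1 ij.2).2, funext fun z => ?_⟩
      change G.toMat (G.straightenElt e l (σ (G.orbitMap e w V z)))⁻¹ ij.1 ij.2 = _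
      rw [hinv, inv_inv]
      rfl
    · refine ⟨_, (hmat ij.1 ij.2).1, funext fun z => ?_⟩
      change G.toMat (G.straightenElt e l (σ (G.orbitMap e w V z))) ij.1 ij.2 = _
      rw [hinv]
      rfl
    · exact ⟨_, linear_mem_polyFun (ℓ.comp (LinearMap.snd ℂ (e.nLower B w) V)), rfl⟩
  · rw [Subalgebra.map_le]
    refine Algebra.adjoin_le ?_
    rintro _ ⟨ℓ, rfl⟩
    obtain ⟨m, hm⟩ := exists_extend_dual_lie (e.nLower B w)
      (ℓ.comp (LinearMap.inl ℂ (e.nLower B w) V))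
    have h1 := G.linear_Ad_mem (G.prodFun (G.subgroupOf (e.nLower B w)) V)
      (G.toMat_mem_prodFun _ V) (G.toMat_inv_mem_prodFun _ V)
      (σ := fun _ => ((heightElt B : H) : G.lie)) (fun ℓ => Subalgebra.algebraMap_mem _ _) m
    have h2 := (G.prodFun (G.subgroupOf (e.nLower B w)) V).algebraMap_mem
      (m ((heightElt B : H) : G.lie))
    have h3 := G.dual_mem_prodFun (G.subgroupOf (e.nLower B w)) V
      (ℓ.comp (LinearMap.inr ℂ (e.nLower B w) V))
    have h6 := Subalgebra.add_mem _ (Subalgebra.sub_mem _ h1 h2) h3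
    change (fun z => ℓ (G.orbitMap e w V z)) ∈ G.prodFun (G.subgroupOf (e.nLower B w)) V
    refine mem_of_forall_eq h6 fun z => ?_
    have h4 := hm (G.orbitMap e w V z).1
    have h5 : G.orbitMap e w V z =
        LinearMap.inl ℂ (e.nLower B w) V (G.orbitMap e w V z).1 +
          LinearMap.inr ℂ (e.nLower B w) V z.2 := by
      simp [orbitMap]
    change ℓ (G.orbitMap e w V z) = _
    rw [h5, map_add]
    refine congrArg₂ (· + ·) (h4.trans ?_) rfl
    exact map_sub m _ _

/-- `N_w × V` is an irreducible affine variety, being isomorphic to an affine space. -/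
theorem isIrreducibleAffineVariety_prodFun :
    IsIrreducibleAffineVariety (G.prodFun (G.subgroupOf (e.nLower B w)) V) := by
  rw [G.prodFun_eq_map_orbitMap (B := B) e w V]
  exact (isIrreducibleAffineVariety_polyFun _).map_pullback (G.orbitMap_bijective e w V)

end ProductVariety

variable (w : (rootSystem H).weylGroup)

lemma Ad_mem_borel {u : G.grp} (hu : u ∈ G.subgroupOf (e.nLower B w)) {y : G.lie}
    (hy : y ∈ e.hSum {α | B.IsPos α}) :
    G.Ad u y ∈ e.hSum {α | B.IsPos α} ∧ e.hPart (G.Ad u y) = e.hPart y := by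
  have h := G.Ad_sub_mem e isClosedSet_pos (fun α => negRoot_notMem_pos B) (fun _ h => h.1) hu hy
  refine ⟨by simpa using Submodule.add_mem _ (e.nSum_le_hSum h) hy, ?_⟩
  have h1 := h.1
  rwa [map_sub, sub_eq_zero] at h1

lemma hPlusNOne_le : e.hPlusNOne B w ≤ e.hSum {α | B.IsPos α} := by
  rw [e.hPlusNOne_eq B]
  exact e.hSum_mono Set.sdiff_subset

/-- The restriction `N_w × (𝔥 + 𝔫^w_1) → 𝔟` of the adjoint action. -/
def adjointMap (z : G.subgroupOf (e.nLower B w) × e.hPlusNOne B w) : e.borel B 1 :=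
  ⟨G.Ad z.1 z.2, (e.mem_borel_one B).mpr
    (G.Ad_mem_borel e w z.1.2 (G.hPlusNOne_le e w z.2.2)).1⟩

lemma dual_adjointMap_mem (ℓ : Module.Dual ℂ (e.borel B 1)) :
    (fun z => ℓ (G.adjointMap e w z)) ∈
      G.prodFun (G.subgroupOf (e.nLower B w)) (e.hPlusNOne B w) := by
  obtain ⟨m, hm⟩ := exists_extend_dual_lie (e.borel B 1) ℓ
  have h := G.linear_Ad_mem (G.prodFun (G.subgroupOf (e.nLower B w)) (e.hPlusNOne B w))
    (u := fun z => z.1) (G.toMat_mem_prodFun _ _) (G.toMat_inv_mem_prodFun _ _)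
    (σ := fun z => z.2) (fun ℓ => G.dual_mem_prodFun _ _ (ℓ.comp (e.hPlusNOne B w).subtype)) m
  refine mem_of_forall_eq h fun z => ?_
  exact hm (G.adjointMap e w z)

lemma comp_adjointMap_mem {f : e.borel B 1 → ℂ} (hf : f ∈ polyFun (e.borel B 1)) :
    f ∘ G.adjointMap e w ∈ G.prodFun (G.subgroupOf (e.nLower B w)) (e.hPlusNOne B w) := by
  induction hf using Algebra.adjoin_induction with
  | mem f hf =>
    obtain ⟨ℓ, rfl⟩ := hf
    exact G.dual_adjointMap_mem e w ℓ
  | algebraMap r => exact Subalgebra.algebraMap_mem _ r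
  | add f g _ _ hf hg => exact Subalgebra.add_mem _ hf hg
  | mul f g _ _ hf hg => exact Subalgebra.mul_mem _ hf hg

theorem isBirationalEquiv_adjointMap :
    IsBirationalEquiv (G.prodFun (G.subgroupOf (e.nLower B w)) (e.hPlusNOne B w))
      (polyFun (e.borel B 1)) (G.adjointMap e w) := by
  obtain ⟨l, hl, hmem⟩ := exists_isStraighteningList B w
  have hV : e.hPlusNOne B w = e.hSum (posOutside B l) := by
    rw [e.hPlusNOne_eq B, posOutside_eq hmem]
  have hpos : ∀ y : e.borel B 1, (y : G.lie) ∈ e.hSum {α | B.IsPos α} := fun y =>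
    (e.mem_borel_one B).mp y.2
  -- the inverse of the adjoint action over the regular part of the Borel subalgebra
  let τ : e.regPart (e.borel B 1 : Set G.lie) →
      G.subgroupOf (e.nLower B w) × e.hPlusNOne B w := fun y =>
    (⟨(G.straightenElt e l y)⁻¹, Subgroup.inv_mem _
      (G.straightenElt_mem e (fun α hα => (hmem α).mp hα) y)⟩,
      ⟨l.foldr (G.straighten e) (y : G.lie), by
        rw [hV]
        exact (G.foldr_straighten e hl ((e.mem_borel_one B).mp y.2.1) y.2.2).1⟩)
  have hτ : ∀ z, ∀ hz : (G.adjointMap e w z : G.lie) ∈ e.regPart (e.borel B 1 : Set G.lie),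
      τ ⟨G.adjointMap e w z, hz⟩ = z := by
    rintro ⟨⟨u, hu⟩, x⟩ hz
    have hx : G.Ad u⁻¹ (G.Ad u x) ∈ e.hSum (posOutside B l) := by
      rw [Ad_inv_Ad, ← hV]
      exact x.2
    have hus : u⁻¹ = G.straightenElt e l (G.Ad u x) := G.eq_straightenElt e hl hmem
      ((e.mem_borel_one B).mp hz.1) hz.2 (Subgroup.inv_mem _ hu) hx
    refine Prod.ext (Subtype.ext ?_) (Subtype.ext ?_)
    · change (G.straightenElt e l (G.Ad u x))⁻¹ = u
      rw [← hus, inv_inv]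
    · change l.foldr (G.straighten e) (G.Ad u x) = x
      rw [← Ad_straightenElt, ← hus, Ad_inv_Ad]
  have hφτ : ∀ y, (G.adjointMap e w (τ y) : G.lie) = y := fun y => by
    change G.Ad (G.straightenElt e l y)⁻¹ (l.foldr (G.straighten e) (y : G.lie)) = y
    rw [← Ad_straightenElt, Ad_inv_Ad]
  have hτreg : ∀ f ∈ G.prodFun (G.subgroupOf (e.nLower B w)) (e.hPlusNOne B w),
      f ∘ τ ∈ e.regFun (e.borel B 1 : Set G.lie) := by
    intro f hf
    have hmat := G.toMat_straightenElt_mem e (e.regFun (e.borel B 1 : Set G.lie))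
      e.linear_mem_regFun e.inv_rootVal_mem_regFun
      (fun y => (e.mem_borel_one B).mp y.2.1) (fun y => y.2.2) hl
    refine G.comp_mem_of_mem_prodFun _ τ (fun i j => (hmat i j).2) (fun i j => ?_) (fun ℓ => ?_) hf
    · simp only [τ, inv_inv]
      exact (hmat i j).1
    · refine Exists.elim (exists_extend_dual (e.hPlusNOne B w) ℓ) fun m hm => ?_
      have h := G.linear_foldr_straighten_mem e (e.regFun (e.borel B 1 : Set G.lie))
        e.linear_mem_regFun e.inv_rootVal_mem_regFun
        (fun y => (e.mem_borel_one B).mp y.2.1) (fun y => y.2.2) hl m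
      refine mem_of_forall_eq h fun y => ?_
      exact hm (τ y).2
  have hq := e.rootProd_coe_mem_polyFun (e.borel B 1)
  have hreg : ∀ y : e.borel B 1, e.rootProd (y : G.lie) ≠ 0 →
      (y : G.lie) ∈ e.regPart (e.borel B 1 : Set G.lie) := fun y hy =>
    ⟨y.2, e.rootProd_ne_zero_iff.mp hy⟩
  let y₀ : e.regPart (e.borel B 1 : Set G.lie) := ⟨((heightElt B : H) : G.lie),
    (e.mem_borel_one B).mpr (e.coe_mem_hSum _), fun α => by
      rw [RootVectors.rootVal, e.hPart_coe]
      exact apply_heightElt_ne_zero B α⟩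
  have hy₀ : e.rootProd (y₀ : G.lie) ≠ 0 := e.rootProd_ne_zero_iff.mpr y₀.2.2
  refine ⟨G.isIrreducibleAffineVariety_prodFun e w _, isIrreducibleAffineVariety_polyFun _,
    fun f hf => G.comp_adjointMap_mem e w hf,
    (fun y : e.borel B 1 => e.rootProd (y : G.lie)) ∘ G.adjointMap e w,
    G.comp_adjointMap_mem e w hq, fun y => e.rootProd (y : G.lie), hq, fun h => hy₀ ?_,
    fun h => hy₀ ?_, ⟨fun z hz => hz, ?_, ?_⟩, fun f hf => ?_⟩
  · rw [← hφτ]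
    exact congrFun h (τ y₀)
  · exact congrFun h ⟨y₀, y₀.2.1⟩
  · intro z hz z' hz' h
    have h1 := hτ z (hreg _ hz)
    have h2 := hτ z' (hreg _ hz')
    rw [← h1, ← h2]
    congr 2
    exact congrArg Subtype.val h
  · intro y hy
    have h' : G.adjointMap e w (τ ⟨y, hreg y hy⟩) = y := Subtype.ext (hφτ ⟨y, hreg y hy⟩)
    refine ⟨τ ⟨y, hreg y hy⟩, ?_, h'⟩
    rw [Set.mem_ofPred_eq, Function.comp_apply, h']
    exact hy
  · refine Exists.elim (e.exists_mul_rootProd_pow_coe (e.borel B 1) (hτreg f hf)) fun m hm => ?_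
    refine Exists.elim hm fun g hg => ⟨m, g, hg.1, fun z hz => ?_⟩
    have hz' := hreg (G.adjointMap e w z) hz
    have h := hg.2 (G.adjointMap e w z) hz'
    rw [Function.comp_apply, hτ z hz'] at h
    exact h

end LinearAlgebraicGroup

/-! ### Pull-backs and projections for the localized algebras -/

section Pullback

variable {L : Type*} [LieRing L] [LieAlgebra ℂ L] [FiniteDimensional ℂ L] [IsKilling ℂ L]
  {H : LieSubalgebra ℂ L} [H.IsCartanSubalgebra] {B : (rootSystem H).Base}

namespace RootVectors

variable (e : RootVectors H)

section PullbackReg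

variable {U V : Set L} (s : e.regPart U → e.regPart V) (hp : ∀ y, e.hPart (s y : L) = e.hPart y)
  (hs : ∀ ℓ : Module.Dual ℂ L, (fun y => ℓ (s y : L)) ∈ e.regFun U)

/-- The homomorphism `ℂ[V]' → ℂ[U]'` given by a regular map `U' → V'` that preserves the components
in the Cartan subalgebra. -/
def pullbackReg : e.regFun V →ₐ[ℂ] e.regFun U :=
  ((pullback s).comp (e.regFun V).val).codRestrict (e.regFun U) fun f =>
    e.comp_mem_of_mem_regFun (e.regFun U) s hs (fun α => mem_of_forall_eq
      (e.inv_rootVal_mem_regFun α) fun y => by rw [e.rootVal_eq_of_hPart_eq (hp y)]) f.2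

lemma pullbackReg_apply (f : e.regFun V) (y : e.regPart U) :
    (e.pullbackReg s hp hs f : e.regPart U → ℂ) y = (f : e.regPart V → ℂ) (s y) := rfl

variable {s hp hs} in
lemma pullbackReg_pullbackReg {W : Set L} {s' : e.regPart V → e.regPart W}
    {hp' : ∀ y, e.hPart (s' y : L) = e.hPart y}
    {hs' : ∀ ℓ : Module.Dual ℂ L, (fun y => ℓ (s' y : L)) ∈ e.regFun V}
    {t : e.regPart U → e.regPart W} {ht : ∀ y, e.hPart (t y : L) = e.hPart y}
    {ht' : ∀ ℓ : Module.Dual ℂ L, (fun y => ℓ (t y : L)) ∈ e.regFun U}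
    (h : ∀ y, (s' (s y) : L) = t y) (f : e.regFun W) :
    e.pullbackReg s hp hs (e.pullbackReg s' hp' hs' f) = e.pullbackReg t ht ht' f :=
  Subtype.ext (funext fun y =>
    congrArg (f : e.regPart W → ℂ) (Subtype.ext (h y) : s' (s y) = t y))

end PullbackReg

section Projection

variable (P : Set H.root)

open Classical in
/-- The projection of `L` onto `𝔥 ⊕ ⨁_P 𝔤_α` along the other root spaces. -/
def proj : L →ₗ[ℂ] L :=
  e.sumMap.comp (e.hPart.prod (LinearMap.pi fun α => if α ∈ P then e.coef α else 0))

open Classical in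
lemma proj_apply (y : L) :
    e.proj P y = (e.hPart y : L) + ∑ α, (if α ∈ P then e.coef α y else 0) • e.vec α := by
  refine (e.sumMap_apply _ _).trans ?_
  congr 1
  refine Finset.sum_congr rfl fun α _ => ?_
  by_cases h : α ∈ P <;> simp [h]

@[simp] lemma hPart_proj (y : L) : e.hPart (e.proj P y) = e.hPart y := by
  rw [proj_apply, hPart_sumMap]

lemma proj_mem (y : L) : e.proj P y ∈ e.hSum P := fun α hα => by
  rw [proj_apply, coef_sumMap, if_neg hα]

variable {P}

lemma proj_eq_self {y : L} (hy : y ∈ e.hSum P) : e.proj P y = y := by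
  classical
  refine e.ext_parts (by simp) fun α => ?_
  rw [proj_apply, coef_sumMap]
  split_ifs with h
  · rfl
  · exact (hy α h).symm

lemma linear_sub_linear_proj [DecidablePred (· ∈ P)] (ℓ : Module.Dual ℂ L) (y : L) :
    ℓ y - ℓ (e.proj P y) = ∑ α, if α ∈ P then 0 else e.coef α y * ℓ (e.vec α) := by
  classical
  have h1 := congrArg ℓ (e.eq_hPart_add_sum y)
  have h2 := congrArg ℓ (e.proj_apply P y)
  rw [map_add, map_sum] at h1 h2
  rw [h1, h2, add_sub_add_left_eq_sub, ← Finset.sum_sub_distrib]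
  refine Finset.sum_congr rfl fun α _ => ?_
  rw [map_smul, map_smul, smul_eq_mul, smul_eq_mul]
  split_ifs <;> simp

/-- Modulo an ideal that contains the coordinates `c_α` with `α ∉ P`, each element of `ℂ[U]'` is
determined by its restriction to `𝔥 ⊕ ⨁_P 𝔤_α`. -/
lemma sub_pullbackReg_proj_mem {U : Set L} (s : e.regPart U → e.regPart U)
    (hsP : ∀ y, (s y : L) = e.proj P y) (hp : ∀ y, e.hPart (s y : L) = e.hPart y)
    (hs : ∀ ℓ : Module.Dual ℂ L, (fun y => ℓ (s y : L)) ∈ e.regFun U) (I : Ideal (e.regFun U))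
    (hI : ∀ α ∉ P, e.eHat U (negRoot α) ∈ I) (f : e.regFun U) :
    f - e.pullbackReg s hp hs f ∈ I := by
  classical
  obtain ⟨f, hf⟩ := f
  induction hf using Algebra.adjoin_induction with
  | mem f hf =>
    rcases hf with ⟨ℓ, rfl⟩ | ⟨α, rfl⟩
    · have hsum : (⟨_, e.linear_mem_regFun ℓ⟩ : e.regFun U) -
          e.pullbackReg s hp hs ⟨_, e.linear_mem_regFun ℓ⟩ =
            ∑ α : H.root, if α ∈ P then 0 else ℓ (e.vec α) • e.eHat U (negRoot α) := by
        refine Subtype.ext (funext fun y => ?_)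
        rw [AddSubmonoidClass.coe_finsetSum, Finset.sum_apply]
        change ℓ (y : L) - ℓ (s y : L) = _
        rw [hsP, linear_sub_linear_proj]
        refine Finset.sum_congr rfl fun α _ => ?_
        split_ifs
        · rfl
        · change _ = ℓ (e.vec α) * e.coef (negRoot (negRoot α)) (y : L)
          rw [negRoot_negRoot, mul_comm]
      refine (congrArg (· ∈ I) hsum).mpr (I.sum_mem fun α _ => ?_)
      split_ifs with hα
      · exact I.zero_mem
      · rw [Algebra.smul_def]
        exact I.mul_mem_left _ (hI α hα)
    · have : (⟨_, e.inv_rootVal_mem_regFun α⟩ : e.regFun U) -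
          e.pullbackReg s hp hs ⟨_, e.inv_rootVal_mem_regFun α⟩ = 0 := by
        refine Subtype.ext (funext fun y => ?_)
        change (e.rootVal α (y : L))⁻¹ - (e.rootVal α (s y : L))⁻¹ = 0
        rw [e.rootVal_eq_of_hPart_eq (hp y), sub_self]
      exact (congrArg (· ∈ I) this).mpr I.zero_mem
  | algebraMap r =>
    have : algebraMap ℂ (e.regFun U) r - e.pullbackReg s hp hs (algebraMap ℂ _ r) = 0 := by
      rw [AlgHom.commutes, sub_self]
    exact (congrArg (· ∈ I) this).mpr I.zero_mem
  | add f g hf' hg' hf hg =>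
    have : (⟨f, hf'⟩ + ⟨g, hg'⟩ : e.regFun U) - e.pullbackReg s hp hs (⟨f, hf'⟩ + ⟨g, hg'⟩) =
        (⟨f, hf'⟩ - e.pullbackReg s hp hs ⟨f, hf'⟩) +
          (⟨g, hg'⟩ - e.pullbackReg s hp hs ⟨g, hg'⟩) := by
      rw [map_add]
      ring
    exact (congrArg (· ∈ I) this).mpr (I.add_mem hf hg)
  | mul f g hf' hg' hf hg =>
    have : (⟨f, hf'⟩ * ⟨g, hg'⟩ : e.regFun U) - e.pullbackReg s hp hs (⟨f, hf'⟩ * ⟨g, hg'⟩) =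
        ⟨f, hf'⟩ * (⟨g, hg'⟩ - e.pullbackReg s hp hs ⟨g, hg'⟩) +
          e.pullbackReg s hp hs ⟨g, hg'⟩ * (⟨f, hf'⟩ - e.pullbackReg s hp hs ⟨f, hf'⟩) := by
      rw [map_mul]
      ring
    exact (congrArg (· ∈ I) this).mpr (I.add_mem (I.mul_mem_left _ hg) (I.mul_mem_left _ hf))

lemma proj_mem_regPart {U V : Set L} (hPV : ∀ y ∈ e.hSum P, y ∈ V) (y : e.regPart U) :
    e.proj P (y : L) ∈ e.regPart V :=
  ⟨hPV _ (e.proj_mem P _), fun α => by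
    rw [e.rootVal_eq_of_hPart_eq (e.hPart_proj P _)]
    exact y.2.2 α⟩

/-- The composition with the projection onto `𝔥 ⊕ ⨁_P 𝔤_α`. -/
def projPullback (U : Set L) {V : Set L} (hPV : ∀ y ∈ e.hSum P, y ∈ V) :
    e.regFun V →ₐ[ℂ] e.regFun U :=
  e.pullbackReg (fun y => ⟨e.proj P (y : L), e.proj_mem_regPart hPV y⟩)
    (fun _ => e.hPart_proj _ _) (fun ℓ => e.linear_mem_regFun (ℓ.comp (e.proj _)))

lemma projPullback_apply {U V : Set L} (hPV : ∀ y ∈ e.hSum P, y ∈ V) (f : e.regFun V)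
    (y : e.regPart U) : (e.projPullback U hPV f : e.regPart U → ℂ) y =
      (f : e.regPart V → ℂ) ⟨e.proj P (y : L), e.proj_mem_regPart hPV y⟩ := rfl

section Retraction

variable {U V : Set L} {s : e.regPart U → e.regPart V}
  {hp : ∀ y, e.hPart (s y : L) = e.hPart y}
  {hs : ∀ ℓ : Module.Dual ℂ L, (fun y => ℓ (s y : L)) ∈ e.regFun U}
  (hPU : ∀ y ∈ e.hSum P, y ∈ U) (hsP : ∀ y, (s y : L) ∈ e.hSum P)
  (hsfix : ∀ y : e.regPart U, (y : L) ∈ e.hSum P → (s y : L) = y)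

include hPU hsfix

include hsP in
/-- For a retraction `s` of `U'` onto the regular part of `𝔥 ⊕ ⨁_P 𝔤_α`, the functions of the form
`f ∘ s` are those that take the same values at `y` and `s y`. -/
lemma mem_range_pullbackReg {f : e.regFun U} :
    f ∈ LinearMap.range (e.pullbackReg s hp hs).toLinearMap ↔
      ∀ y z : e.regPart U, (z : L) = s y →
        (f : e.regPart U → ℂ) z = (f : e.regPart U → ℂ) y := by
  constructor
  · rintro ⟨g, rfl⟩ y z hz
    have hzy : s z = s y := Subtype.ext (by rw [hsfix z (hz ▸ hsP y), hz])
    exact congrArg (g : e.regPart V → ℂ) hzy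
  · intro hf
    refine ⟨e.projPullback V hPU f, Subtype.ext (funext fun y => ?_)⟩
    exact hf y ⟨_, e.proj_mem_regPart hPU (s y)⟩ (e.proj_eq_self (hsP y))

/-- If a regular map `s` from `U'` to `V'` fixes the regular elements of `𝔥 ⊕ ⨁_P 𝔤_α`, then the
functions `f` on `V'` with `f ∘ s = 0` lie in the ideal of the functions vanishing there. -/
lemma mem_of_pullbackReg_eq_zero (hPV : ∀ y ∈ e.hSum P, y ∈ V) (I : Ideal (e.regFun V))
    (hI : ∀ α ∉ P, e.eHat V (negRoot α) ∈ I) {f : e.regFun V}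
    (hf : e.pullbackReg s hp hs f = 0) : f ∈ I := by
  have h1 : f - e.projPullback V hPV f ∈ I :=
    e.sub_pullbackReg_proj_mem _ (fun y => rfl) _ _ _ hI f
  have h2 : e.projPullback V hPV f = 0 := by
    refine Subtype.ext (funext fun y => ?_)
    rw [projPullback_apply]
    have h3 : (f : e.regPart V → ℂ) (s ⟨_, e.proj_mem_regPart hPU y⟩) = 0 :=
      congrFun (congrArg Subtype.val hf) ⟨_, e.proj_mem_regPart hPU y⟩
    have h4 : s ⟨_, e.proj_mem_regPart hPU y⟩ = ⟨_, e.proj_mem_regPart hPV y⟩ :=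
      Subtype.ext (hsfix _ (e.proj_mem P _))
    rw [h4] at h3
    exact h3
  rwa [h2, sub_zero] at h1

include hsP in
/-- The kernel of the composition with a retraction of `U'` onto the regular part of
`𝔥 ⊕ ⨁_P 𝔤_α` is generated by the coordinate functions that vanish there. -/
lemma ker_pullbackReg (hPV : ∀ y ∈ e.hSum P, y ∈ V) {D : Set H.root}
    (hD : ∀ α ∈ D, negRoot α ∉ P)
    (hVD : ∀ α ∉ P, negRoot α ∉ D → ∀ y ∈ V, e.coef α y = 0) :
    (LinearMap.ker (e.pullbackReg s hp hs).toLinearMap : Set (e.regFun V)) =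
      Ideal.span (e.eHat V '' D) := by
  apply Set.Subset.antisymm
  · intro f hf
    refine e.mem_of_pullbackReg_eq_zero (hp := hp) (hs := hs) hPU hsfix hPV _ (fun α hα => ?_)
      (LinearMap.mem_ker.mp hf)
    by_cases h1 : negRoot α ∈ D
    · exact Ideal.subset_span ⟨_, h1, rfl⟩
    · have h0 : e.eHat V (negRoot α) = 0 := by
        refine Subtype.ext (funext fun y => ?_)
        change e.coef (negRoot (negRoot α)) (y : L) = 0
        rw [negRoot_negRoot]
        exact hVD α hα h1 _ y.2.1
      rw [h0]
      exact Ideal.zero_mem _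
  · change Ideal.span _ ≤ RingHom.ker (e.pullbackReg s hp hs)
    rw [Ideal.span_le]
    rintro _ ⟨α, hα, rfl⟩
    exact Subtype.ext (funext fun y => hsP y (negRoot α) (hD α hα))

end Retraction

end Projection

end RootVectors

lemma LinearMap.apply_eq_of_eq_comp {M₁ M₂ M₃ : Type*} [AddCommMonoid M₁] [Module ℂ M₁]
    [AddCommMonoid M₂] [Module ℂ M₂] [AddCommGroup M₃] [Module ℂ M₃] {T : M₁ →ₗ[ℂ] M₃}
    {A : M₂ →ₗ[ℂ] M₃} {S : M₁ →ₗ[ℂ] M₂} (h : T = A.comp S) {x : M₁} {y : M₂} (hy : S x = y) :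
    T x = A y := by
  rw [h, LinearMap.comp_apply, hy]

lemma RootVectors.mem_coe_borel (e : RootVectors H) (B : (rootSystem H).Base)
    (w : (rootSystem H).weylGroup) (y : L) :
    y ∈ (e.borel B w : Set L) ↔ y ∈ e.hSum (posSystem B w) :=
  SetLike.mem_coe.trans (e.mem_borel B)

lemma RootVectors.mem_coe_borel_one (e : RootVectors H) (B : (rootSystem H).Base) (y : L) :
    y ∈ (e.borel B 1 : Set L) ↔ y ∈ e.hSum {α | B.IsPos α} :=
  SetLike.mem_coe.trans (e.mem_borel_one B)

lemma RootVectors.compose_cons (e : RootVectors H) (Q : ∀ (α : H.root) (l : List H.root),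
      e.regFun (e.borel B (wordProd (α :: l)) : Set L) →ₗ[ℂ]
        e.regFun (e.borel B (wordProd l) : Set L)) (α : H.root) (l : List H.root) :
    e.compose B Q (α :: l) = (e.compose B Q l).comp (Q α l) := rfl

section NormalOrdering

variable {l₁ l₂ : List H.root} (h : IsNormalOrdering B (l₁ ++ l₂))

include h

lemma IsNormalOrdering.isPos {α : H.root} (hα : α ∈ l₂) : B.IsPos α :=
  (h.mem_iff α).mp (List.mem_append_right _ hα)

lemma IsNormalOrdering.posOutside_eq_inter :
    posOutside B l₂ = {α | B.IsPos α} ∩ posSystem B (wordProd l₂) := by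
  ext α
  rw [Set.mem_inter_iff, h.mem_posSystem_wordProd]
  refine ⟨fun hα => ⟨hα.1, Or.inl hα⟩, fun hα => hα.2.resolve_right fun hn => ?_⟩
  exact (isPos_negRoot B).mp (h.isPos hn) hα.1

lemma IsNormalOrdering.mem_inversions_iff (α : H.root) :
    α ∈ l₂ ↔ α ∈ inversions B (wordProd l₂) := by
  rw [mem_inversions, ← mem_posSystem, h.mem_posSystem_wordProd]
  constructor
  · intro hα
    refine ⟨h.isPos hα, ?_⟩
    rintro (h1 | h1)
    · exact h1.2 hα
    · exact (isPos_negRoot B).mp (h.isPos h1) (h.isPos hα)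
  · rintro ⟨h1, h2⟩
    by_contra hα
    exact h2 (Or.inl ⟨h1, hα⟩)

lemma IsNormalOrdering.exists_of_suffix {l : List H.root} (hl : l <:+ l₂) :
    ∃ l' : List H.root, IsNormalOrdering B (l' ++ l) := by
  obtain ⟨t, rfl⟩ := hl
  exact ⟨l₁ ++ t, by rwa [List.append_assoc]⟩

lemma IsNormalOrdering.isStraighteningList : IsStraighteningList B l₂ := by
  refine ⟨(List.nodup_append.mp h.nodup).2.1, fun α hα => h.isPos hα, fun l hl => ?_⟩
  obtain ⟨l', h'⟩ := h.exists_of_suffix hl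
  change IsClosedSet (posOutside B l)
  rw [h'.posOutside_eq_inter]
  exact isClosedSet_pos.inter (isClosedSet_posSystem _)

lemma IsNormalOrdering.posOutside_subset_posSystem :
    posOutside B l₂ ⊆ posSystem B (wordProd l₂) := by
  rw [h.posOutside_eq_inter]
  exact Set.inter_subset_right

end NormalOrdering

section NormalOrderingCons

variable {l₁ l : List H.root} {α : H.root} (h : IsNormalOrdering B (l₁ ++ α :: l))

include h

lemma IsNormalOrdering.tail : IsNormalOrdering B ((l₁ ++ [α]) ++ l) := by simpa using h

lemma IsNormalOrdering.head_mem_posSystem : α ∈ posSystem B (wordProd l) :=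
  h.tail.posOutside_subset_posSystem h.isStraighteningList.head_mem

lemma IsNormalOrdering.posSystem_diff_subset :
    posSystem B (wordProd l) \ {α} ⊆ posSystem B (wordProd (α :: l)) := by
  rintro β ⟨hβ, hne⟩
  rw [h.tail.mem_posSystem_wordProd] at hβ
  rw [h.mem_posSystem_wordProd]
  refine hβ.imp (fun hb => ⟨hb.1, ?_⟩) fun hb => List.mem_cons_of_mem _ hb
  rw [List.mem_cons, not_or]
  exact ⟨hne, hb.2⟩

end NormalOrderingCons

end Pullback

namespace LinearAlgebraicGroup

variable {n : ℕ} (G : LinearAlgebraicGroup n) [IsKilling ℂ G.lie] {H : LieSubalgebra ℂ G.lie}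
  [H.IsCartanSubalgebra] {B : (rootSystem H).Base} (e : RootVectors H)

section Orbits

variable {w : (rootSystem H).weylGroup} {l : List H.root} (hl : IsStraighteningList B l)
  (hmem : ∀ α, α ∈ l ↔ α ∈ inversions B w)

include hl hmem

/-- Elements without components along `l` are fixed by the straightening along `l`. -/
lemma foldr_straighten_eq_self {y : G.lie} (hy : y ∈ e.hSum (posOutside B l))
    (hreg : ∀ β : H.root, e.rootVal β y ≠ 0) : l.foldr (G.straighten e) y = y := by
  have h := G.eq_straightenElt e hl hmem (e.hSum_mono (posOutside_subset l) hy) hreg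
    (Subgroup.one_mem (G.subgroupOf (e.nLower B w))) (by rwa [Ad_one])
  rw [← Ad_straightenElt, ← h, Ad_one]

/-- The straightening along `l` is constant on the orbits of `N_w`. -/
lemma foldr_straighten_Ad {u : G.grp} (hu : u ∈ G.subgroupOf (e.nLower B w)) {y : G.lie}
    (hy : y ∈ e.hSum {α | B.IsPos α}) (hreg : ∀ β : H.root, e.rootVal β y ≠ 0) :
    l.foldr (G.straighten e) (G.Ad u y) = l.foldr (G.straighten e) y := by
  obtain ⟨h1, h2⟩ := G.Ad_mem_borel e w hu hy
  have h3 : G.Ad (G.straightenElt e l (G.Ad u y) * u) y =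
      l.foldr (G.straighten e) (G.Ad u y) := by rw [Ad_mul, Ad_straightenElt]
  have h4 := G.eq_straightenElt e hl hmem hy hreg
    (Subgroup.mul_mem _ (G.straightenElt_mem e (fun α hα => (hmem α).mp hα) (G.Ad u y)) hu) (by
      rw [h3]
      exact (G.foldr_straighten e hl h1 fun β => by
        rw [e.rootVal_eq_of_hPart_eq h2]
        exact hreg β).1)
  rw [← h3, h4, Ad_straightenElt]

end Orbits

/-! ### The operators `Q_w` and `Q_α` -/

section Operators

variable {l₁ l₂ : List H.root} (h : IsNormalOrdering B (l₁ ++ l₂)) {U V : Set G.lie}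
  (hU : ∀ y, y ∈ U ↔ y ∈ e.hSum {α | B.IsPos α})
  (hV : ∀ y, y ∈ V ↔ y ∈ e.hSum (posSystem B (wordProd l₂)))

include h hU

lemma foldr_straighten_mem_hSum (y : e.regPart U) :
    l₂.foldr (G.straighten e) (y : G.lie) ∈ e.hSum (posOutside B l₂) :=
  (G.foldr_straighten e h.isStraighteningList ((hU y).mp y.2.1) y.2.2).1

lemma hPart_foldr_straighten (y : e.regPart U) :
    e.hPart (l₂.foldr (G.straighten e) (y : G.lie)) = e.hPart (y : G.lie) :=
  (G.foldr_straighten e h.isStraighteningList ((hU y).mp y.2.1) y.2.2).2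

lemma foldr_straighten_fix (y : e.regPart U) (hy : (y : G.lie) ∈ e.hSum (posOutside B l₂)) :
    l₂.foldr (G.straighten e) (y : G.lie) = y :=
  G.foldr_straighten_eq_self e h.isStraighteningList h.mem_inversions_iff hy y.2.2

lemma mem_invariants_iff (f : e.regFun U) :
    f ∈ G.invariants e U (G.subgroupOf (e.nLower B (wordProd l₂))) ↔
      ∀ y z : e.regPart U, (z : G.lie) = l₂.foldr (G.straighten e) (y : G.lie) →
        (f : e.regPart U → ℂ) z = (f : e.regPart U → ℂ) y := by
  constructor
  · intro hf y z hz
    refine hf (G.straightenElt e l₂ y) (G.straightenElt_mem e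
      (fun α hα => (h.mem_inversions_iff α).mp hα) y) y z ?_
    rw [Ad_straightenElt]
    exact hz
  · intro hf u hu y z hz
    -- `f` takes at `y` and at `z` its value at their common straightening
    have hyz : l₂.foldr (G.straighten e) (z : G.lie) = l₂.foldr (G.straighten e) (y : G.lie) := by
      rw [hz, G.foldr_straighten_Ad e h.isStraighteningList h.mem_inversions_iff hu
        ((hU y).mp y.2.1) y.2.2]
    have hx : l₂.foldr (G.straighten e) (y : G.lie) ∈ e.regPart U :=
      ⟨(hU _).mpr (e.hSum_mono (posOutside_subset l₂) (G.foldr_straighten_mem_hSum e h hU y)),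
        fun α => by
          rw [e.rootVal_eq_of_hPart_eq (G.hPart_foldr_straighten e h hU y)]
          exact y.2.2 α⟩
    exact (hf z ⟨_, hx⟩ hyz.symm).symm.trans (hf y ⟨_, hx⟩ rfl)

include hV

lemma foldr_straighten_mem_regPart (y : e.regPart U) :
    l₂.foldr (G.straighten e) (y : G.lie) ∈ e.regPart V :=
  ⟨(hV _).mpr (e.hSum_mono h.posOutside_subset_posSystem (G.foldr_straighten_mem_hSum e h hU y)),
    fun α => by
      rw [e.rootVal_eq_of_hPart_eq (G.hPart_foldr_straighten e h hU y)]
      exact y.2.2 α⟩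

/-- The operator `Q_w`: the composition with the straightening along the list `l₂`. The sets `U` and
`V` stand for the Borel subalgebras `𝔟` and `𝔟^w`. -/
def opQ : e.regFun V →ₐ[ℂ] e.regFun U :=
  e.pullbackReg (fun y => ⟨l₂.foldr (G.straighten e) (y : G.lie),
      G.foldr_straighten_mem_regPart e h hU hV y⟩) (G.hPart_foldr_straighten e h hU)
    (G.linear_foldr_straighten_mem e _ e.linear_mem_regFun e.inv_rootVal_mem_regFun
      (fun y => (hU y).mp y.2.1) (fun y => y.2.2) h.isStraighteningList)

lemma opQ_apply (f : e.regFun V) (y : e.regPart U) :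
    (G.opQ e h hU hV f : e.regPart U → ℂ) y = (f : e.regPart V → ℂ)
      ⟨l₂.foldr (G.straighten e) y, G.foldr_straighten_mem_regPart e h hU hV y⟩ :=
  e.pullbackReg_apply _ _ _ f y

/-- The image of `Q_w` consists of the invariants of `N_w`: the straightening map moves each point
along its `N_w`-orbit and fixes the straightened points. -/
theorem range_opQ : LinearMap.range (G.opQ e h hU hV).toLinearMap =
    G.invariants e U (G.subgroupOf (e.nLower B (wordProd l₂))) :=
  Submodule.ext fun f => (e.mem_range_pullbackReg
    (fun y hy => (hU y).mpr (e.hSum_mono (posOutside_subset l₂) hy))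
    (G.foldr_straighten_mem_hSum e h hU) (G.foldr_straighten_fix e h hU)).trans
      (G.mem_invariants_iff e h hU f).symm

/-- The straightening maps onto the points of `(b^w)'` at which all `ê_α`, `α ∈ Δ_w`, vanish, so the
kernel of `Q_w` consists of the functions that vanish at these points. -/
theorem ker_opQ : (LinearMap.ker (G.opQ e h hU hV).toLinearMap : Set (e.regFun V)) =
    Ideal.span (e.eHat V '' inversions B (wordProd l₂)) :=
  e.ker_pullbackReg (fun y hy => (hU y).mpr (e.hSum_mono (posOutside_subset l₂) hy))
    (G.foldr_straighten_mem_hSum e h hU) (G.foldr_straighten_fix e h hU)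
    (fun y hy => (hV y).mpr (e.hSum_mono h.posOutside_subset_posSystem hy))
    (fun _ hα hn => (isPos_negRoot B).mp hn.1 hα.1)
    (fun α hα hn y hy => (hV y).mp hy α fun hαw =>
      ((h.mem_posSystem_wordProd α).mp hαw).elim hα fun h1 => hn ((h.mem_inversions_iff _).mp h1))

end Operators

section Factors

variable {l₁ l : List H.root} {α : H.root} (h : IsNormalOrdering B (l₁ ++ α :: l))
  {V W : Set G.lie} (hV : ∀ y, y ∈ V ↔ y ∈ e.hSum (posSystem B (wordProd l)))
  (hW : ∀ y, y ∈ W ↔ y ∈ e.hSum (posSystem B (wordProd (α :: l))))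

include h hV

lemma hPart_straighten_of_mem (y : e.regPart V) :
    e.hPart (G.straighten e α (y : G.lie)) = e.hPart (y : G.lie) :=
  G.hPart_straighten e h.isStraighteningList.isPos_head (isClosedSet_posSystem _)
    h.head_mem_posSystem (negRoot_notMem_posSystem _ h.head_mem_posSystem) ((hV y).mp y.2.1)

include hW

lemma straighten_mem_regPart (y : e.regPart V) :
    G.straighten e α (y : G.lie) ∈ e.regPart W := by
  refine ⟨(hW _).mpr (e.hSum_mono h.posSystem_diff_subset
    (G.straighten_mem e h.isStraighteningList.isPos_head (isClosedSet_posSystem _)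
      h.head_mem_posSystem (negRoot_notMem_posSystem _ h.head_mem_posSystem) ((hV y).mp y.2.1)
      (y.2.2 α))), fun β => ?_⟩
  rw [e.rootVal_eq_of_hPart_eq (G.hPart_straighten_of_mem e h hV y)]
  exact y.2.2 β

/-- The operator `Q_α`: the composition with the straightening along `α`. The sets `V` and `W` stand
for the Borel subalgebras `𝔟^{wordProd l}` and `𝔟^{wordProd (α :: l)}`. -/
def factorQ : e.regFun W →ₐ[ℂ] e.regFun V :=
  e.pullbackReg
    (fun y => ⟨G.straighten e α (y : G.lie), G.straighten_mem_regPart e h hV hW y⟩)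
    (G.hPart_straighten_of_mem e h hV)
    (fun ℓ => by
      simp only [G.straighten_eq_adExp e h.isStraighteningList.isPos_head]
      exact RootVectors.linear_adExp_mem _ _ e.linear_mem_regFun
        (G.straighten_param_mem e _ e.linear_mem_regFun e.inv_rootVal_mem_regFun α) _ ℓ)

lemma factorQ_apply (f : e.regFun W) (y : e.regPart V) :
    (G.factorQ e h hV hW f : e.regPart V → ℂ) y = (f : e.regPart W → ℂ)
      ⟨G.straighten e α y, G.straighten_mem_regPart e h hV hW y⟩ :=
  e.pullbackReg_apply _ _ _ f y

/-- Taylor's formula for the straightening along `e_α`: `-κ(e_α, e_{-α})` times the bracket with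
`ê_α` is the derivation along `ad e_α`. -/
theorem factorQ_eq_sum_seriesTerm {κ : LinearMap.BilinForm ℂ G.lie} (hκ_symm : κ.IsSymm)
    (hκ : κ.Nondegenerate) (hκ_inv : κ.lieInvariant G.lie) (f : e.regFun W)
    {φ : e.regPart (Set.univ : Set G.lie) → ℂ} (hφ : φ ∈ e.regFun (Set.univ : Set G.lie))
    (hf : e.Represents φ (f : e.regPart W → ℂ)) {g : e.regFun V}
    (hg : g = G.factorQ e h hV hW f) :
    ∃ M : ℕ, ∀ m ≥ M, ∀ y : e.regPart V, (g : e.regPart V → ℂ) y =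
      ∑ i ∈ Finset.range m, e.seriesTerm κ hκ α φ i ⟨y, trivial, y.2.2⟩ := by
  obtain ⟨M, hM⟩ := e.exists_sum_seriesTerm_eq hκ (isClosedSet_posSystem (wordProd l))
    h.head_mem_posSystem (negRoot_notMem_posSystem _ h.head_mem_posSystem) hκ_symm hκ_inv hφ
  refine ⟨M, fun m hm y => ?_⟩
  rw [hM m hm y ((hV y).mp y.2.1) y.2.2, hg, factorQ_apply]
  refine (hf ⟨G.straighten e α (y : G.lie), G.straighten_mem_regPart e h hV hW y⟩).symm.trans ?_
  congr 2
  exact G.straighten_eq_adExp e h.isStraighteningList.isPos_head _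

lemma opQ_factorQ {U : Set G.lie} (hU : ∀ y, y ∈ U ↔ y ∈ e.hSum {α | B.IsPos α})
    (f : e.regFun W) :
    G.opQ e h.tail hU hV (G.factorQ e h hV hW f) = G.opQ e h hU hW f :=
  e.pullbackReg_pullbackReg (fun _ => rfl) f

end Factors

section Composition

/-- If the operators `Q α l` are the compositions with the straightenings along `α`, then their
composition is the composition with the straightening along the whole list. -/
lemma compose_eq_opQ {l₂ : List H.root} (Q : ∀ (α : H.root) (l : List H.root),
      e.regFun (e.borel B (wordProd (α :: l)) : Set G.lie) →ₗ[ℂ]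
        e.regFun (e.borel B (wordProd l) : Set G.lie))
    (hQ : ∀ α l, α :: l <:+ l₂ → ∀ l', ∀ h' : IsNormalOrdering B (l' ++ α :: l), ∀ f,
      Q α l f = G.factorQ e h' (e.mem_coe_borel B _) (e.mem_coe_borel B _) f)
    (l : List H.root) (hl : l <:+ l₂) (l' : List H.root) (h' : IsNormalOrdering B (l' ++ l))
    (f : e.regFun (e.borel B (wordProd l) : Set G.lie)) :
    e.compose B Q l f =
      G.opQ e h' (e.mem_coe_borel_one B) (e.mem_coe_borel B _) f := by
  induction l generalizing l' with
  | nil => rfl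
  | cons α l ih =>
    exact (LinearMap.apply_eq_of_eq_comp (e.compose_cons Q α l) (hQ α l hl l' h' f)).trans
      ((ih ((List.suffix_cons α l).trans hl) _ h'.tail _).trans (G.opQ_factorQ e h' _ _ _ f))

end Composition

end LinearAlgebraicGroup

end

end Zhelobenko

theorem proposition5 {n : ℕ} (G : Zhelobenko.LinearAlgebraicGroup n)
    [LieAlgebra.HasTrivialRadical ℂ G.lie]
    (H : LieSubalgebra ℂ G.lie) [H.IsCartanSubalgebra]
    (B : (LieAlgebra.IsKilling.rootSystem H).Base)
    (e : Zhelobenko.RootVectors H)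
    (κ : LinearMap.BilinForm ℂ G.lie) (hκ_symm : κ.IsSymm) (hκ : κ.Nondegenerate)
    (hκ_inv : κ.lieInvariant G.lie) :
    -- the birational equivalence, for every `w` in the Weyl group
    (∀ w : (LieAlgebra.IsKilling.rootSystem H).weylGroup,
      ∃ φ : G.subgroupOf (e.nLower B w) × e.hPlusNOne B w → e.borel B 1,
        (∀ u x, (φ (u, x) : G.lie) = G.Ad u x) ∧
        Zhelobenko.IsBirationalEquiv
          (G.prodFun (G.subgroupOf (e.nLower B w)) (e.hPlusNOne B w))
          (Zhelobenko.polyFun (e.borel B 1)) φ) ∧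
    -- the operator `Q_w`, for a normal ordering `l₁ ++ l₂` with `w = wordProd l₂`
    (∀ l₁ l₂ : List H.root, Zhelobenko.IsNormalOrdering B (l₁ ++ l₂) →
      ∃ hmem : ∀ y ∈ e.regPart (e.borel B 1 : Set G.lie),
        l₂.foldr (G.straighten e) y ∈
          e.regPart (e.borel B (Zhelobenko.wordProd l₂) : Set G.lie),
      ∃ Qw : e.regFun (e.borel B (Zhelobenko.wordProd l₂) : Set G.lie) →ₗ[ℂ]
          e.regFun (e.borel B 1 : Set G.lie),
        (∀ f (y : e.regPart (e.borel B 1 : Set G.lie)),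
          (Qw f : e.regPart (e.borel B 1 : Set G.lie) → ℂ) y =
            (f : e.regPart (e.borel B (Zhelobenko.wordProd l₂) : Set G.lie) → ℂ)
              ⟨l₂.foldr (G.straighten e) y, hmem y y.2⟩) ∧
        LinearMap.range Qw =
          G.invariants e (e.borel B 1)
            (G.subgroupOf (e.nLower B (Zhelobenko.wordProd l₂))) ∧
        (LinearMap.ker Qw : Set (e.regFun (e.borel B (Zhelobenko.wordProd l₂) : Set G.lie))) =
          Ideal.span (e.eHat (e.borel B (Zhelobenko.wordProd l₂)) ''
            Zhelobenko.inversions B (Zhelobenko.wordProd l₂)) ∧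
        ∃ Q : ∀ (α : H.root) (l : List H.root),
            e.regFun (e.borel B (Zhelobenko.wordProd (α :: l)) : Set G.lie) →ₗ[ℂ]
              e.regFun (e.borel B (Zhelobenko.wordProd l) : Set G.lie),
          (∀ α l, α :: l <:+ l₂ →
            ∀ f : e.regFun (e.borel B (Zhelobenko.wordProd (α :: l)) : Set G.lie),
            ∀ φ ∈ e.regFun (Set.univ : Set G.lie),
              e.Represents φ
                (f : e.regPart (e.borel B (Zhelobenko.wordProd (α :: l)) : Set G.lie) → ℂ) →
              ∃ M : ℕ, ∀ m ≥ M, ∀ y : e.regPart (e.borel B (Zhelobenko.wordProd l) : Set G.lie),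
                (Q α l f : e.regPart (e.borel B (Zhelobenko.wordProd l) : Set G.lie) → ℂ) y =
                  ∑ i ∈ Finset.range m, e.seriesTerm κ hκ α φ i ⟨y, trivial, y.2.2⟩) ∧
          Qw = e.compose B Q l₂) := by
  classical
  refine ⟨fun w => ⟨G.adjointMap e w, fun _ _ => rfl, G.isBirationalEquiv_adjointMap e w⟩,
    fun l₁ l₂ h => ?_⟩
  have hU := e.mem_coe_borel_one B
  have hV := e.mem_coe_borel B (Zhelobenko.wordProd l₂)
  have hs : ∀ α l, α :: l <:+ l₂ → ∃ l', Zhelobenko.IsNormalOrdering B (l' ++ α :: l) :=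
    fun α l hl => h.exists_of_suffix hl
  let Q : ∀ (α : H.root) (l : List H.root),
      e.regFun (e.borel B (Zhelobenko.wordProd (α :: l)) : Set G.lie) →ₗ[ℂ]
        e.regFun (e.borel B (Zhelobenko.wordProd l) : Set G.lie) := fun α l =>
    if hl : α :: l <:+ l₂ then
      (G.factorQ e (hs α l hl).choose_spec (e.mem_coe_borel B _) (e.mem_coe_borel B _)).toLinearMap
    else 0
  have hQ : ∀ α l, α :: l <:+ l₂ → ∀ l', ∀ h' : Zhelobenko.IsNormalOrdering B (l' ++ α :: l),
      ∀ f, Q α l f = G.factorQ e h' (e.mem_coe_borel B _) (e.mem_coe_borel B _) f := by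
    intro α l hl l' h' f
    exact LinearMap.congr_fun (dif_pos hl : Q α l = (G.factorQ e (hs α l hl).choose_spec
      (e.mem_coe_borel B _) (e.mem_coe_borel B _)).toLinearMap) f
  refine ⟨fun y hy => G.foldr_straighten_mem_regPart e h hU hV ⟨y, hy⟩,
    (G.opQ e h hU hV).toLinearMap, G.opQ_apply e h hU hV, G.range_opQ e h hU hV,
    G.ker_opQ e h hU hV, Q, fun α l hl f φ hφ hf => ?_, ?_⟩
  · exact G.factorQ_eq_sum_seriesTerm e (hs α l hl).choose_spec (e.mem_coe_borel B _)
      (e.mem_coe_borel B _) hκ_symm hκ hκ_inv f hφ hf (hQ α l hl _ _ f)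
  · exact LinearMap.ext fun f => (G.compose_eq_opQ e Q hQ l₂ List.suffix_rfl l₁ h f).symm
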